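/- All operads are symmetric operads in the category of abelian groups, and $\mathbb N=\{0,1,2,\dots\}$. \textbf{The operad $B$.} For $l,n,k_1,\dots,k_n\ge 0$, an $(l;k_1,\dots,k_n)$-tree is a planar rooted tree whose legs (input edges) are labelled bijectively by $1,\dots,l$ and whose vertices are: white vertices labelled bijectively by $1,\dots,n$, the $i$-th of arity $k_i$; black vertices of arity $\ge 2$; and special vertices of arity $0$; such that no edge connects two black vertices or a black vertex with a special vertex. For $n=0$ the two exceptional trees, consisting of one leg only ($l=1$) and of one special vertex only ($l=0$), are allowed. Let $B^l_{k_1,\dots,k_n}$ be the free abelian group on the set of $(l;k_1,\dots,k_n)$-trees. The composition replaces the $i$-th white vertex of a tree by a tree with $k_i$ legs, the $j$-th input of the vertex being connected to the leg labelled $j$, and then reduces the result: edges between black vertices are collapsed, a special vertex attached to a black vertex is deleted (lowering the arity of the black vertex by one), a black vertex of arity $1$ is erased, and a black vertex of arity $0$ becomes a special vertex. The symmetric groups relabel the white vertices. \textbf{The operad $\check B$.} Consider the pairs $(V,M)$ of an additive symmetric monoidal category $V$ (that is, a symmetric monoidal category enriched in abelian groups with biadditive $\otimes$; direct sums are not required)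 and a unital monoid $M$ in $V$. A morphism $(V,M)\to(W,N)$ is an additive (strong) symmetric monoidal functor $F:V\to W$ together with an isomorphism of monoids $F(M)\cong N$; it induces maps $V(M^{\otimes k},M)\to W(N^{\otimes k},N)$, where $M^{\otimes 0}$ is the unit object. Let $\check B^l_{k_1,\dots,k_n}$ be the abelian group of families of linear maps \[ \alpha_{(V,M)}:V(M^{\otimes k_1},M)\otimes\cdots\otimes V(M^{\otimes k_n},M)\longrightarrow V(M^{\otimes l},M), \] indexed by all pairs $(V,M)$ and natural with respect to all morphisms of pairs. These groups carry the composition of multilinear maps and the permutation of the inputs. \textbf{Theorem.} $B$ and $\check B$ are $\mathbb N$-coloured operads, and they are naturally isomorphic as $\mathbb N$-coloured operads. The isomorphism $B\to\check B$ sends an $(l;k_1,\dots,k_n)$-tree $T$ to the family of operations $O_T$ which assigns to $f_i\in V(M^{\otimes k_i},M)$, $1\le i\le n$, the morphism $M^{\otimes l}\to M$ obtained by decorating the $i$-th white vertex of $T$ by $f_i$, the black vertices by the iterated multiplications of $M$ and the special vertices by the unit of $M$, and composing along $T$, the $a$-th factor of $M^{\otimes l}$ being fed into the leg labelled $a$.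 -/

import Mathlib

open CategoryTheory MonoidalCategory

universe u v w w₁ w₂

/-! ## Symmetric coloured operads in abelian groups -/

/-- The data of a symmetric operad in abelian groups with set of colours `C`. Inputs are indexed by
arbitrary finite types: for `k : I → C`, the group `obj l k` consists of the operations with one
input of colour `k i` for every `i : I` and with output of colour `l`. For `I = Fin n` it is the
component of type `(l; k₁, …, kₙ)`, and `relabel` along the permutations of `Fin n` is the symmetric
group action. `comp` is the simultaneous composition into all inputs. -/
structure OperadData (C : Type) where
  obj (l : C) {I : Type} [Finite I] (k : I → C) : Type w
  grp (l : C) {I : Type} [Finite I] (k : I → C) : AddCommGroup (obj l k)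
  relabel {l : C} {I J : Type} [Finite I] [Finite J] (e : I ≃ J) (k : J → C) :
    obj l (fun i => k (e i)) → obj l k
  unit (c : C) : obj c (fun _ : Unit => c)
  comp {l : C} {I : Type} [Finite I] {k : I → C} {J : I → Type} [∀ i, Finite (J i)]
    {m : ∀ i, J i → C} (f : obj l k) (g : ∀ i, obj (k i) (m i)) :
    obj l (fun p : Σ i, J i => m p.1 p.2)

namespace OperadData

attribute [instance] OperadData.grp

/-- The axioms of a symmetric coloured operad in abelian groups. -/
structure IsOperad {C : Type} (P : OperadData.{w} C) : Prop where
  relabel_add {l : C} {I J : Type} [Finite I] [Finite J] (e : I ≃ J) (k : J → C)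
    (f g : P.obj l (fun i => k (e i))) :
    P.relabel e k (f + g) = P.relabel e k f + P.relabel e k g
  relabel_refl {l : C} {I : Type} [Finite I] (k : I → C) (f : P.obj l k) :
    P.relabel (Equiv.refl I) k f = f
  relabel_trans {l : C} {I J K : Type} [Finite I] [Finite J] [Finite K] (e : I ≃ J) (e' : J ≃ K)
    (k : K → C) (f : P.obj l (fun i => k (e' (e i)))) :
    P.relabel (e.trans e') k f = P.relabel e' k (P.relabel e (fun j => k (e' j)) f)
  comp_add_left {l : C} {I : Type} [Finite I] {k : I → C} {J : I → Type} [∀ i, Finite (J i)]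
    {m : ∀ i, J i → C} (f f' : P.obj l k) (g : ∀ i, P.obj (k i) (m i)) :
    P.comp (f + f') g = P.comp f g + P.comp f' g
  comp_add_right {l : C} {I : Type} [Finite I] [DecidableEq I] {k : I → C} {J : I → Type}
    [∀ i, Finite (J i)] {m : ∀ i, J i → C} (f : P.obj l k) (g : ∀ i, P.obj (k i) (m i)) (i : I)
    (a b : P.obj (k i) (m i)) :
    P.comp f (Function.update g i (a + b)) =
      P.comp f (Function.update g i a) + P.comp f (Function.update g i b)
  comp_relabel_left {l : C} {I I' : Type} [Finite I] [Finite I'] (e : I ≃ I') {k : I' → C}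
    {J : I' → Type} [∀ i, Finite (J i)] {m : ∀ i, J i → C} (f : P.obj l (fun i => k (e i)))
    (g : ∀ i, P.obj (k i) (m i)) :
    P.comp (P.relabel e k f) g =
      P.relabel (Equiv.sigmaCongrLeft e) (fun p : Σ i, J i => m p.1 p.2)
        (P.comp f (fun i => g (e i)))
  comp_relabel_right {l : C} {I : Type} [Finite I] {k : I → C} {J J' : I → Type}
    [∀ i, Finite (J i)] [∀ i, Finite (J' i)] (e : ∀ i, J i ≃ J' i) {m : ∀ i, J' i → C}
    (f : P.obj l k) (g : ∀ i, P.obj (k i) (fun j => m i (e i j))) :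
    P.comp f (fun i => P.relabel (e i) (m i) (g i)) =
      P.relabel (Equiv.sigmaCongrRight e) (fun p : Σ i, J' i => m p.1 p.2) (P.comp f g)
  unit_comp {l : C} {I : Type} [Finite I] {k : I → C} (f : P.obj l k) :
    P.relabel (Equiv.uniqueSigma (fun _ : Unit => I)) k
      (P.comp (P.unit l) (fun _ : Unit => f)) = f
  comp_unit {l : C} {I : Type} [Finite I] {k : I → C} (f : P.obj l k) :
    P.relabel (Equiv.sigmaUnique I (fun _ => Unit)) k (P.comp f (fun i => P.unit (k i))) = f
  assoc {l : C} {I : Type} [Finite I] {k : I → C} {J : I → Type} [∀ i, Finite (J i)]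
    {m : ∀ i, J i → C} {K : ∀ i, J i → Type} [∀ i j, Finite (K i j)] {n : ∀ i j, K i j → C}
    (f : P.obj l k) (g : ∀ i, P.obj (k i) (m i)) (h : ∀ i j, P.obj (m i j) (n i j)) :
    P.relabel (Equiv.sigmaAssoc K) (fun q : Σ i, Σ j, K i j => n q.1 q.2.1 q.2.2)
        (P.comp (P.comp f g) (fun p : Σ i, J i => h p.1 p.2)) =
      P.comp f (fun i => P.comp (g i) (h i))

/-- An isomorphism of coloured operads, identical on colours. -/
structure Iso {C : Type} (P : OperadData.{w₁} C) (Q : OperadData.{w₂} C) where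
  equiv (l : C) {I : Type} [Finite I] (k : I → C) : P.obj l k ≃+ Q.obj l k
  map_relabel {l : C} {I J : Type} [Finite I] [Finite J] (e : I ≃ J) (k : J → C)
    (f : P.obj l (fun i => k (e i))) :
    equiv l k (P.relabel e k f) = Q.relabel e k (equiv l _ f)
  map_unit (c : C) : equiv c _ (P.unit c) = Q.unit c
  map_comp {l : C} {I : Type} [Finite I] {k : I → C} {J : I → Type} [∀ i, Finite (J i)]
    {m : ∀ i, J i → C} (f : P.obj l k) (g : ∀ i, P.obj (k i) (m i)) :
    equiv l _ (P.comp f g) = Q.comp (equiv l k f) (fun i => equiv (k i) (m i) (g i))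

end OperadData

/-! ## Trees -/

/-- Concatenation of finitely many lists. -/
def catLists {α : Type} : (n : ℕ) → (Fin n → List α) → List α
  | 0, _ => []
  | n + 1, L => L 0 ++ catLists n (fun i => L i.succ)

/-- Planar trees whose legs carry labels in `Fin l` and whose vertices are white (labelled by
`i : I`, with `k i` ordered inputs), black, or special (without inputs). A tree is given by its
root: `leg a` is the tree without vertices whose only edge is the leg `a`. -/
inductive RawTree (l : ℕ) {I : Type} (k : I → ℕ) : Type
  | leg (a : Fin l) : RawTree l k
  | white (i : I) (ch : Fin (k i) → RawTree l k) : RawTree l k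
  | black (n : ℕ) (ch : Fin n → RawTree l k) : RawTree l k
  | special : RawTree l k

namespace RawTree

variable {l : ℕ} {I : Type} {k : I → ℕ}

/-- The labels of the legs, from left to right. -/
def legs : RawTree l k → List (Fin l)
  | leg a => [a]
  | white i ch => catLists (k i) (fun x => (ch x).legs)
  | black n ch => catLists n (fun x => (ch x).legs)
  | special => []

/-- The labels of the white vertices. -/
def whites : RawTree l k → List I
  | leg _ => []
  | white i ch => i :: catLists (k i) (fun x => (ch x).whites)
  | black n ch => catLists n (fun x => (ch x).whites)
  | special => []

/-- The root vertex exists and is black or special. -/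
def RootBlackOrSpecial : RawTree l k → Prop
  | black _ _ => True
  | special => True
  | _ => False

/-- Black vertices have arity at least two, and no edge connects two black vertices or a black
vertex with a special vertex. -/
def IsReduced : RawTree l k → Prop
  | leg _ => True
  | white _ ch => ∀ x, (ch x).IsReduced
  | black n ch => 2 ≤ n ∧ ∀ x, ¬ (ch x).RootBlackOrSpecial ∧ (ch x).IsReduced
  | special => True

/-- The conditions for an `(l; k)`-tree: legs are labelled bijectively by `Fin l`, white vertices
bijectively by `I`, and the tree is reduced. (For empty `I` this includes the two exceptional trees:
the single leg, for `l = 1`, and the single special vertex, for `l = 0`.) -/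
structure IsOpTree (T : RawTree l k) : Prop where
  reduced : T.IsReduced
  legs_nodup : T.legs.Nodup
  mem_legs : ∀ a, a ∈ T.legs
  whites_nodup : T.whites.Nodup
  mem_whites : ∀ i, i ∈ T.whites

/-- The trees that a subtree contributes when it is attached to a black vertex: the edge between two
black vertices is collapsed, and a special vertex is absorbed. -/
def factors : RawTree l k → List (RawTree l k)
  | black _ ch => List.ofFn ch
  | special => []
  | T => [T]

/-- Join a list of trees by a black vertex; no vertex is needed for one tree, and the empty list
gives the special vertex. -/
def joinFactors : List (RawTree l k) → RawTree l k
  | [] => special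
  | [T] => T
  | S :: T :: L => black (L.length + 2) (S :: T :: L).get

/-- Attach trees to a black vertex and reduce. -/
def mkBlack (n : ℕ) (ch : Fin n → RawTree l k) : RawTree l k :=
  joinFactors (catLists n (fun x => (ch x).factors))

/-- Relabel the white vertices. -/
def relabel {J : Type} (e : I ≃ J) (k : J → ℕ) : RawTree l (fun i => k (e i)) → RawTree l k
  | leg a => leg a
  | white i ch => white (e i) (fun x => (ch x).relabel e k)
  | black n ch => black n (fun x => (ch x).relabel e k)
  | special => special

/-- Replace the leg `a` of a tree by the tree `sub a`, and the label `j` by `⟨i, j⟩`; then reduce. -/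
def graft {J : I → Type} {m : ∀ i, J i → ℕ} (i : I) {n : ℕ}
    (sub : Fin n → RawTree l (fun p : Σ i, J i => m p.1 p.2)) :
    RawTree n (m i) → RawTree l (fun p : Σ i, J i => m p.1 p.2)
  | leg a => sub a
  | white j ch => white (k := fun p : Σ i, J i => m p.1 p.2) ⟨i, j⟩ (fun x => (ch x).graft i sub)
  | black r ch => mkBlack r (fun x => (ch x).graft i sub)
  | special => special

/-- Replace every white vertex `i` of a tree by the tree `S i`, the inputs of the vertex being
connected to the legs of `S i` with the same number; then reduce. -/
def insert {J : I → Type} {m : ∀ i, J i → ℕ} (S : ∀ i, RawTree (k i) (m i)) :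
    RawTree l k → RawTree l (fun p : Σ i, J i => m p.1 p.2)
  | leg a => leg a
  | white i ch => (S i).graft i (fun x => (ch x).insert S)
  | black n ch => mkBlack n (fun x => (ch x).insert S)
  | special => special

/-- The tree with one vertex, which is white, and with its legs in the natural order. -/
def corolla (c : ℕ) : RawTree c (fun _ : Unit => c) := white () leg

end RawTree

namespace RawTree

section Lemmas

variable {l : ℕ} {I : Type} {k : I → ℕ}

theorem catLists_eq {α : Type} (n : ℕ) (L : Fin n → List α) :
    catLists n L = (List.ofFn L).flatten := by
  induction n with
  | zero => simp [catLists]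
  | succ n ih => simp [catLists, ih, List.ofFn_succ]

theorem count_catLists {α : Type} [DecidableEq α] (n : ℕ) (L : Fin n → List α) (a : α) :
    (catLists n L).count a = ∑ x, (L x).count a := by
  induction n with
  | zero => simp [catLists]
  | succ n ih => simp [catLists, ih, Fin.sum_univ_succ]

theorem catLists_get {α β : Type} (f : α → List β) (L : List α) :
    catLists L.length (fun x => f (L.get x)) = L.flatMap f := by
  rw [catLists_eq, List.flatMap_def]
  congr 1
  apply List.ext_get <;> simp

theorem flatMap_catLists {α β : Type} (f : α → List β) (n : ℕ) (L : Fin n → List α) :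
    (catLists n L).flatMap f = catLists n (fun x => (L x).flatMap f) := by
  induction n with
  | zero => simp [catLists]
  | succ n ih => simp [catLists, ih]

theorem flatMap_ofFn {α β : Type} (f : α → List β) (n : ℕ) (L : Fin n → α) :
    (List.ofFn L).flatMap f = catLists n (fun x => f (L x)) := by
  rw [catLists_eq, List.flatMap_def, List.map_ofFn]; rfl

theorem mem_catLists {α : Type} {n : ℕ} {L : Fin n → List α} {a : α} :
    a ∈ catLists n L ↔ ∃ x, a ∈ L x := by
  induction n with
  | zero => simp [catLists]
  | succ n ih => simp [catLists, ih, Fin.exists_fin_succ]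

theorem flatMap_factors_legs (T : RawTree l k) : T.factors.flatMap legs = T.legs := by
  cases T <;> simp [factors, flatMap_ofFn, legs]

theorem flatMap_factors_whites (T : RawTree l k) : T.factors.flatMap whites = T.whites := by
  cases T <;> simp [factors, flatMap_ofFn, whites]

theorem legs_joinFactors (L : List (RawTree l k)) : (joinFactors L).legs = L.flatMap legs := by
  match L with
  | [] => simp [joinFactors, legs]
  | [T] => simp [joinFactors]
  | S :: T :: L => exact catLists_get legs (S :: T :: L)

theorem whites_joinFactors (L : List (RawTree l k)) :
    (joinFactors L).whites = L.flatMap whites := by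
  match L with
  | [] => simp [joinFactors, whites]
  | [T] => simp [joinFactors]
  | S :: T :: L => exact catLists_get whites (S :: T :: L)

theorem legs_mkBlack (n : ℕ) (ch : Fin n → RawTree l k) :
    (mkBlack n ch).legs = catLists n (fun x => (ch x).legs) := by
  simp [mkBlack, legs_joinFactors, flatMap_catLists, flatMap_factors_legs]

theorem whites_mkBlack (n : ℕ) (ch : Fin n → RawTree l k) :
    (mkBlack n ch).whites = catLists n (fun x => (ch x).whites) := by
  simp [mkBlack, whites_joinFactors, flatMap_catLists, flatMap_factors_whites]

theorem isReduced_mkBlack (n : ℕ) (ch : Fin n → RawTree l k) (h : ∀ x, (ch x).IsReduced) :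
    (mkBlack n ch).IsReduced := by
  have key : ∀ T : RawTree l k, T.IsReduced →
      ∀ S ∈ T.factors, ¬ S.RootBlackOrSpecial ∧ S.IsReduced := by
    intro T hT S hS
    cases T with
    | leg a => simp only [factors, List.mem_singleton] at hS; subst hS; exact ⟨id, hT⟩
    | white i ch => simp only [factors, List.mem_singleton] at hS; subst hS; exact ⟨id, hT⟩
    | black n ch =>
      simp only [factors, List.mem_ofFn] at hS
      obtain ⟨x, rfl⟩ := hS
      exact hT.2 x
    | special => simp [factors] at hS
  have hL : ∀ S ∈ catLists n (fun x => (ch x).factors), ¬ S.RootBlackOrSpecial ∧ S.IsReduced := by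
    intro S hS
    obtain ⟨x, hx⟩ := mem_catLists.1 hS
    exact key _ (h x) S hx
  unfold mkBlack
  generalize catLists n (fun x => (ch x).factors) = L at hL
  match L, hL with
  | [], _ => trivial
  | [T], hL => exact (hL T (by simp)).2
  | S :: T :: L, hL => exact ⟨by omega, fun x => hL _ (List.get_mem (S :: T :: L) x)⟩

theorem isOpTree_iff [DecidableEq I] (T : RawTree l k) :
    T.IsOpTree ↔ T.IsReduced ∧ (∀ a, T.legs.count a = 1) ∧ ∀ i, T.whites.count i = 1 := by
  constructor
  · intro h
    exact ⟨h.reduced, fun a => List.count_eq_one_of_mem h.legs_nodup (h.mem_legs a),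
      fun i => List.count_eq_one_of_mem h.whites_nodup (h.mem_whites i)⟩
  · rintro ⟨h, h1, h2⟩
    exact ⟨h, List.nodup_iff_count_le_one.2 fun a => (h1 a).le,
      fun a => List.count_pos_iff.1 (by simp [h1]), List.nodup_iff_count_le_one.2 fun a => (h2 a).le,
      fun a => List.count_pos_iff.1 (by simp [h2])⟩

section Relabel

variable {J : Type} (e : I ≃ J) (k : J → ℕ)

theorem legs_relabel (T : RawTree l (fun i => k (e i))) : (T.relabel e k).legs = T.legs := by
  induction T with
  | leg a => rfl
  | white i ch ih => simp only [relabel, legs, ih]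
  | black n ch ih => simp only [relabel, legs, ih]
  | special => rfl

theorem map_catLists {α β : Type} (f : α → β) (n : ℕ) (L : Fin n → List α) :
    (catLists n L).map f = catLists n (fun x => (L x).map f) := by
  induction n with
  | zero => rfl
  | succ n ih => simp [catLists, ih]

theorem whites_relabel (T : RawTree l (fun i => k (e i))) :
    (T.relabel e k).whites = T.whites.map e := by
  induction T with
  | leg a => rfl
  | white i ch ih => simp only [relabel, whites, ih, List.map_cons, map_catLists]
  | black n ch ih => simp only [relabel, whites, ih, map_catLists]
  | special => rfl

theorem rootBlackOrSpecial_relabel (T : RawTree l (fun i => k (e i))) :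
    (T.relabel e k).RootBlackOrSpecial ↔ T.RootBlackOrSpecial := by
  cases T <;> rfl

theorem isReduced_relabel (T : RawTree l (fun i => k (e i))) (h : T.IsReduced) :
    (T.relabel e k).IsReduced := by
  induction T with
  | leg a => trivial
  | white i ch ih => exact fun x => ih x (h x)
  | black n ch ih =>
    exact ⟨h.1, fun x => ⟨fun hx => (h.2 x).1 ((rootBlackOrSpecial_relabel e k _).1 hx),
      ih x (h.2 x).2⟩⟩
  | special => trivial

theorem IsOpTree.relabel {T : RawTree l (fun i => k (e i))} (h : T.IsOpTree) :
    (T.relabel e k).IsOpTree where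
  reduced := isReduced_relabel e k T h.reduced
  legs_nodup := by rw [legs_relabel]; exact h.legs_nodup
  mem_legs := by rw [legs_relabel]; exact h.mem_legs
  whites_nodup := by rw [whites_relabel]; exact h.whites_nodup.map e.injective
  mem_whites j := by
    rw [whites_relabel]; exact List.mem_map.2 ⟨e.symm j, h.mem_whites _, by simp⟩

end Relabel

section Insert

variable {J : I → Type} {m : ∀ i, J i → ℕ}

theorem isReduced_graft (i : I) {n : ℕ}
    (sub : Fin n → RawTree l (fun p : Σ i, J i => m p.1 p.2)) (h : ∀ a, (sub a).IsReduced)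
    (S : RawTree n (m i)) (hS : S.IsReduced) : (S.graft i sub).IsReduced := by
  induction S with
  | leg a => exact h a
  | white j ch ih => exact fun x => ih x (hS x)
  | black r ch ih => exact isReduced_mkBlack _ _ fun x => ih x (hS.2 x).2
  | special => trivial

theorem legs_graft (i : I) {n : ℕ} (sub : Fin n → RawTree l (fun p : Σ i, J i => m p.1 p.2))
    (S : RawTree n (m i)) : (S.graft i sub).legs = S.legs.flatMap (fun a => (sub a).legs) := by
  induction S with
  | leg a => simp [graft, legs]
  | white j ch ih => simp only [graft, legs, ih, flatMap_catLists]
  | black r ch ih => simp only [graft, legs, legs_mkBlack, ih, flatMap_catLists]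
  | special => rfl

theorem sum_map_eq {n : ℕ} (L : List (Fin n)) (f : Fin n → ℕ) :
    (L.map f).sum = ∑ a, L.count a * f a := by
  induction L with
  | nil => simp
  | cons b L ih =>
    simp [ih, List.count_cons, add_mul, Finset.sum_add_distrib, add_comm]

open Classical in
theorem count_whites_graft (i : I) {n : ℕ}
    (sub : Fin n → RawTree l (fun p : Σ i, J i => m p.1 p.2)) (S : RawTree n (m i))
    (q : Σ i, J i) : (S.graft i sub).whites.count q =
      (S.whites.map (Sigma.mk i)).count q + ∑ a, S.legs.count a * (sub a).whites.count q := by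
  have aux : ∀ (r : ℕ) (c : Fin r → ℕ) (d : Fin r → Fin n → ℕ) (e : Fin n → ℕ),
      ∑ x, (c x + ∑ a, d x a * e a) = ∑ x, c x + ∑ a, (∑ x, d x a) * e a := by
    intro r c d e
    simp only [Finset.sum_add_distrib, Finset.sum_mul]
    rw [Finset.sum_comm]
  induction S with
  | leg a =>
    simp only [graft, legs, whites, List.count_singleton, List.map_nil, List.count_nil, zero_add]
    simp
  | white j ch ih =>
    simp only [graft, legs, whites, List.map_cons, List.count_cons, map_catLists, count_catLists,
      ih, aux]
    ring
  | black r ch ih =>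
    simp only [graft, legs, whites, whites_mkBlack, map_catLists, count_catLists, ih, aux]
  | special => simp [graft, whites, legs]

variable {S : ∀ i, RawTree (k i) (m i)}

theorem isReduced_insert (hS : ∀ i, (S i).IsReduced) (T : RawTree l k) (hT : T.IsReduced) :
    (T.insert S).IsReduced := by
  induction T with
  | leg a => trivial
  | white i ch ih => exact isReduced_graft i _ (fun x => ih x (hT x)) _ (hS i)
  | black n ch ih => exact isReduced_mkBlack _ _ fun x => ih x (hT.2 x).2
  | special => trivial

theorem count_legs_insert (hS : ∀ i a, (S i).legs.count a = 1) (T : RawTree l k) (b : Fin l) :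
    (T.insert S).legs.count b = T.legs.count b := by
  induction T with
  | leg a => rfl
  | white i ch ih =>
    simp only [insert, legs, legs_graft, List.count_flatMap, sum_map_eq, hS, count_catLists,
      Function.comp_def, one_mul, ih]
  | black n ch ih => simp only [insert, legs, legs_mkBlack, count_catLists, ih]
  | special => rfl

open Classical in
theorem count_whites_insert (hS : ∀ i a, (S i).legs.count a = 1) (T : RawTree l k) (i : I)
    (j : J i) :
    (T.insert S).whites.count ⟨i, j⟩ = T.whites.count i * (S i).whites.count j := by
  induction T with
  | leg a => simp [insert, whites]
  | white i' ch ih =>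
    simp only [insert, whites, count_whites_graft, hS, one_mul, count_catLists, List.count_cons, ih,
      add_mul, Finset.sum_mul]
    rw [add_comm]
    congr 1
    by_cases h : i' = i
    · subst h
      simp [List.count_map_of_injective _ _ sigma_mk_injective]
    · have : (⟨i, j⟩ : Σ i, J i) ∉ (S i').whites.map (Sigma.mk i') := by
        simp only [List.mem_map, not_exists, not_and]
        intro x _ hx
        exact h (congrArg Sigma.fst hx)
      simp [h, List.count_eq_zero_of_not_mem this]
  | black n ch ih => simp only [insert, whites, whites_mkBlack, count_catLists, ih, Finset.sum_mul]
  | special => simp [insert, whites]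

theorem IsOpTree.insert {T : RawTree l k} (hT : T.IsOpTree) (hS : ∀ i, (S i).IsOpTree) :
    (T.insert S).IsOpTree := by
  classical
  simp only [isOpTree_iff] at *
  have h1 := fun i => (hS i).2.1
  refine ⟨isReduced_insert (fun i => (hS i).1) T hT.1, fun a => ?_, fun p => ?_⟩
  · rw [count_legs_insert h1, hT.2.1]
  · obtain ⟨i, j⟩ := p
    rw [count_whites_insert h1, hT.2.2, (hS i).2.2]

end Insert

theorem isOpTree_corolla (c : ℕ) : (corolla c).IsOpTree := by
  classical
  rw [isOpTree_iff]
  refine ⟨fun _ => trivial, fun a => ?_, fun i => ?_⟩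
  · simp only [corolla, legs, count_catLists, List.count_singleton]
    simp
  · simp only [corolla, whites, count_catLists, List.count_cons]
    simp

end Lemmas

end RawTree

/-- The `(l; k)`-trees, for a family `k` of arities indexed by `I`. -/
def OpTree (l : ℕ) {I : Type} (k : I → ℕ) : Type := {T : RawTree l k // T.IsOpTree}

namespace OpTree

variable {l : ℕ} {I : Type} {k : I → ℕ}

/-- Relabelling of the white vertices. -/
def relabel {J : Type} (e : I ≃ J) (k : J → ℕ) (T : OpTree l (fun i => k (e i))) : OpTree l k :=
  ⟨T.1.relabel e k, T.2.relabel e k⟩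

/-- Insertion of trees into all white vertices. -/
def insert {J : I → Type} {m : ∀ i, J i → ℕ} (T : OpTree l k) (S : ∀ i, OpTree (k i) (m i)) :
    OpTree l (fun p : Σ i, J i => m p.1 p.2) :=
  ⟨T.1.insert (fun i => (S i).1), T.2.insert (fun i => (S i).2)⟩

/-- The tree with one white vertex and legs in the natural order. -/
def corolla (c : ℕ) : OpTree c (fun _ : Unit => c) :=
  ⟨RawTree.corolla c, RawTree.isOpTree_corolla c⟩

end OpTree

open Classical in
/-- The `ℕ`-coloured operad `B` of trees: its components are the free abelian groups on the
`(l; k)`-trees, and its composition is the multilinear extension of vertex insertion. -/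
noncomputable def treeOperad : OperadData.{0} ℕ where
  obj l _ _ k := OpTree l k →₀ ℤ
  grp _ _ _ _ := inferInstance
  relabel e k := Finsupp.mapDomain (OpTree.relabel e k)
  unit c := Finsupp.single (OpTree.corolla c) 1
  comp {_ I _ _ _ _ _} f g :=
    letI := Fintype.ofFinite I
    f.sum fun T a => ∑ S ∈ Fintype.piFinset (fun i => (g i).support),
      Finsupp.single (T.insert S) (a * ∏ i, g i (S i))

/-! ## Monoids in symmetric monoidal categories -/

section Powers

variable {C : Type u} [Category.{v} C] [MonoidalCategory C]

/-- `M ⊗ (M ⊗ ⋯ (M ⊗ X))` with `n` factors `M`. -/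
def powTensor (M X : C) : ℕ → C
  | 0 => X
  | n + 1 => M ⊗ powTensor M X n

/-- The tensor power `M^{⊗ n}`; the zeroth power is the unit object. -/
abbrev tensorPow (M : C) (n : ℕ) : C := powTensor M (𝟙_ C) n

/-- The comparison `N^{⊗ n} ⟶ F (M^{⊗ n})` for a monoidal functor `F` and `N ≅ F M`. -/
def powComparison {D : Type u} [Category.{v} D] [MonoidalCategory D] (F : C ⥤ D) [F.LaxMonoidal]
    {M : C} {N : D} (e : F.obj M ≅ N) : (n : ℕ) → (tensorPow N n ⟶ F.obj (tensorPow M n))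
  | 0 => Functor.LaxMonoidal.ε F
  | n + 1 => (e.inv ⊗ₘ powComparison F e n) ≫ Functor.LaxMonoidal.μ F M (tensorPow M n)

end Powers

set_option linter.checkUnivs false

/-- A pair `(V, M)`: an additive symmetric monoidal category `V`, that is, a symmetric monoidal
category enriched in abelian groups with biadditive tensor product, and a unital monoid `M` in `V`.
The category of such pairs is `Symcat`. -/
structure SymCat where
  V : Type u
  [cat : Category.{v} V]
  [monoidal : MonoidalCategory V]
  [symmetric : SymmetricCategory V]
  [preadditive : Preadditive V]
  [monoidalPreadditive : MonoidalPreadditive V]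
  M : V
  [mon : MonObj M]

namespace SymCat

attribute [instance] cat monoidal symmetric preadditive monoidalPreadditive mon

open scoped Obj in
/-- Additive (strong) symmetric monoidal functors which preserve the distinguished monoids: the
functor is equipped with an isomorphism of monoids `F M ≅ N`. -/
structure Hom (X Y : SymCat.{u, v}) where
  F : X.V ⥤ Y.V
  [braided : F.Braided]
  [additive : F.Additive]
  iso : F.obj X.M ≅ Y.M
  [isMonHom : IsMonHom iso.hom]

attribute [instance] Hom.braided Hom.additive

/-- The abelian group `V(M^{⊗ n}, M)`. -/
abbrev End (X : SymCat.{u, v}) (n : ℕ) : Type v := tensorPow X.M n ⟶ X.M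

/-- The map `V(M^{⊗ n}, M) → W(N^{⊗ n}, N)` induced by a morphism `(V, M) → (W, N)`. -/
def Hom.map {X Y : SymCat.{u, v}} (φ : Hom X Y) (n : ℕ) (f : X.End n) : Y.End n :=
  powComparison φ.F φ.iso n ≫ φ.F.map f ≫ φ.iso.hom

theorem Hom.map_add {X Y : SymCat.{u, v}} (φ : Hom X Y) (n : ℕ) (f g : X.End n) :
    φ.map n (f + g) = φ.map n f + φ.map n g := by
  simp [Hom.map, Functor.map_add]

end SymCat

/-! ## The operad of natural families of operations -/

/-- The group of families of multilinear maps `∏ i, V(M^{⊗ k i}, M) → V(M^{⊗ l}, M)`, equivalently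
of linear maps out of the tensor product over `i`, indexed by all pairs `(V, M)` and natural with
respect to all morphisms of pairs. -/
def NatFamily (l : ℕ) {I : Type} (k : I → ℕ) : AddSubgroup
    (∀ X : SymCat.{u, v}, MultilinearMap ℤ (fun i => X.End (k i)) (X.End l)) where
  carrier := {α | ∀ (X Y : SymCat.{u, v}) (φ : SymCat.Hom X Y) (x : ∀ i, X.End (k i)),
    φ.map l (α X x) = α Y (fun i => φ.map (k i) (x i))}
  add_mem' := by
    intro α β hα hβ X Y φ x
    simp only [Pi.add_apply, add_apply, SymCat.Hom.map_add, hα X Y φ x, hβ X Y φ x]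
  zero_mem' := by
    intro X Y φ x
    simp [SymCat.Hom.map]
  neg_mem' := by
    intro α hα X Y φ x
    have h := hα X Y φ x
    simp only [SymCat.Hom.map, Pi.neg_apply, neg_apply] at h ⊢
    rw [← h]
    simp

namespace NatFamily

variable {l : ℕ} {I : Type} {k : I → ℕ}

/-- The member of the family at the pair `X = (V, M)`. -/
def app (α : NatFamily.{u, v} l k) (X : SymCat.{u, v}) :
    MultilinearMap ℤ (fun i => X.End (k i)) (X.End l) := α.1 X

/-- Relabelling of the inputs. -/
def relabel {J : Type} (e : I ≃ J) (k : J → ℕ) (α : NatFamily.{u, v} l (fun i => k (e i))) :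
    NatFamily.{u, v} l k :=
  ⟨fun X =>
    { toFun := fun x => α.1 X (fun i => x (e i))
      map_update_add' := by
        classical
        intro _ x j a b
        obtain ⟨i, rfl⟩ := e.surjective j
        have h : ∀ c, (fun i' => Function.update x (e i) c (e i')) =
            Function.update (fun i' => x (e i')) i c := by
          intro c
          funext i'
          by_cases hi : i' = i
          · subst hi; simp
          · simp [hi]
        simp only [h, MultilinearMap.map_update_add]
      map_update_smul' := by
        classical
        intro _ x j a b
        obtain ⟨i, rfl⟩ := e.surjective j
        have h : ∀ c, (fun i' => Function.update x (e i) c (e i')) =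
            Function.update (fun i' => x (e i')) i c := by
          intro c
          funext i'
          by_cases hi : i' = i
          · subst hi; simp
          · simp [hi]
        simp only [h, MultilinearMap.map_update_smul] },
    fun X Y φ x => α.2 X Y φ (fun i => x (e i))⟩

/-- The identity operation. -/
def unit (c : ℕ) : NatFamily.{u, v} c (fun _ : Unit => c) :=
  ⟨fun _ =>
    { toFun := fun x => x ()
      map_update_add' := by intros; simp [Function.update]
      map_update_smul' := by intros; simp [Function.update] },
    fun _ _ _ _ => rfl⟩

/-- Composition of families of multilinear maps. -/
def comp {J : I → Type} {m : ∀ i, J i → ℕ} (α : NatFamily.{u, v} l k)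
    (β : ∀ i, NatFamily.{u, v} (k i) (m i)) : NatFamily.{u, v} l (fun p : Σ i, J i => m p.1 p.2) :=
  ⟨fun X => (α.1 X).compMultilinearMap (fun i => (β i).1 X),
    fun X Y φ x => by
      refine (α.2 X Y φ _).trans ?_
      refine congrArg (α.1 Y) ?_
      funext i
      exact (β i).2 X Y φ _⟩

end NatFamily

/-- The `ℕ`-coloured operad of natural families of operations. -/
def natOperad : OperadData.{max (u + 1) (v + 1)} ℕ where
  obj l _ _ k := NatFamily.{u, v} l k
  grp _ _ _ _ := inferInstance
  relabel e k := NatFamily.relabel e k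
  unit := NatFamily.unit
  comp f g := NatFamily.comp f g

/-! ## The action of trees -/

section Action

variable {C : Type u} [Category.{v} C] [MonoidalCategory C]

/-- The associativity isomorphism `M ⊗ (M ⊗ ⋯ (M ⊗ X)) ⟶ M^{⊗ n} ⊗ X`. -/
def powAssoc (M X : C) : (n : ℕ) → (powTensor M X n ⟶ tensorPow M n ⊗ X)
  | 0 => (λ_ X).inv
  | n + 1 => M ◁ powAssoc M X n ≫ (α_ M (tensorPow M n) X).inv

/-- The comparison of the power for a concatenation of lists with an iterated power. -/
def powAppend {α : Type} (M X : C) : (L L' : List α) →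
    (powTensor M X (L ++ L').length ⟶ powTensor M (powTensor M X L'.length) L.length)
  | [], _ => 𝟙 _
  | _ :: L, L' => M ◁ powAppend M X L L'

/-- The iterated multiplication `M^{⊗ n} ⟶ M`, which is the unit for `n = 0`. -/
def iterMul (M : C) [MonObj M] : (n : ℕ) → (tensorPow M n ⟶ M)
  | 0 => MonObj.one
  | n + 1 => M ◁ iterMul M n ≫ MonObj.mul

/-- Apply maps `M^{⊗ |L x|} ⟶ M`, given in the form `e x`, to consecutive blocks of factors. -/
def applyBlocks {α : Type} (M : C) : (n : ℕ) → (L : Fin n → List α) →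
    (∀ (x : Fin n) (X : C), powTensor M X (L x).length ⟶ M ⊗ X) → (X : C) →
    (powTensor M X (catLists n L).length ⟶ powTensor M X n)
  | 0, _, _, _ => 𝟙 _
  | n + 1, L, e, X =>
    powAppend M X (L 0) (catLists n (fun i => L i.succ)) ≫
      e 0 (powTensor M X (catLists n (fun i => L i.succ)).length) ≫
      M ◁ applyBlocks M n (fun i => L i.succ) (fun i => e i.succ) X

/-- Composition along a tree whose white vertices are decorated by the maps `f i`, the black
vertices by iterated multiplications and the special vertices by the unit; the inputs are ordered as
the legs of the planar tree, and the map is tensored with the identity of an object `X`. -/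
def RawTree.planarEval {l : ℕ} {I : Type} {k : I → ℕ} (M : C) [MonObj M]
    (f : ∀ i, tensorPow M (k i) ⟶ M) :
    (T : RawTree l k) → (X : C) → (powTensor M X T.legs.length ⟶ M ⊗ X)
  | leg _, _ => 𝟙 _
  | white i ch, X => applyBlocks M (k i) (fun x => (ch x).legs) (fun x => (ch x).planarEval M f) X ≫
      powAssoc M X (k i) ≫ f i ▷ X
  | black n ch, X => applyBlocks M n (fun x => (ch x).legs) (fun x => (ch x).planarEval M f) X ≫
      powAssoc M X n ≫ iterMul M n ▷ X
  | special, X => (λ_ X).inv ≫ MonObj.one ▷ X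

/-- The symmetry of `M^{⊗ (n + 1)}` which moves the factor with index `j` to the front. -/
def moveFront [SymmetricCategory C] (M : C) :
    (n : ℕ) → Fin (n + 1) → (tensorPow M (n + 1) ⟶ M ⊗ tensorPow M n)
  | 0, _ => 𝟙 _
  | n + 1, j => Fin.cases (𝟙 _) (fun i => M ◁ moveFront M n i ≫
      (α_ M M (tensorPow M n)).inv ≫ (β_ M M).hom ▷ tensorPow M n ≫
      (α_ M M (tensorPow M n)).hom) j

/-- The bijection obtained from `σ` by deleting `0` and `σ 0` and renumbering. -/
def deleteZero {m n : ℕ} (σ : Fin (m + 1) ≃ Fin (n + 1)) : Fin m ≃ Fin n :=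
  (finSuccAboveEquiv 0).trans
    ((σ.subtypeEquiv (p := fun x => x ≠ 0) (q := fun y => y ≠ σ 0)
      (fun _ => σ.injective.ne_iff.symm)).trans (finSuccAboveEquiv (σ 0)).symm)

/-- The symmetry of tensor powers which, on elements, is
`a₀ ⊗ ⋯ ⊗ a_{n-1} ↦ a_{σ 0} ⊗ ⋯ ⊗ a_{σ (m-1)}`. -/
def permute [SymmetricCategory C] (M : C) :
    (m n : ℕ) → (Fin m ≃ Fin n) → (tensorPow M n ⟶ tensorPow M m)
  | 0, 0, _ => 𝟙 _
  | m + 1, n + 1, σ => moveFront M n (σ 0) ≫ M ◁ permute M m n (deleteZero σ)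
  | 0, _ + 1, σ => (σ.symm 0).elim0
  | _ + 1, 0, σ => (σ 0).elim0

/-- The operation `(f i) ↦ O_T(f)` determined by an `(l; k)`-tree `T`: composition along the tree,
the factor of `M^{⊗ l}` with index `a` being fed into the leg with label `a`. -/
def OpTree.act {l : ℕ} {I : Type} {k : I → ℕ} (T : OpTree l k) (X : SymCat.{u, v})
    (f : ∀ i, X.End (k i)) : X.End l :=
  permute X.M T.1.legs.length l (T.2.legs_nodup.getEquivOfForallMemList _ T.2.mem_legs) ≫
    T.1.planarEval X.M f (𝟙_ X.V) ≫ (ρ_ X.M).hom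

end Action

/-!
A tree is sent to the operation obtained by composing along it. The content of the theorem is that
this is a bijection from linear combinations of trees to natural families of multilinear
operations.

*Every natural family comes from trees.* Natural families are determined by their values on
universal arguments. The universal pair `freePair k` has as objects the words in one letter, and as
morphisms the formal expressions in the structure of an additive symmetric monoidal category, in the
multiplication and the unit of a monoid and in generators `M^{⊗ k i} ⟶ M`; two expressions are
identified when they have the same value in every pair. By naturality a family `α` is determined by
the value of `α` on the generators, and this value is the value of some expression. The normal form
theorem `FreeTerm.comp_eval_mem` says that an expression, precomposed with a tensor product of trees
and a permutation of the factors, is a linear combination of tensor products of trees, each preceded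
by a permutation. It is proved by induction on the expression, and rests on the stability of the
class of permutations (`IsPerm`) under composition, tensor products, associators, unitors and
braidings. Since trees can be reduced without changing their operation (`RawTree.eval_reduce`), the
value of `α` is a linear combination of reduced trees, a priori with white vertices whose labels are
repeated or missing. Multiplying one argument by `2` multiplies the operation of such a tree by a
power of `2` whose exponent is the number of vertices with that label; as `α` is multilinear and
reduced trees are linearly independent, only trees in which every label occurs once can appear
(`treeHom_surjective`).

*Trees are linearly independent.* In the category of abelian groups, let the distinguished monoid be
the monoid ring of a monoid `G`, and let the arguments be linear extensions of maps `G ^ k i → G`.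
Then the operation of a tree sends group-like elements to group-like elements, namely to the
interpretation `RawTree.interp` of the tree in `G` (`RawTree.operation_pureTensor`). For the free
monoid `G` on the set of all trees, with a white vertex acting by joining trees above that vertex,
the interpretation of a reduced tree is the list of its factors, from which the tree is recovered
(`RawTree.interp_freeMonoid`). So the operations of different trees are different basis elements.

*Compatibility with the operad structures.* By the two parts, a natural family is determined by what
the monoid ring of the free monoid says about its value on the universal arguments
(`NatFamily.eq_of_represents`). Hence it suffices to compare interpretations of trees in monoids,
where relabelling and insertion of trees are evidently compatible with relabelling and composition
of operations (`RawTree.interp_relabel`, `RawTree.interp_insert`). Natural families form an operad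
because multilinear maps do, and the operad axioms for trees follow along the isomorphism.

*On the diagrams.* Objects such as `tensorPow M (n + 1)` and `M ⊗ tensorPow M n` agree by unfolding
but not syntactically. Computations with them are therefore carried out for arbitrary objects, in
auxiliary statements called `key`, and then specialized.
-/

universe u' v'

/-! ### Evaluation of planar trees -/

section Evaluation

variable {C : Type u} [Category.{v} C] [MonoidalCategory C]

/-- The isomorphism `M^{⊗ |L ++ L'|} ⟶ M^{⊗ |L|} ⊗ M^{⊗ |L'|}`. -/
def splitPow {α : Type} (M : C) (L L' : List α) :
    tensorPow M (L ++ L').length ⟶ tensorPow M L.length ⊗ tensorPow M L'.length :=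
  powAppend M (𝟙_ C) L L' ≫ powAssoc M (tensorPow M L'.length) L.length

theorem splitPow_nil {α : Type} (M : C) (L' : List α) :
    splitPow M [] L' = (λ_ (tensorPow M L'.length)).inv :=
  Category.id_comp _

theorem splitPow_cons {α : Type} (M : C) (a : α) (L L' : List α) :
    splitPow M (a :: L) L' = M ◁ splitPow M L L' ≫ (α_ _ _ _).inv := by
  have key : ∀ {A B D E : C} (a : A ⟶ B) (b : B ⟶ D ⊗ E),
      M ◁ a ≫ M ◁ b ≫ (α_ M D E).inv = M ◁ (a ≫ b) ≫ (α_ M D E).inv := by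
    intros; simp
  exact key _ _

/-- The tensor product of maps `w x : M^{⊗ |L x|} ⟶ M`, as a map out of the tensor power indexed by
the concatenation of the lists. -/
def blockTensor {α : Type} (M : C) : (n : ℕ) → (L : Fin n → List α) →
    (∀ x : Fin n, tensorPow M (L x).length ⟶ M) →
      (tensorPow M (catLists n L).length ⟶ tensorPow M n)
  | 0, _, _ => 𝟙 _
  | n + 1, L, w => splitPow M (L 0) (catLists n (fun i => L i.succ)) ≫
      (w 0 ⊗ₘ blockTensor M n (fun i => L i.succ) (fun i => w i.succ))

/-- Composition along a decorated planar tree, without the auxiliary object `X` of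
`RawTree.planarEval`. -/
def RawTree.eval {l : ℕ} {I : Type} {k : I → ℕ} (M : C) [MonObj M]
    (f : ∀ i, tensorPow M (k i) ⟶ M) : (T : RawTree l k) → (tensorPow M T.legs.length ⟶ M)
  | leg _ => (ρ_ M).hom
  | white i ch => blockTensor M (k i) (fun x => (ch x).legs) (fun x => (ch x).eval M f) ≫ f i
  | black n ch => blockTensor M n (fun x => (ch x).legs) (fun x => (ch x).eval M f) ≫ iterMul M n
  | special => MonObj.one

theorem powAssoc_unit (M : C) (n : ℕ) : powAssoc M (𝟙_ C) n ≫ (ρ_ _).hom = 𝟙 _ := by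
  induction n with
  | zero =>
    have key : (λ_ (𝟙_ C)).inv ≫ (ρ_ (𝟙_ C)).hom = 𝟙 _ := by
      rw [← unitors_equal, Iso.inv_hom_id]
    exact key
  | succ n ih =>
    have key : ∀ {B : C} (a : B ⟶ B ⊗ 𝟙_ C), a ≫ (ρ_ B).hom = 𝟙 _ →
        (M ◁ a ≫ (α_ M B (𝟙_ C)).inv) ≫ (ρ_ (M ⊗ B)).hom = 𝟙 _ := by
      intro B a h
      have h' := congrArg (fun t => M ◁ t) h
      simpa using h'
    exact key _ ih

theorem powAppend_powAssoc {α : Type} (M X : C) (L L' : List α) :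
    powAppend M X L L' ≫ powAssoc M (powTensor M X L'.length) L.length ≫
      tensorPow M L.length ◁ powAssoc M X L'.length =
    powAssoc M X (L ++ L').length ≫ splitPow M L L' ▷ X ≫ (α_ _ _ _).hom := by
  induction L with
  | nil =>
    have key : ∀ {A S : C} (a : A ⟶ S ⊗ X),
      𝟙 A ≫ (λ_ A).inv ≫ 𝟙_ C ◁ a = a ≫ (λ_ S).inv ▷ X ≫ (α_ _ _ _).hom := by
      intros; simp
    rw [splitPow_nil]
    exact key _
  | cons a L ih =>
    have key : ∀ {A P T Q S R : C} (a : A ⟶ P) (b : P ⟶ T ⊗ Q) (c : Q ⟶ S ⊗ X) (d : A ⟶ R ⊗ X)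
        (s : R ⟶ T ⊗ S), a ≫ b ≫ T ◁ c = d ≫ s ▷ X ≫ (α_ _ _ _).hom →
        M ◁ a ≫ (M ◁ b ≫ (α_ _ _ _).inv) ≫ (M ⊗ T) ◁ c =
          (M ◁ d ≫ (α_ _ _ _).inv) ≫ (M ◁ s ≫ (α_ _ _ _).inv) ▷ X ≫ (α_ _ _ _).hom := by
      intro A P T Q S R a b c d s h
      have := congrArg (fun t => M ◁ t ≫ (α_ _ _ _).inv) h
      simp at this ⊢
      rw [this]
    rw [splitPow_cons]
    exact key _ _ _ _ _ ih

/-- If every map `e x` is a map `w x` whiskered with the remaining factors, then so is the map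
assembled from all of them. -/
theorem applyBlocks_powAssoc {α : Type} (M : C) (n : ℕ) (L : Fin n → List α)
    (e : ∀ (x : Fin n) (X : C), powTensor M X (L x).length ⟶ M ⊗ X)
    (w : ∀ x : Fin n, tensorPow M (L x).length ⟶ M)
    (h : ∀ x X, e x X = powAssoc M X (L x).length ≫ w x ▷ X) (X : C) :
    applyBlocks M n L e X ≫ powAssoc M X n =
      powAssoc M X (catLists n L).length ≫ blockTensor M n L w ▷ X := by
  induction n with
  | zero =>
    have key : 𝟙 X ≫ (λ_ X).inv = (λ_ X).inv ≫ 𝟙 (𝟙_ C) ▷ X := by simp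
    exact key
  | succ n ih =>
    have ih := ih (fun i => L i.succ) (fun i => e i.succ) (fun i => w i.succ) (fun i => h i.succ)
    have h2 := powAppend_powAssoc M X (L 0) (catLists n (fun i => L i.succ))
    rw [blockTensor, applyBlocks, h]
    have key : ∀ {A P T Q S R U V : C} (a : A ⟶ P) (b : P ⟶ T ⊗ Q) (c : Q ⟶ S ⊗ X) (d : A ⟶ R ⊗ X)
        (s : R ⟶ T ⊗ S) (w : T ⟶ M) (e : Q ⟶ U) (f : U ⟶ V ⊗ X) (g : S ⟶ V),
        a ≫ b ≫ T ◁ c = d ≫ s ▷ X ≫ (α_ _ _ _).hom → e ≫ f = c ≫ g ▷ X →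
        (a ≫ (b ≫ w ▷ Q) ≫ M ◁ e) ≫ (M ◁ f ≫ (α_ M V X).inv) = d ≫ (s ≫ (w ⊗ₘ g)) ▷ X := by
      intro A P T Q S R U V a b c d s w e f g h h'
      have h'' := congrArg (fun t => t ≫ w ▷ _ ≫ M ◁ (g ▷ X) ≫ (α_ _ _ _).inv) h
      simp only [Category.assoc] at h'' ⊢
      rw [← MonoidalCategory.whiskerLeft_comp_assoc, h', MonoidalCategory.whiskerLeft_comp_assoc]
      rw [← whisker_exchange_assoc]
      rw [h'']
      simp [MonoidalCategory.tensorHom_def]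
    exact key _ _ _ _ _ _ _ _ _ h2 ih

/-- The auxiliary object `X` in the evaluation of a tree is only carried along. -/
theorem RawTree.planarEval_eq {l : ℕ} {I : Type} {k : I → ℕ} (M : C) [MonObj M]
    (f : ∀ i, tensorPow M (k i) ⟶ M) (T : RawTree l k) (X : C) :
    T.planarEval M f X = powAssoc M X T.legs.length ≫ T.eval M f ▷ X := by
  have key : ∀ {A B D E X : C} (a : A ⟶ B) (b : B ⟶ D ⊗ X) (f : D ⟶ M) (c : A ⟶ E ⊗ X)
      (d : E ⟶ D), a ≫ b = c ≫ d ▷ X → a ≫ b ≫ f ▷ X = c ≫ (d ≫ f) ▷ X := by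
    intro A B D E X a b f c d h
    simp [reassoc_of% h]
  induction T generalizing X with
  | leg a =>
    have key : 𝟙 (M ⊗ X) = (M ◁ (λ_ X).inv ≫ (α_ _ _ _).inv) ≫ (ρ_ M).hom ▷ X := by simp
    exact key
  | white i ch ih => exact key _ _ _ _ _ (applyBlocks_powAssoc M _ _ _ _ ih X)
  | black n ch ih => exact key _ _ _ _ _ (applyBlocks_powAssoc M _ _ _ _ ih X)
  | special => rfl

theorem RawTree.planarEval_unit {l : ℕ} {I : Type} {k : I → ℕ} (M : C) [MonObj M]
    (f : ∀ i, tensorPow M (k i) ⟶ M) (T : RawTree l k) :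
    T.planarEval M f (𝟙_ C) ≫ (ρ_ M).hom = T.eval M f := by
  rw [planarEval_eq, Category.assoc, rightUnitor_naturality, ← Category.assoc, powAssoc_unit,
    Category.id_comp]

end Evaluation

/-! ### Permutations of tensor powers -/

section Permutations

variable {C : Type u} [Category.{v} C] [MonoidalCategory C] [SymmetricCategory C]

/-- The symmetry of `M ⊗ (M ⊗ X)` which exchanges the first two factors. -/
def swapFront (M X : C) : M ⊗ (M ⊗ X) ⟶ M ⊗ (M ⊗ X) :=
  (α_ M M X).inv ≫ (β_ M M).hom ▷ X ≫ (α_ M M X).hom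

theorem swapFront_naturality (M : C) {X Y : C} (f : X ⟶ Y) :
    swapFront M X ≫ M ◁ M ◁ f = M ◁ M ◁ f ≫ swapFront M Y := by
  simp only [swapFront, Category.assoc]
  rw [← associator_naturality_right, ← whisker_exchange_assoc,
    associator_inv_naturality_right_assoc]

theorem swapFront_swapFront (M X : C) : swapFront M X ≫ swapFront M X = 𝟙 _ := by
  simp [swapFront, ← comp_whiskerRight_assoc]

/-- The braid relation for adjacent transpositions of factors. -/
theorem swapFront_braid (M X : C) :
    swapFront M (M ⊗ X) ≫ M ◁ swapFront M X ≫ swapFront M (M ⊗ X) =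
      M ◁ swapFront M X ≫ swapFront M (M ⊗ X) ≫ M ◁ swapFront M X := by
  have h := BraidedCategory.yang_baxter' M M M
  calc
    _ = 𝟙 _ ⊗≫ ((β_ M M).hom ▷ M ⊗≫ M ◁ (β_ M M).hom ⊗≫ (β_ M M).hom ▷ M) ▷ X ⊗≫ 𝟙 _ := by
      simp only [swapFront]; monoidal
    _ = _ := by rw [h]; simp only [swapFront]; monoidal

theorem moveFront_zero (M : C) (n : ℕ) : moveFront M n 0 = 𝟙 (M ⊗ tensorPow M n) := by
  cases n <;> rfl

theorem moveFront_succ (M : C) (n : ℕ) (i : Fin (n + 1)) :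
    moveFront M (n + 1) i.succ = M ◁ moveFront M n i ≫ swapFront M (tensorPow M n) := rfl

/-- Moving two factors to the front and exchanging them amounts to moving them to the front in the
other order. -/
theorem exists_moveFront_swapFront (M : C) (n : ℕ) (a : Fin (n + 2)) (b : Fin (n + 1)) :
    ∃ (a' : Fin (n + 2)) (b' : Fin (n + 1)),
      moveFront M (n + 1) a ≫ M ◁ moveFront M n b ≫ swapFront M (tensorPow M n) =
        moveFront M (n + 1) a' ≫ M ◁ moveFront M n b' := by
  have h1 : ∀ {X : C} (f g : M ⊗ X ⟶ M ⊗ X), f = 𝟙 _ →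
      𝟙 (M ⊗ M ⊗ X) ≫ M ◁ g ≫ swapFront M X = (M ◁ g ≫ swapFront M X) ≫ M ◁ f := by
    rintro X f g rfl
    simp
  have h2 : ∀ {X : C} (f g : M ⊗ X ⟶ M ⊗ X), g = 𝟙 _ →
      (M ◁ f ≫ swapFront M X) ≫ M ◁ g ≫ swapFront M X = 𝟙 _ ≫ M ◁ f := by
    rintro X f g rfl
    simp [swapFront_swapFront]
  have h3 : ∀ {X : C} (i i' : M ⊗ M ⊗ X ⟶ M ⊗ M ⊗ X) (j j' : M ⊗ X ⟶ M ⊗ X),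
      i ≫ M ◁ j ≫ swapFront M X = i' ≫ M ◁ j' →
      (M ◁ i ≫ swapFront M (M ⊗ X)) ≫ M ◁ (M ◁ j ≫ swapFront M X) ≫ swapFront M (M ⊗ X) =
        (M ◁ i' ≫ swapFront M (M ⊗ X)) ≫ M ◁ (M ◁ j' ≫ swapFront M X) := by
    intro X i i' j j' h
    have h' := congrArg (fun t => M ◁ t ≫ swapFront M (M ⊗ X) ≫ M ◁ swapFront M X) h
    simp only [MonoidalCategory.whiskerLeft_comp, Category.assoc] at h' ⊢
    rw [reassoc_of% swapFront_naturality, swapFront_braid, h', reassoc_of% swapFront_naturality]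
  induction n with
  | zero =>
    cases b using Fin.cases with
    | succ j => exact j.elim0
    | zero =>
    cases a using Fin.cases with
    | zero => exact ⟨1, 0, by rw [moveFront_zero M 1]; exact h1 _ _ (moveFront_zero M 0)⟩
    | succ i => exact ⟨0, i, by rw [moveFront_zero M 1]; exact h2 _ _ (moveFront_zero M 0)⟩
  | succ n ih =>
    cases a using Fin.cases with
    | zero =>
      exact ⟨b.succ, 0, by rw [moveFront_zero M (n + 2)]; exact h1 _ _ (moveFront_zero M (n + 1))⟩
    | succ i =>
    cases b using Fin.cases with
    | zero =>
      exact ⟨0, i, by rw [moveFront_zero M (n + 2)]; exact h2 _ _ (moveFront_zero M (n + 1))⟩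
    | succ j =>
      obtain ⟨a', b', h⟩ := ih i j
      exact ⟨a'.succ, b'.succ, h3 _ _ _ _ h⟩

/-- The symmetries of tensor powers of `M`. They are exactly the maps `permute M m n σ`, by
`isPerm_permute` and `IsPerm.exists_permute`, but the permutation `σ` is not recorded: only the
closure properties of the class matter, and these need no computation with permutations. -/
inductive IsPerm (M : C) : (m n : ℕ) → (tensorPow M m ⟶ tensorPow M n) → Prop
  | zero : IsPerm M 0 0 (𝟙 _)
  | succ {m n : ℕ} (j : Fin (m + 1)) {p : tensorPow M m ⟶ tensorPow M n} (hp : IsPerm M m n p) :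
      IsPerm M (m + 1) (n + 1) (moveFront M m j ≫ M ◁ p)

theorem isPerm_permute (M : C) (m n : ℕ) (σ : Fin m ≃ Fin n) : IsPerm M n m (permute M m n σ) := by
  induction m generalizing n with
  | zero =>
    cases n with
    | zero => exact .zero
    | succ n => exact (σ.symm 0).elim0
  | succ m ih =>
    cases n with
    | zero => exact (σ 0).elim0
    | succ n => exact .succ _ (ih _ _)

theorem exists_deleteZero {m n : ℕ} (j : Fin (n + 1)) (τ : Fin m ≃ Fin n) :
    ∃ σ : Fin (m + 1) ≃ Fin (n + 1), σ 0 = j ∧ deleteZero σ = τ := by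
  let σ : Fin (m + 1) ≃ Fin (n + 1) :=
    (finSuccEquiv' 0).trans ((Equiv.optionCongr τ).trans (finSuccEquiv' j).symm)
  have h0 : σ 0 = j := by simp [σ]
  have hs : ∀ x : Fin m, σ x.succ = j.succAbove (τ x) := by
    intro x
    have : finSuccEquiv' 0 x.succ = some x := finSuccEquiv'_succAbove 0 x
    simp [σ, this]
  refine ⟨σ, h0, ?_⟩
  ext x : 1
  have h : finSuccAboveEquiv (σ 0) (deleteZero σ x) = finSuccAboveEquiv (σ 0) (τ x) := by
    simp only [deleteZero, Equiv.trans_apply, Equiv.apply_symm_apply]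
    ext1
    simp [h0, hs, finSuccAboveEquiv]
  exact (finSuccAboveEquiv (σ 0)).injective h

theorem IsPerm.exists_permute {M : C} {m n : ℕ} {f : tensorPow M n ⟶ tensorPow M m}
    (h : IsPerm M n m f) : ∃ σ, f = permute M m n σ := by
  induction h with
  | zero => exact ⟨Equiv.refl _, rfl⟩
  | succ j hp ih =>
    obtain ⟨τ, rfl⟩ := ih
    obtain ⟨σ, rfl, rfl⟩ := exists_deleteZero j τ
    exact ⟨σ, rfl⟩

namespace IsPerm

variable {M : C}

theorem of_eq {m n : ℕ} {p q : tensorPow M m ⟶ tensorPow M n} (hp : IsPerm M m n p) (h : p = q) :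
    IsPerm M m n q := h ▸ hp

theorem whiskerLeft {m n : ℕ} {p : tensorPow M m ⟶ tensorPow M n} (hp : IsPerm M m n p) :
    IsPerm M (m + 1) (n + 1) (M ◁ p) := by
  have key : ∀ {X Y : C} (f : M ⊗ X ⟶ M ⊗ X) (p : X ⟶ Y), f = 𝟙 _ → f ≫ M ◁ p = M ◁ p := by
    rintro X Y f p rfl
    simp
  exact (IsPerm.succ 0 hp).of_eq (key (moveFront M m 0) p (moveFront_zero M m))

theorem id (n : ℕ) : IsPerm M n n (𝟙 _) := by
  induction n with
  | zero => exact .zero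
  | succ n ih => exact ih.whiskerLeft.of_eq (MonoidalCategory.whiskerLeft_id M (tensorPow M n))

/-- A symmetry followed by the move of the `j`-th factor to the front moves some factor to the front
and permutes the remaining ones; hence symmetries compose. -/
theorem exists_comp_moveFront {m n : ℕ} {p : tensorPow M (m + 1) ⟶ tensorPow M (n + 1)}
    (hp : IsPerm M (m + 1) (n + 1) p) (j : Fin (n + 1)) :
    ∃ (i : Fin (m + 1)) (q : tensorPow M m ⟶ tensorPow M n),
      IsPerm M m n q ∧ p ≫ moveFront M n j = moveFront M m i ≫ M ◁ q := by
  induction n generalizing m with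
  | zero =>
    cases hp with
    | succ a hq =>
    cases j using Fin.cases with
    | zero => exact ⟨a, _, hq, by rw [moveFront_zero]; exact Category.comp_id _⟩
    | succ j => exact j.elim0
  | succ n ih =>
    cases hp with
    | succ a hq =>
    cases j using Fin.cases with
    | zero => exact ⟨a, _, hq, by rw [moveFront_zero]; exact Category.comp_id _⟩
    | succ j =>
      cases m with
      | zero => cases hq
      | succ m =>
        obtain ⟨i, r, hr, h⟩ := ih hq j
        obtain ⟨a', b', h'⟩ := exists_moveFront_swapFront M m a i
        refine ⟨a', _, hr.succ b', ?_⟩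
        have key : ∀ {X Y : C} (a a' : M ⊗ M ⊗ X ⟶ M ⊗ M ⊗ X) (q : M ⊗ X ⟶ M ⊗ Y)
            (j : M ⊗ Y ⟶ M ⊗ Y) (i b' : M ⊗ X ⟶ M ⊗ X) (r : X ⟶ Y), q ≫ j = i ≫ M ◁ r →
            a ≫ M ◁ i ≫ swapFront M X = a' ≫ M ◁ b' →
            (a ≫ M ◁ q) ≫ M ◁ j ≫ swapFront M Y = a' ≫ M ◁ (b' ≫ M ◁ r) := by
          intro X Y a a' q j i b' r h h'
          have h'' := congrArg (fun t => t ≫ M ◁ M ◁ r) h'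
          simp only [Category.assoc, MonoidalCategory.whiskerLeft_comp] at h'' ⊢
          rw [← h'', swapFront_naturality, ← MonoidalCategory.whiskerLeft_comp_assoc, h]
          simp
        exact key _ _ _ _ _ _ _ h h'

theorem comp {m n r : ℕ} {p : tensorPow M m ⟶ tensorPow M n} {q : tensorPow M n ⟶ tensorPow M r}
    (hp : IsPerm M m n p) (hq : IsPerm M n r q) : IsPerm M m r (p ≫ q) := by
  induction hq generalizing m with
  | zero => exact hp.of_eq (Category.comp_id _).symm
  | @succ n r j q hq ih =>
    cases m with
    | zero => cases hp
    | succ m =>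
      obtain ⟨i, p', hp', h⟩ := hp.exists_comp_moveFront j
      refine ((ih hp').succ i).of_eq ?_
      have key : ∀ {A X Y Z : C} (p : A ⟶ M ⊗ Y) (j : M ⊗ Y ⟶ M ⊗ Y) (q : Y ⟶ Z) (i : A ⟶ M ⊗ X)
          (p' : X ⟶ Y), p ≫ j = i ≫ M ◁ p' → i ≫ M ◁ (p' ≫ q) = p ≫ j ≫ M ◁ q := by
        intro A X Y Z p j q i p' h
        simp [reassoc_of% h]
      exact key _ _ _ _ _ h

theorem swapFront (n : ℕ) : IsPerm M (n + 2) (n + 2) (swapFront M (tensorPow M n)) := by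
  refine ((IsPerm.id (M := M) (n + 1)).succ 1).of_eq ?_
  have key : ∀ {X : C} (f : M ⊗ X ⟶ M ⊗ X) , f = 𝟙 _ →
      (M ◁ f ≫ _root_.swapFront M X) ≫ M ◁ 𝟙 _ = _root_.swapFront M X := by
    rintro X f rfl
    simp
  exact key _ (moveFront_zero M n)

theorem exists_inv_moveFront (n : ℕ) (j : Fin (n + 1)) :
    ∃ q, IsPerm M (n + 1) (n + 1) q ∧ _root_.moveFront M n j ≫ q = 𝟙 _ ∧
      q ≫ _root_.moveFront M n j = 𝟙 _ := by
  induction n with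
  | zero => exact ⟨𝟙 _, .id 1, Category.comp_id _, Category.comp_id _⟩
  | succ n ih =>
    cases j using Fin.cases with
    | zero =>
      exact ⟨𝟙 _, .id _, by rw [moveFront_zero]; exact Category.comp_id _,
        by rw [moveFront_zero]; exact Category.comp_id _⟩
    | succ j =>
      obtain ⟨q, hq, h1, h2⟩ := ih j
      have key : ∀ {X : C} (j q : M ⊗ X ⟶ M ⊗ X), j ≫ q = 𝟙 _ → q ≫ j = 𝟙 _ →
          (M ◁ j ≫ _root_.swapFront M X) ≫ _root_.swapFront M X ≫ M ◁ q = 𝟙 _ ∧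
          (_root_.swapFront M X ≫ M ◁ q) ≫ M ◁ j ≫ _root_.swapFront M X = 𝟙 _ := by
        intro X j q h1 h2
        constructor
        · rw [Category.assoc, ← Category.assoc (_root_.swapFront M X), swapFront_swapFront]
          simp [← MonoidalCategory.whiskerLeft_comp, h1]
        · rw [Category.assoc, ← MonoidalCategory.whiskerLeft_comp_assoc, h2]
          simp [swapFront_swapFront]
      exact ⟨_, (IsPerm.swapFront n).comp hq.whiskerLeft, (key _ _ h1 h2).1, (key _ _ h1 h2).2⟩

theorem exists_inv {m n : ℕ} {p : tensorPow M m ⟶ tensorPow M n} (hp : IsPerm M m n p) :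
    ∃ q, IsPerm M n m q ∧ p ≫ q = 𝟙 _ ∧ q ≫ p = 𝟙 _ := by
  induction hp with
  | zero => exact ⟨𝟙 _, .zero, Category.comp_id _, Category.comp_id _⟩
  | @succ m n j p hp ih =>
    obtain ⟨q, hq, h1, h2⟩ := ih
    obtain ⟨r, hr, h3, h4⟩ := exists_inv_moveFront (M := M) m j
    refine ⟨_, hq.whiskerLeft.comp hr, ?_⟩
    have key : ∀ {X Y : C} (j r : M ⊗ X ⟶ M ⊗ X) (p : X ⟶ Y) (q : Y ⟶ X), p ≫ q = 𝟙 _ →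
        q ≫ p = 𝟙 _ → j ≫ r = 𝟙 _ → r ≫ j = 𝟙 _ →
        (j ≫ M ◁ p) ≫ M ◁ q ≫ r = 𝟙 _ ∧ (M ◁ q ≫ r) ≫ j ≫ M ◁ p = 𝟙 _ := by
      intro X Y j r p q h1 h2 h3 h4
      constructor
      · rw [Category.assoc, ← MonoidalCategory.whiskerLeft_comp_assoc, h1]
        simpa using h3
      · rw [Category.assoc, reassoc_of% h4, ← MonoidalCategory.whiskerLeft_comp, h2]
        simp
    exact key _ _ _ _ h1 h2 h3 h4

end IsPerm

end Permutations

/-! ### Permutations and concatenation of tensor powers -/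

section Join

variable {C : Type u} [Category.{v} C] [MonoidalCategory C]

/-- The isomorphism `M^{⊗ a} ⊗ M^{⊗ b} ≅ M^{⊗ (b + a)}`. The exponents are added in this order since
`b + (a + 1)` unfolds to `(b + a) + 1`. -/
def joinPow (M : C) : (a b : ℕ) → (tensorPow M a ⊗ tensorPow M b ≅ tensorPow M (b + a))
  | 0, b => λ_ (tensorPow M b)
  | a + 1, b => α_ M (tensorPow M a) (tensorPow M b) ≪≫ whiskerLeftIso M (joinPow M a b)

theorem joinPow_one (M : C) (b : ℕ) : (joinPow M 1 b).hom = (ρ_ M).hom ▷ tensorPow M b := by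
  have key : ∀ X : C, (α_ M (𝟙_ C) X).hom ≫ M ◁ (λ_ X).hom = (ρ_ M).hom ▷ X := by
    intro X; simp
  exact key _

variable [SymmetricCategory C] {M : C}

namespace IsPerm

theorem exists_whiskerLeft_join (a : ℕ) {b b' : ℕ} {p : tensorPow M b ⟶ tensorPow M b'}
    (hp : IsPerm M b b' p) : ∃ q, IsPerm M (b + a) (b' + a) q ∧
      tensorPow M a ◁ p ≫ (joinPow M a b').hom = (joinPow M a b).hom ≫ q := by
  induction a with
  | zero => exact ⟨p, hp, leftUnitor_naturality p⟩
  | succ a ih =>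
    obtain ⟨q, hq, h⟩ := ih
    refine ⟨_, hq.whiskerLeft, ?_⟩
    have key : ∀ {A B B' D D' : C} (p : B ⟶ B') (q : D ⟶ D') (j : A ⊗ B ⟶ D) (j' : A ⊗ B' ⟶ D'),
        A ◁ p ≫ j' = j ≫ q →
        (M ⊗ A) ◁ p ≫ (α_ _ _ _).hom ≫ M ◁ j' = ((α_ _ _ _).hom ≫ M ◁ j) ≫ M ◁ q := by
      intro A B B' D D' p q j j' h
      rw [associator_naturality_right_assoc, ← MonoidalCategory.whiskerLeft_comp, h]
      simp
    exact key _ _ _ _ h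

/-- Moving a factor of the left-hand tensor power to the front is, after concatenation, again the
move of a factor to the front. -/
theorem exists_moveFront_join (a b : ℕ) (j : Fin (a + 1)) : ∃ i : Fin (b + a + 1),
    _root_.moveFront M a j ▷ tensorPow M b ≫ (joinPow M (a + 1) b).hom =
      (joinPow M (a + 1) b).hom ≫ _root_.moveFront M (b + a) i := by
  have key0 : ∀ {A B D : C} (f : M ⊗ A ⟶ M ⊗ A) (g : M ⊗ D ⟶ M ⊗ D) (j : (M ⊗ A) ⊗ B ⟶ M ⊗ D),
      f = 𝟙 _ → g = 𝟙 _ → f ▷ B ≫ j = j ≫ g := by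
    rintro A B D f g j rfl rfl
    simp
  induction a with
  | zero => exact ⟨0, key0 _ _ _ (by cases j using Fin.cases with
      | zero => rfl
      | succ j => exact j.elim0) (moveFront_zero M b)⟩
  | succ a ih =>
    cases j using Fin.cases with
    | zero => exact ⟨0, key0 _ _ _ (moveFront_zero M _) (moveFront_zero M _)⟩
    | succ j =>
      obtain ⟨i, h⟩ := ih j
      refine ⟨i.succ, ?_⟩
      have key : ∀ {A B D : C} (f : M ⊗ A ⟶ M ⊗ A) (g : M ⊗ D ⟶ M ⊗ D) (j : A ⊗ B ⟶ D),
          f ▷ B ≫ (α_ _ _ _).hom ≫ M ◁ j = ((α_ _ _ _).hom ≫ M ◁ j) ≫ g →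
          (M ◁ f ≫ _root_.swapFront M A) ▷ B ≫ (α_ _ _ _).hom ≫ M ◁ ((α_ _ _ _).hom ≫ M ◁ j) =
            ((α_ _ _ _).hom ≫ M ◁ ((α_ _ _ _).hom ≫ M ◁ j)) ≫ M ◁ g ≫ _root_.swapFront M D := by
        intro A B D f g j h
        have h' := congrArg (fun t => (α_ _ _ _).hom ≫ M ◁ t ≫ _root_.swapFront M D) h
        simp only [MonoidalCategory.whiskerLeft_comp, Category.assoc, comp_whiskerRight] at h' ⊢
        rw [← h', ← swapFront_naturality]
        simp [_root_.swapFront]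
      exact key _ _ _ h

theorem exists_whiskerRight_join {a a' : ℕ} (b : ℕ) {p : tensorPow M a ⟶ tensorPow M a'}
    (hp : IsPerm M a a' p) : ∃ q, IsPerm M (b + a) (b + a') q ∧
      p ▷ tensorPow M b ≫ (joinPow M a' b).hom = (joinPow M a b).hom ≫ q := by
  induction hp with
  | zero =>
    refine ⟨𝟙 _, .id _, ?_⟩
    have key : ∀ {X Y : C} (f : 𝟙_ C ⊗ X ⟶ Y), 𝟙 (𝟙_ C) ▷ X ≫ f = f ≫ 𝟙 _ := by
      intros; simp
    exact key _
  | @succ a a' j p hp ih =>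
    obtain ⟨q, hq, h⟩ := ih
    obtain ⟨i, hi⟩ := exists_moveFront_join (M := M) a b j
    refine ⟨_, hq.succ i, ?_⟩
    have key : ∀ {A A' B D D' : C} (f : M ⊗ A ⟶ M ⊗ A) (p : A ⟶ A') (j : A ⊗ B ⟶ D)
        (j' : A' ⊗ B ⟶ D') (q : D ⟶ D') (i : M ⊗ D ⟶ M ⊗ D), p ▷ B ≫ j' = j ≫ q →
        f ▷ B ≫ (α_ _ _ _).hom ≫ M ◁ j = ((α_ _ _ _).hom ≫ M ◁ j) ≫ i →
        (f ≫ M ◁ p) ▷ B ≫ (α_ _ _ _).hom ≫ M ◁ j' = ((α_ _ _ _).hom ≫ M ◁ j) ≫ i ≫ M ◁ q := by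
      intro A A' B D D' f p j j' q i h h'
      have h'' := congrArg (fun t => t ≫ M ◁ q) h'
      simp only [Category.assoc] at h'' ⊢
      rw [← h'', ← MonoidalCategory.whiskerLeft_comp, ← h]
      simp
    exact key _ _ _ _ _ _ h hi

/-- Concatenation is associative up to the identification of `c + b + a` with `c + (b + a)`, which
is a symmetry. -/
theorem exists_assoc_join (a b c : ℕ) : ∃ q, IsPerm M (c + b + a) (c + (b + a)) q ∧
    (joinPow M a b).hom ▷ tensorPow M c ≫ (joinPow M (b + a) c).hom =
      (α_ _ _ _).hom ≫ tensorPow M a ◁ (joinPow M b c).hom ≫ (joinPow M a (c + b)).hom ≫ q := by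
  induction a with
  | zero =>
    refine ⟨𝟙 _, .id _, ?_⟩
    have key : ∀ {A B D : C} (j : A ⊗ B ⟶ D), (λ_ A).hom ▷ B ≫ j =
        (α_ _ _ _).hom ≫ 𝟙_ C ◁ j ≫ (λ_ D).hom ≫ 𝟙 D := by
      intros; simp
    exact key _
  | succ a ih =>
    obtain ⟨q, hq, h⟩ := ih
    refine ⟨_, hq.whiskerLeft, ?_⟩
    have key : ∀ {A B D AB BD X Y : C} (j : A ⊗ B ⟶ AB) (k : AB ⊗ D ⟶ X) (j' : B ⊗ D ⟶ BD)
        (k' : A ⊗ BD ⟶ Y) (q : Y ⟶ X), j ▷ D ≫ k = (α_ _ _ _).hom ≫ A ◁ j' ≫ k' ≫ q →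
        ((α_ M _ _).hom ≫ M ◁ j) ▷ D ≫ (α_ _ _ _).hom ≫ M ◁ k =
          (α_ _ _ _).hom ≫ (M ⊗ A) ◁ j' ≫ ((α_ _ _ _).hom ≫ M ◁ k') ≫ M ◁ q := by
      intro A B D AB BD X Y j k j' k' q h
      simp only [comp_whiskerRight, Category.assoc, associator_naturality_middle_assoc]
      rw [← MonoidalCategory.whiskerLeft_comp, h]
      simp
    exact key _ _ _ _ _ h

theorem exists_join_zero (a : ℕ) : ∃ q, IsPerm M a (0 + a) q ∧
    (joinPow M a 0).hom = (ρ_ (tensorPow M a)).hom ≫ q := by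
  induction a with
  | zero =>
    refine ⟨𝟙 _, .id _, ?_⟩
    have key : (λ_ (𝟙_ C)).hom = (ρ_ (𝟙_ C)).hom ≫ 𝟙 _ := by simp [unitors_equal]
    exact key
  | succ a ih =>
    obtain ⟨q, hq, h⟩ := ih
    refine ⟨_, hq.whiskerLeft, ?_⟩
    have key : ∀ {A B : C} (j : A ⊗ 𝟙_ C ⟶ B) (q : A ⟶ B), j = (ρ_ A).hom ≫ q →
        (α_ _ _ _).hom ≫ M ◁ j = (ρ_ (M ⊗ A)).hom ≫ M ◁ q := by
      rintro A B j q rfl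
      simp
    exact key _ _ h

/-- The braiding of one factor with a tensor power is a symmetry; this is the induction step for the
braiding of two tensor powers. -/
theorem exists_braiding_one (b : ℕ) : ∃ q, IsPerm M (b + 1) (1 + b) q ∧
    (β_ M (tensorPow M b)).hom ≫ tensorPow M b ◁ (ρ_ M).inv ≫ (joinPow M b 1).hom = q := by
  induction b with
  | zero =>
    refine ⟨𝟙 _, .id _, ?_⟩
    have key : (β_ M (𝟙_ C)).hom ≫ 𝟙_ C ◁ (ρ_ M).inv ≫ (λ_ (M ⊗ 𝟙_ C)).hom = 𝟙 (M ⊗ 𝟙_ C) := by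
      rw [braiding_tensorUnit_right]
      monoidal
    exact key
  | succ b ih =>
    obtain ⟨q, hq, h⟩ := ih
    refine ⟨_, (IsPerm.swapFront b).comp hq.whiskerLeft, ?_⟩
    have key : ∀ {B D : C} (j : B ⊗ M ⊗ 𝟙_ C ⟶ D) (q : M ⊗ B ⟶ D),
        (β_ M B).hom ≫ B ◁ (ρ_ M).inv ≫ j = q →
        (β_ M (M ⊗ B)).hom ≫ (M ⊗ B) ◁ (ρ_ M).inv ≫ (α_ _ _ _).hom ≫ M ◁ j =
          _root_.swapFront M B ≫ M ◁ q := by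
      rintro B D j q rfl
      rw [_root_.swapFront, BraidedCategory.braiding_tensor_right_hom]
      monoidal
    exact key _ _ h

theorem exists_braiding_join (a b : ℕ) : ∃ q, IsPerm M (b + a) (a + b) q ∧
    (β_ (tensorPow M a) (tensorPow M b)).hom ≫ (joinPow M b a).hom = (joinPow M a b).hom ≫ q := by
  induction a with
  | zero =>
    obtain ⟨q, hq, h⟩ := exists_join_zero (M := M) b
    refine ⟨q, hq, ?_⟩
    have key : ∀ {B D : C} (j : B ⊗ 𝟙_ C ⟶ D) (q : B ⟶ D), j = (ρ_ B).hom ≫ q →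
        (β_ (𝟙_ C) B).hom ≫ j = (λ_ B).hom ≫ q := by
      rintro B D j q rfl
      simp [braiding_tensorUnit_left]
    exact key _ _ h
  | succ a ih =>
    obtain ⟨q1, hq1, h1⟩ := ih
    obtain ⟨q2, hq2, h2⟩ := exists_braiding_one (M := M) b
    obtain ⟨q3, hq3, h3⟩ := exists_whiskerRight_join a hq2
    obtain ⟨q4, hq4, h4⟩ := exists_assoc_join (M := M) b 1 a
    obtain ⟨r, hr, hqr, hrq⟩ := hq4.exists_inv
    refine ⟨_, hq1.whiskerLeft.comp (hq3.comp hr), ?_⟩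
    rw [joinPow_one] at h4
    have key : ∀ {A B D E F G H : C} (jab : A ⊗ B ⟶ D) (jba : B ⊗ A ⟶ E) (q1 : D ⟶ E)
        (j1 : B ⊗ M ⊗ 𝟙_ C ⟶ F) (q2 : M ⊗ B ⟶ F) (jF : F ⊗ A ⟶ G) (q3 : M ⊗ E ⟶ G)
        (jH : B ⊗ M ⊗ A ⟶ H) (q4 : H ⟶ G) (r : G ⟶ H),
        (β_ A B).hom ≫ jba = jab ≫ q1 → (β_ M B).hom ≫ B ◁ (ρ_ M).inv ≫ j1 = q2 →
        q2 ▷ A ≫ jF = ((α_ _ _ _).hom ≫ M ◁ jba) ≫ q3 →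
        j1 ▷ A ≫ jF = (α_ _ _ _).hom ≫ B ◁ ((ρ_ M).hom ▷ A) ≫ jH ≫ q4 → q4 ≫ r = 𝟙 _ →
        (β_ (M ⊗ A) B).hom ≫ jH = ((α_ _ _ _).hom ≫ M ◁ jab) ≫ M ◁ q1 ≫ q3 ≫ r := by
      intro A B D E F G H jab jba q1 j1 q2 jF q3 jH q4 r h1 h2 h3 h4 hr
      have h3' := congrArg (fun t => (α_ _ _ _).inv ≫ t ≫ r) h3
      have h4' := congrArg (fun t => t ≫ r) h4
      simp only [Category.assoc, hr, Category.comp_id, Iso.inv_hom_id_assoc] at h3' h4'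
      simp only [Category.assoc]
      rw [← MonoidalCategory.whiskerLeft_comp_assoc, ← h1, MonoidalCategory.whiskerLeft_comp_assoc,
        ← h3', ← h2]
      simp only [comp_whiskerRight, Category.assoc, h4']
      rw [BraidedCategory.braiding_tensor_left_hom]
      monoidal
    exact key _ _ _ _ _ _ _ _ _ _ h1 h2 h3 h4 hqr

end IsPerm

end Join

/-! ### Trees as operations in monoids, and reduction -/

namespace RawTree

section Interp

variable {l : ℕ} {I : Type} {k : I → ℕ} {G : Type w} [Monoid G]

/-- The value of a tree in a monoid `G`: the legs are replaced by elements of `G`, the white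
vertices act by arbitrary operations on `G` and the black vertices by multiplication. -/
def interp (φ : ∀ i, (Fin (k i) → G) → G) (a : Fin l → G) : RawTree l k → G
  | leg x => a x
  | white i ch => φ i (fun x => (ch x).interp φ a)
  | black n ch => (List.ofFn (fun x : Fin n => (ch x).interp φ a)).prod
  | special => 1

variable (φ : ∀ i, (Fin (k i) → G) → G) (a : Fin l → G)

theorem interp_joinFactors (L : List (RawTree l k)) :
    (joinFactors L).interp φ a = (L.map (interp φ a)).prod := by
  match L with
  | [] => rfl
  | [T] => simp [joinFactors]
  | S :: T :: L =>
    rw [joinFactors, interp]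
    congr 1
    apply List.ext_get <;> simp

theorem prod_map_factors (T : RawTree l k) :
    (T.factors.map (interp φ a)).prod = T.interp φ a := by
  cases T <;> simp [factors, interp, Function.comp_def]

theorem prod_map_catLists {α : Type} (f : α → G) (n : ℕ) (L : Fin n → List α) :
    ((catLists n L).map f).prod = (List.ofFn (fun x => ((L x).map f).prod)).prod := by
  induction n with
  | zero => simp [catLists]
  | succ n ih => simp [catLists, ih]

/-- Reduction at a black vertex does not change the value, by associativity and unitality. -/
theorem interp_mkBlack (n : ℕ) (ch : Fin n → RawTree l k) :
    (mkBlack n ch).interp φ a = (List.ofFn (fun x => (ch x).interp φ a)).prod := by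
  simp only [mkBlack, interp_joinFactors, prod_map_catLists, prod_map_factors]

/-- The reduced form of a tree. -/
def reduce : RawTree l k → RawTree l k
  | leg x => leg x
  | white i ch => white i (fun x => (ch x).reduce)
  | black n ch => mkBlack n (fun x => (ch x).reduce)
  | special => special

theorem isReduced_reduce (T : RawTree l k) : T.reduce.IsReduced := by
  induction T with
  | leg x => trivial
  | white i ch ih => exact ih
  | black n ch ih => exact isReduced_mkBlack _ _ ih
  | special => trivial

theorem interp_reduce (T : RawTree l k) : T.reduce.interp φ a = T.interp φ a := by
  induction T with
  | leg x => rfl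
  | white i ch ih => simp only [reduce, interp, ih]
  | black n ch ih => simp only [reduce, interp, interp_mkBlack, ih]
  | special => rfl

theorem interp_relabel {J : Type} (e : I ≃ J) {k : J → ℕ} (φ : ∀ j, (Fin (k j) → G) → G)
    (T : RawTree l (fun i => k (e i))) :
    (T.relabel e k).interp φ a = T.interp (fun i => φ (e i)) a := by
  induction T with
  | leg x => rfl
  | white i ch ih => simp only [relabel, interp, ih]
  | black n ch ih => simp only [relabel, interp, ih]
  | special => rfl

variable {J : I → Type} {m : ∀ i, J i → ℕ}

theorem interp_graft (φ : ∀ p : Σ i, J i, (Fin (m p.1 p.2) → G) → G) (i : I) {n : ℕ}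
    (sub : Fin n → RawTree l (fun p : Σ i, J i => m p.1 p.2)) (S : RawTree n (m i)) :
    (S.graft i sub).interp φ a =
      S.interp (fun j => φ ⟨i, j⟩) (fun x => (sub x).interp φ a) := by
  induction S with
  | leg x => rfl
  | white j ch ih => simp only [graft, interp, ih]
  | black r ch ih => simp only [graft, interp, interp_mkBlack, ih]
  | special => rfl

/-- Insertion of trees into the white vertices corresponds to composition of the operations. -/
theorem interp_insert (φ : ∀ p : Σ i, J i, (Fin (m p.1 p.2) → G) → G)
    (S : ∀ i, RawTree (k i) (m i)) (T : RawTree l k) :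
    (T.insert S).interp φ a =
      T.interp (fun i b => (S i).interp (fun j => φ ⟨i, j⟩) b) a := by
  induction T with
  | leg x => rfl
  | white i ch ih => simp only [insert, interp, interp_graft, ih]
  | black n ch ih => simp only [insert, interp, interp_mkBlack, ih]
  | special => rfl

end Interp

end RawTree

section Cast

variable {C : Type u} [Category.{v} C] [MonoidalCategory C]

/-- The identification of tensor powers with equal exponents. -/
def castPow (M : C) {m n : ℕ} (h : m = n) : tensorPow M m ⟶ tensorPow M n :=
  eqToHom (congrArg (tensorPow M) h)

theorem castPow_self (M : C) {m : ℕ} (h : m = m) : castPow M h = 𝟙 _ := rfl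

theorem castPow_succ (M : C) {m n : ℕ} (h : m = n) (h' : m + 1 = n + 1) :
    castPow M h' = M ◁ castPow M h := by
  subst h
  exact (MonoidalCategory.whiskerLeft_id M (tensorPow M m)).symm

theorem splitPow_right_nil {α : Type} (M : C) (L : List α) :
    splitPow M L [] = castPow M (by simp) ≫ (ρ_ (tensorPow M L.length)).inv := by
  induction L with
  | nil =>
    have key : (λ_ (𝟙_ C)).inv = 𝟙 _ ≫ (ρ_ (𝟙_ C)).inv := by simp [unitors_inv_equal]
    exact (splitPow_nil M ([] : List α)).trans key
  | cons a L ih =>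
    have key : ∀ {A B : C} (s : A ⟶ B ⊗ 𝟙_ C) (c : A ⟶ B) (c' : M ⊗ A ⟶ M ⊗ B),
        s = c ≫ (ρ_ B).inv → c' = M ◁ c →
        M ◁ s ≫ (α_ M B (𝟙_ C)).inv = c' ≫ (ρ_ (M ⊗ B)).inv := by
      rintro A B s c c' rfl rfl
      simp
    exact (splitPow_cons M a L []).trans (key _ _ _ ih (castPow_succ M _ _))

theorem splitPow_assoc {α : Type} (M : C) (L L' L'' : List α) :
    splitPow M (L ++ L') L'' ≫ splitPow M L L' ▷ _ ≫ (α_ _ _ _).hom =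
      castPow M (by simp) ≫ splitPow M L (L' ++ L'') ≫ _ ◁ splitPow M L' L'' := by
  induction L with
  | nil =>
    rw [splitPow_nil, splitPow_nil]
    have key : ∀ {X Y Z : C} (f : X ⟶ Y ⊗ Z), f ≫ (λ_ Y).inv ▷ Z ≫ (α_ (𝟙_ C) Y Z).hom =
        𝟙 _ ≫ (λ_ X).inv ≫ 𝟙_ C ◁ f := by
      intros; simp
    exact key _
  | cons a L ih =>
    have h : splitPow M (a :: L ++ L') L'' = _ := splitPow_cons M a (L ++ L') L''
    have h' : splitPow M (a :: L) L' = _ := splitPow_cons M a L L'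
    have h'' : splitPow M (a :: L) (L' ++ L'') = _ := splitPow_cons M a L (L' ++ L'')
    rw [h, h', h'', castPow_succ M (show (L ++ L' ++ L'').length = (L ++ (L' ++ L'')).length by
      simp)]
    have key : ∀ {X X' Y A B D E : C} (s : X ⟶ Y ⊗ E) (t : Y ⟶ A ⊗ B) (c : X ⟶ X')
        (s' : X' ⟶ A ⊗ D) (t' : D ⟶ B ⊗ E), s ≫ t ▷ E ≫ (α_ _ _ _).hom = c ≫ s' ≫ A ◁ t' →
        (M ◁ s ≫ (α_ _ _ _).inv) ≫ (M ◁ t ≫ (α_ _ _ _).inv) ▷ E ≫ (α_ (M ⊗ A) B E).hom =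
          M ◁ c ≫ (M ◁ s' ≫ (α_ _ _ _).inv) ≫ (M ⊗ A) ◁ t' := by
      intro X X' Y A B D E s t c s' t' h
      have h' := congrArg (fun f => M ◁ f ≫ (α_ M A (B ⊗ E)).inv) h
      simp at h' ⊢
      rw [h']
    exact key _ _ _ _ _ ih

/-- Maps out of a tensor power of `M` whose factors carry labels in `α`. -/
structure LabelledMap (α : Type) (M : C) : Type v where
  labels : List α
  hom : tensorPow M labels.length ⟶ M

namespace LabelledMap

variable {α : Type} {M : C}

theorem mk_eq {L L' : List α} (h : L = L') {f : tensorPow M L.length ⟶ M}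
    {f' : tensorPow M L'.length ⟶ M} (hf : f = castPow M (by rw [h]) ≫ f') :
    (⟨L, f⟩ : LabelledMap α M) = ⟨L', f'⟩ := by
  subst h
  rw [hf, castPow_self, Category.id_comp]

/-- The product of two maps is their tensor product followed by the multiplication of `M`. -/
instance [MonObj M] : Monoid (LabelledMap α M) where
  mul x y := ⟨x.labels ++ y.labels, splitPow M x.labels y.labels ≫ (x.hom ⊗ₘ y.hom) ≫ MonObj.mul⟩
  one := ⟨[], MonObj.one⟩
  mul_assoc x y z := by
    obtain ⟨L, f⟩ := x
    obtain ⟨L', f'⟩ := y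
    obtain ⟨L'', f''⟩ := z
    refine mk_eq (List.append_assoc L L' L'') ?_
    have key : ∀ {X X' Y A B D E : C} (s : X ⟶ Y ⊗ E) (t : Y ⟶ A ⊗ B) (c : X ⟶ X')
        (s' : X' ⟶ A ⊗ D) (t' : D ⟶ B ⊗ E) (f : A ⟶ M) (f' : B ⟶ M) (f'' : E ⟶ M),
        s ≫ t ▷ E ≫ (α_ _ _ _).hom = c ≫ s' ≫ A ◁ t' →
        s ≫ ((t ≫ (f ⊗ₘ f') ≫ MonObj.mul) ⊗ₘ f'') ≫ MonObj.mul =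
          c ≫ s' ≫ (f ⊗ₘ (t' ≫ (f' ⊗ₘ f'') ≫ MonObj.mul)) ≫ MonObj.mul := by
      intro X X' Y A B D E s t c s' t' f f' f'' h
      have h' := congrArg (fun r => r ≫ (f ⊗ₘ f' ⊗ₘ f'') ≫ M ◁ MonObj.mul ≫ MonObj.mul) h
      simp only [Category.assoc] at h'
      have e1 : ((t ≫ (f ⊗ₘ f') ≫ MonObj.mul) ⊗ₘ f'') =
          t ▷ E ≫ ((f ⊗ₘ f') ⊗ₘ f'') ≫ MonObj.mul ▷ M := by
        simp only [← tensorHom_id, tensorHom_comp_tensorHom, Category.id_comp, Category.comp_id]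
      have e2 : (f ⊗ₘ (t' ≫ (f' ⊗ₘ f'') ≫ MonObj.mul)) =
          A ◁ t' ≫ (f ⊗ₘ f' ⊗ₘ f'') ≫ M ◁ MonObj.mul := by
        simp only [← id_tensorHom, tensorHom_comp_tensorHom, Category.id_comp, Category.comp_id]
      rw [e1, e2]
      simp only [Category.assoc]
      rw [← h', MonObj.mul_assoc, associator_naturality_assoc]
    exact key _ _ _ _ _ _ _ _ (splitPow_assoc M L L' L'')
  one_mul x := by
    obtain ⟨L, f⟩ := x
    refine mk_eq (List.nil_append L) ?_
    have key : ∀ {X : C} (s : X ⟶ 𝟙_ C ⊗ X) (f : X ⟶ M), s = (λ_ X).inv →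
        s ≫ (MonObj.one ⊗ₘ f) ≫ MonObj.mul = 𝟙 _ ≫ f := by
      rintro X s f rfl
      simp [MonoidalCategory.tensorHom_def']
    exact key _ _ (splitPow_nil M L)
  mul_one x := by
    obtain ⟨L, f⟩ := x
    refine mk_eq (List.append_nil L) ?_
    have key : ∀ {X Y : C} (c : X ⟶ Y) (s : X ⟶ Y ⊗ 𝟙_ C) (f : Y ⟶ M), s = c ≫ (ρ_ Y).inv →
        s ≫ (f ⊗ₘ MonObj.one) ≫ MonObj.mul = c ≫ f := by
      rintro X Y c s f rfl
      simp [MonoidalCategory.tensorHom_def]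
    exact key _ _ _ (splitPow_right_nil M L)

theorem mul_def [MonObj M] (x y : LabelledMap α M) :
    x * y =
      ⟨x.labels ++ y.labels, splitPow M x.labels y.labels ≫ (x.hom ⊗ₘ y.hom) ≫ MonObj.mul⟩ := rfl

/-- The product of several labelled maps is their tensor product followed by the iterated
multiplication. -/
theorem prod_ofFn [MonObj M] (n : ℕ) (x : Fin n → LabelledMap α M) : (List.ofFn x).prod =
    ⟨catLists n (fun i => (x i).labels), blockTensor M n _ (fun i => (x i).hom) ≫ iterMul M n⟩ := by
  induction n with
  | zero =>
    rw [List.ofFn_zero, List.prod_nil]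
    exact mk_eq rfl ((Category.id_comp _).trans (Category.id_comp _)).symm
  | succ n ih =>
    rw [List.ofFn_succ, List.prod_cons, ih, mul_def]
    refine mk_eq rfl ?_
    have key : ∀ {X A B D : C} (s : X ⟶ A ⊗ B) (f : A ⟶ M) (g : B ⟶ D) (h : D ⟶ M),
        s ≫ (f ⊗ₘ (g ≫ h)) ≫ MonObj.mul = 𝟙 _ ≫ (s ≫ (f ⊗ₘ g)) ≫ M ◁ h ≫ MonObj.mul := by
      intro X A B D s f g h
      simp [MonoidalCategory.tensorHom_def]
    exact key _ _ _ _

end LabelledMap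

namespace RawTree

variable {l : ℕ} {I : Type} {k : I → ℕ} (M : C) [MonObj M] (f : ∀ i, tensorPow M (k i) ⟶ M)

/-- The operation on labelled maps given by a map `f : M^{⊗ n} ⟶ M`. -/
def _root_.LabelledMap.apply {α : Type} {n : ℕ} (f : tensorPow M n ⟶ M)
    (x : Fin n → LabelledMap α M) : LabelledMap α M :=
  ⟨catLists n (fun j => (x j).labels), blockTensor M n _ (fun j => (x j).hom) ≫ f⟩

/-- Composition along a tree is an instance of the evaluation of trees in monoids, which is why it
is insensitive to reduction. -/
theorem interp_eq_eval (T : RawTree l k) :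
    T.interp (G := LabelledMap (Fin l) M) (fun i => LabelledMap.apply M (f i))
      (fun a => ⟨[a], (ρ_ M).hom⟩) = ⟨T.legs, T.eval M f⟩ := by
  induction T with
  | leg a => rfl
  | white i ch ih => exact congrArg (LabelledMap.apply M (f i)) (funext ih)
  | black n ch ih =>
    exact (congrArg (fun x => (List.ofFn x).prod) (funext ih)).trans (LabelledMap.prod_ofFn n _)
  | special => rfl

/-- Reduction of a tree changes neither the order of its legs nor the map it represents. -/
theorem eval_reduce (T : RawTree l k) : (⟨T.reduce.legs, T.reduce.eval M f⟩ :
    LabelledMap (Fin l) M) = ⟨T.legs, T.eval M f⟩ := by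
  rw [← interp_eq_eval, ← interp_eq_eval, interp_reduce]

end RawTree

end Cast

/-! ### Maps represented by trees and forests -/

section Relabelling

/-- The list `L` enumerates `Fin l` without repetition. -/
structure IsEnum {l : ℕ} (L : List (Fin l)) : Prop where
  nodup : L.Nodup
  mem : ∀ a, a ∈ L

/-- The bijection from positions to entries given by an enumeration. -/
def IsEnum.equiv {l : ℕ} {L : List (Fin l)} (h : IsEnum L) : Fin L.length ≃ Fin l :=
  h.nodup.getEquivOfForallMemList L h.mem

variable {C : Type u} [Category.{v} C] [MonoidalCategory C]

theorem splitPow_castPow {α β : Type} (M : C) {A B : List α} {A' B' : List β}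
    (hA : A.length = A'.length) (hB : B.length = B'.length)
    (h : (A ++ B).length = (A' ++ B').length) :
    splitPow M A B ≫ (castPow M hA ⊗ₘ castPow M hB) = castPow M h ≫ splitPow M A' B' := by
  induction A generalizing A' with
  | nil =>
    cases A' with
    | cons a' A' => simp at hA
    | nil =>
      rw [splitPow_nil, splitPow_nil]
      have key : ∀ {X Y : C} (f : X ⟶ Y), (λ_ X).inv ≫ (𝟙 (𝟙_ C) ⊗ₘ f) = f ≫ (λ_ Y).inv := by
        intro X Y f
        simp
      exact key _
  | cons a A ih =>
    cases A' with
    | nil => simp at hA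
    | cons a' A' =>
      have hA' : A.length = A'.length := by simpa using hA
      have h' : (A ++ B).length = (A' ++ B').length := by simpa using h
      have key : ∀ {X X' D E D' E' : C} (s : X ⟶ D ⊗ E) (a : D ⟶ D') (b : E ⟶ E') (c : X ⟶ X')
          (s' : X' ⟶ D' ⊗ E') (ma : M ⊗ D ⟶ M ⊗ D') (mc : M ⊗ X ⟶ M ⊗ X'),
          s ≫ (a ⊗ₘ b) = c ≫ s' → ma = M ◁ a → mc = M ◁ c →
          (M ◁ s ≫ (α_ _ _ _).inv) ≫ (ma ⊗ₘ b) = mc ≫ M ◁ s' ≫ (α_ _ _ _).inv := by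
        rintro X X' D E D' E' s a b c s' ma mc h rfl rfl
        rw [← MonoidalCategory.whiskerLeft_comp_assoc, ← h, ← id_tensorHom M a, Category.assoc,
          ← associator_inv_naturality]
        simp
      have e1 := splitPow_cons M a A B
      have e2 := splitPow_cons M a' A' B'
      refine (congrArg (fun t => t ≫ _) e1).trans (Eq.trans ?_ (congrArg (fun t => _ ≫ t) e2.symm))
      exact key _ _ _ _ _ _ _ (ih hA' h') (castPow_succ M hA' hA) (castPow_succ M h' h)

theorem blockTensor_castPow {α β : Type} (M : C) {n : ℕ} {L : Fin n → List α} {L' : Fin n → List β}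
    (hL : ∀ x, (L x).length = (L' x).length) (w : ∀ x, tensorPow M (L x).length ⟶ M)
    (w' : ∀ x, tensorPow M (L' x).length ⟶ M) (hw : ∀ x, w x = castPow M (hL x) ≫ w' x)
    (h : (catLists n L).length = (catLists n L').length) :
    blockTensor M n L w = castPow M h ≫ blockTensor M n L' w' := by
  induction n with
  | zero => exact (Category.comp_id _).symm
  | succ n ih =>
    have h' : (catLists n fun i => L i.succ).length = (catLists n fun i => L' i.succ).length := by
      simpa [catLists, hL 0] using h
    have key : ∀ {X X' A A' B B' D : C} (s : X ⟶ A ⊗ B) (a : A ⟶ A') (b : B ⟶ B')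
        (c : X ⟶ X') (s' : X' ⟶ A' ⊗ B') (w : A ⟶ M) (w' : A' ⟶ M) (x : B ⟶ D) (x' : B' ⟶ D),
        s ≫ (a ⊗ₘ b) = c ≫ s' → w = a ≫ w' → x = b ≫ x' →
        s ≫ (w ⊗ₘ x) = c ≫ s' ≫ (w' ⊗ₘ x') := by
      rintro X X' A A' B B' D s a b c s' w w' x x' h rfl rfl
      rw [← reassoc_of% h]
      simp
    exact key _ _ _ _ _ _ _ _ _ (splitPow_castPow M (hL 0) h' h) (hw 0)
      (ih (fun i => hL i.succ) _ _ (fun i => hw i.succ) h')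

namespace RawTree

variable {l l' : ℕ} {I : Type} {k : I → ℕ}

/-- Change the labels of the legs. -/
def mapLegs (ψ : Fin l → Fin l') : RawTree l k → RawTree l' k
  | leg a => leg (ψ a)
  | white i ch => white i (fun x => (ch x).mapLegs ψ)
  | black n ch => black n (fun x => (ch x).mapLegs ψ)
  | special => special

theorem legs_mapLegs (ψ : Fin l → Fin l') (T : RawTree l k) :
    (T.mapLegs ψ).legs = T.legs.map ψ := by
  induction T with
  | leg a => rfl
  | white i ch ih => simp only [mapLegs, legs, ih, map_catLists]
  | black n ch ih => simp only [mapLegs, legs, ih, map_catLists]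
  | special => rfl

theorem eval_mapLegs (M : C) [MonObj M] (f : ∀ i, tensorPow M (k i) ⟶ M) (ψ : Fin l → Fin l')
    (T : RawTree l k) (h : (T.mapLegs ψ).legs.length = T.legs.length) :
    (T.mapLegs ψ).eval M f = castPow M h ≫ T.eval M f := by
  have hl : ∀ T : RawTree l k, (T.mapLegs ψ).legs.length = T.legs.length := by
    simp [legs_mapLegs]
  have key : ∀ {A B D E : C} (a : A ⟶ D) (c : A ⟶ B) (b : B ⟶ D) (f : D ⟶ E),
      a = c ≫ b → a ≫ f = c ≫ b ≫ f := by
    rintro A B D E a c b f rfl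
    simp
  induction T with
  | leg a => exact (Category.id_comp _).symm
  | white i ch ih =>
    exact key _ _ _ _ (blockTensor_castPow M (fun x => hl (ch x)) _ _ (fun x => ih x (hl _)) h)
  | black n ch ih =>
    exact key _ _ _ _ (blockTensor_castPow M (fun x => hl (ch x)) _ _ (fun x => ih x (hl _)) h)
  | special => exact (Category.id_comp _).symm

end RawTree

end Relabelling

section TreeMaps

variable {C : Type u} [Category.{v} C] [MonoidalCategory C] [SymmetricCategory C] {M : C}

theorem permute_castPow {m m' n : ℕ} (σ : Fin m ≃ Fin n) (h : m = m') :
    permute M m n σ ≫ castPow M h = permute M m' n ((finCongr h.symm).trans σ) := by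
  subst h
  exact Category.comp_id _

theorem IsPerm.castPow {m n : ℕ} (h : m = n) : IsPerm M m n (castPow M h) := by
  subst h
  exact IsPerm.id m

theorem IsPerm.exists_splitPow_join {α : Type} (L L' : List α) :
    ∃ q, IsPerm M _ _ q ∧ splitPow M L L' ≫ (joinPow M L.length L'.length).hom = q := by
  induction L with
  | nil =>
    rw [splitPow_nil]
    exact ⟨𝟙 _, .id _, Iso.inv_hom_id _⟩
  | cons a L ih =>
    obtain ⟨q, hq, h⟩ := ih
    rw [splitPow_cons]
    refine ⟨_, hq.whiskerLeft, ?_⟩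
    have key : ∀ {X Y A B : C} (s : X ⟶ A ⊗ B) (j : A ⊗ B ⟶ Y) (q : X ⟶ Y), s ≫ j = q →
        (M ◁ s ≫ (α_ M A B).inv) ≫ (α_ M A B).hom ≫ M ◁ j = M ◁ q := by
      rintro X Y A B s j q rfl
      simp
    exact key _ _ _ h

/-- Every symmetry onto the tensor power indexed by an enumeration is the canonical one for a
suitable change of labels. -/
theorem exists_relabel {l l' : ℕ} {L : List (Fin l)} (hL : IsEnum L)
    {p : tensorPow M l' ⟶ tensorPow M L.length} (hp : IsPerm M _ _ p) :
    ∃ ψ : Fin l → Fin l', ∀ L' : List (Fin l'), L' = L.map ψ → ∃ (h : IsEnum L')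
      (hl : L'.length = L.length), permute M _ _ h.equiv ≫ castPow M hl = p := by
  obtain ⟨σ, rfl⟩ := hp.exists_permute
  refine ⟨fun a => σ (hL.equiv.symm a), ?_⟩
  rintro _ rfl
  refine ⟨⟨hL.nodup.map (σ.injective.comp hL.equiv.symm.injective), fun a => ?_⟩, by simp, ?_⟩
  · exact List.mem_map.2 ⟨hL.equiv (σ.symm a), hL.mem _, by simp⟩
  · rw [permute_castPow]
    congr 1
    ext i : 1
    have h : hL.equiv.symm (L.get i) = i := (hL.equiv.symm_apply_eq).2 rfl
    refine Eq.trans ?_ (congrArg σ h)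
    simp only [IsEnum.equiv, List.Nodup.getEquivOfForallMemList, Equiv.trans_apply, Equiv.coe_fn_mk,
      List.get_eq_getElem, List.getElem_map]
    rfl

variable {I : Type} {k : I → ℕ} [MonObj M] (f : ∀ i, tensorPow M (k i) ⟶ M)

/-- The maps `M^{⊗ l} ⟶ M` represented by trees, possibly not reduced. -/
def treeMaps (l : ℕ) : Set (tensorPow M l ⟶ M) :=
  {g | ∃ (T : RawTree l k) (h : IsEnum T.legs), g = permute M _ _ h.equiv ≫ T.eval M f}

/-- The maps `M^{⊗ l} ⟶ M^{⊗ n}` represented by forests of `n` trees. -/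
def forestMaps (n l : ℕ) : Set (tensorPow M l ⟶ tensorPow M n) :=
  {g | ∃ (F : Fin n → RawTree l k) (h : IsEnum (catLists n (fun x => (F x).legs))),
    g = permute M _ _ h.equiv ≫ blockTensor M n _ (fun x => (F x).eval M f)}

variable {f}

theorem perm_comp_mem_treeMaps {l l' : ℕ} {g : tensorPow M l ⟶ M} (hg : g ∈ treeMaps f l)
    {p : tensorPow M l' ⟶ tensorPow M l} (hp : IsPerm M _ _ p) : p ≫ g ∈ treeMaps f l' := by
  obtain ⟨T, h, rfl⟩ := hg
  obtain ⟨ψ, hψ⟩ := exists_relabel h (hp.comp (isPerm_permute M _ _ h.equiv))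
  obtain ⟨h', hl, e⟩ := hψ _ (T.legs_mapLegs ψ)
  refine ⟨T.mapLegs ψ, h', ?_⟩
  rw [RawTree.eval_mapLegs M f ψ T hl, reassoc_of% e]

theorem rightUnitor_mem_treeMaps : (ρ_ M).hom ∈ treeMaps f 1 := by
  refine ⟨.leg 0, ⟨by simp [RawTree.legs], fun a => by
    simp [RawTree.legs, Subsingleton.elim a 0]⟩, ?_⟩
  have key : (ρ_ M).hom = (𝟙 (M ⊗ 𝟙_ C) ≫ M ◁ 𝟙 (𝟙_ C)) ≫ (ρ_ M).hom := by simp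
  exact key

theorem comp_mem_treeMaps {l : ℕ} (i : I) {g : tensorPow M l ⟶ tensorPow M (k i)}
    (hg : g ∈ forestMaps f (k i) l) : g ≫ f i ∈ treeMaps f l := by
  obtain ⟨F, h, rfl⟩ := hg
  exact ⟨.white i F, h, Category.assoc _ _ _⟩

theorem comp_iterMul_mem_treeMaps {l n : ℕ} {g : tensorPow M l ⟶ tensorPow M n}
    (hg : g ∈ forestMaps f n l) : g ≫ iterMul M n ∈ treeMaps f l := by
  obtain ⟨F, h, rfl⟩ := hg
  exact ⟨.black n F, h, Category.assoc _ _ _⟩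

theorem perm_mem_forestMaps {l : ℕ} {p : tensorPow M l ⟶ tensorPow M 0} (hp : IsPerm M l 0 p) :
    p ∈ forestMaps f 0 l := by
  cases hp
  exact ⟨Fin.elim0, ⟨List.nodup_nil, fun a => a.elim0⟩, (Category.comp_id _).symm⟩

/-- A tree may be put in front of a forest. The resulting symmetry is absorbed in the labels of the
legs. -/
theorem cons_mem_forestMaps {l l₁ l₂ n : ℕ} {p : tensorPow M l ⟶ tensorPow M (l₂ + l₁)}
    (hp : IsPerm M _ _ p) {g₁ : tensorPow M l₁ ⟶ M} (hg₁ : g₁ ∈ treeMaps f l₁)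
    {g₂ : tensorPow M l₂ ⟶ tensorPow M n} (hg₂ : g₂ ∈ forestMaps f n l₂) :
    p ≫ (joinPow M l₁ l₂).inv ≫ (g₁ ⊗ₘ g₂) ∈ forestMaps f (n + 1) l := by
  obtain ⟨T, h₁, rfl⟩ := hg₁
  obtain ⟨F, h₂, rfl⟩ := hg₂
  -- The labels of the first tree are shifted past those of the other trees.
  let G : Fin (n + 1) → RawTree (l₂ + l₁) k :=
    Fin.cases (T.mapLegs (Fin.natAdd l₂)) (fun x => (F x).mapLegs (Fin.castAdd l₁))
  have e₁ : (G 0).legs = T.legs.map (Fin.natAdd l₂) := T.legs_mapLegs _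
  have e₂ : catLists n (fun x => (G x.succ).legs) =
      (catLists n (fun x => (F x).legs)).map (Fin.castAdd l₁) := by
    rw [RawTree.map_catLists]
    exact congrArg (catLists n) (funext fun x => (F x).legs_mapLegs _)
  have e : catLists (n + 1) (fun x => (G x).legs) = T.legs.map (Fin.natAdd l₂) ++
      (catLists n (fun x => (F x).legs)).map (Fin.castAdd l₁) := congrArg₂ _ e₁ e₂
  have hG : IsEnum (catLists (n + 1) (fun x => (G x).legs)) := by
    rw [e]
    constructor
    · refine List.Nodup.append (h₁.nodup.map (Fin.natAdd_injective _ _))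
        (h₂.nodup.map (Fin.castAdd_injective _ _)) ?_
      intro a ha ha'
      obtain ⟨b, -, rfl⟩ := List.mem_map.1 ha
      obtain ⟨c, -, hc⟩ := List.mem_map.1 ha'
      have := congrArg Fin.val hc
      simp at this
      omega
    · intro a
      rw [List.mem_append]
      refine Fin.addCases (fun i => ?_) (fun i => ?_) a
      · exact .inr (List.mem_map_of_mem (h₂.mem i))
      · exact .inl (List.mem_map_of_mem (h₁.mem i))
  have hl₁ : (G 0).legs.length = T.legs.length := by simp [e₁]
  have hl₂ : (catLists n (fun x => (G x.succ).legs)).length =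
      (catLists n (fun x => (F x).legs)).length := by simp [e₂]
  have hlx : ∀ x : Fin n, (G x.succ).legs.length = (F x).legs.length := fun x => by
    simp [G, RawTree.legs_mapLegs]
  have hT : permute M _ _ h₁.equiv ≫ T.eval M f =
      (permute M _ _ h₁.equiv ≫ castPow M hl₁.symm) ≫ (G 0).eval M f := by
    rw [show (G 0).eval M f = castPow M hl₁ ≫ T.eval M f from T.eval_mapLegs M f _ hl₁]
    simp [castPow]
  have hF : permute M _ _ h₂.equiv ≫ blockTensor M n _ (fun x => (F x).eval M f) =
      (permute M _ _ h₂.equiv ≫ castPow M hl₂.symm) ≫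
        blockTensor M n _ (fun x => (G x.succ).eval M f) := by
    rw [show blockTensor M n _ (fun x => (G x.succ).eval M f) = castPow M hl₂ ≫
      blockTensor M n _ (fun x => (F x).eval M f) from
        blockTensor_castPow M hlx _ _ (fun x => (F x).eval_mapLegs M f _ (hlx x)) hl₂]
    simp [castPow]
  obtain ⟨q₁, hq₁, eq₁⟩ := ((isPerm_permute M _ _ h₁.equiv).comp
    (.castPow hl₁.symm)).exists_whiskerRight_join l₂
  obtain ⟨q₂, hq₂, eq₂⟩ := ((isPerm_permute M _ _ h₂.equiv).comp
    (.castPow hl₂.symm)).exists_whiskerLeft_join (G 0).legs.length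
  obtain ⟨s, hs, es⟩ := IsPerm.exists_splitPow_join (M := M) (G 0).legs
    (catLists n (fun x => (G x.succ).legs))
  obtain ⟨r, hr, hsr, hrs⟩ := hs.exists_inv
  have hP : IsPerm M _ _ (p ≫ q₁ ≫ q₂ ≫ r) := hp.comp (hq₁.comp (hq₂.comp hr))
  obtain ⟨ψ, hψ⟩ := exists_relabel hG hP
  have eψ : catLists (n + 1) (fun x => ((G x).mapLegs ψ).legs) =
      (catLists (n + 1) (fun x => (G x).legs)).map ψ := by
    rw [RawTree.map_catLists]
    exact congrArg (catLists (n + 1)) (funext fun x => (G x).legs_mapLegs _)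
  obtain ⟨h, hl', eh⟩ := hψ _ eψ
  refine ⟨fun x => (G x).mapLegs ψ, h, ?_⟩
  have hGx : ∀ x, ((G x).mapLegs ψ).legs.length = (G x).legs.length := fun x => by
    simp [RawTree.legs_mapLegs]
  have hev' : blockTensor M (n + 1) _ (fun x => ((G x).mapLegs ψ).eval M f) =
      castPow M hl' ≫ blockTensor M (n + 1) _ (fun x => (G x).eval M f) :=
    blockTensor_castPow M hGx _ _ (fun x => (G x).eval_mapLegs M f _ (hGx x)) hl'
  rw [hev', reassoc_of% eh, hT, hF]
  have key : ∀ {X W₁ W₂ W₃ A A' B B' D Z : C} (p : X ⟶ W₁) (j : A ⊗ B ≅ W₁) (a : A ⟶ A')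
      (b : B ⟶ B') (j' : A' ⊗ B ⟶ W₂) (q₁ : W₁ ⟶ W₂) (j'' : A' ⊗ B' ⟶ W₃) (q₂ : W₂ ⟶ W₃)
      (s : Z ⟶ A' ⊗ B') (t : Z ⟶ W₃) (r : W₃ ⟶ Z) (x : A' ⟶ M) (y : B' ⟶ D)
      (j''' : W₃ ⟶ A' ⊗ B'), a ▷ B ≫ j' = j.hom ≫ q₁ → A' ◁ b ≫ j'' = j' ≫ q₂ →
      s ≫ j'' = t → r ≫ t = 𝟙 _ → j'' ≫ j''' = 𝟙 _ →
      p ≫ j.inv ≫ ((a ≫ x) ⊗ₘ (b ≫ y)) = (p ≫ q₁ ≫ q₂ ≫ r) ≫ s ≫ (x ⊗ₘ y) := by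
    intro X W₁ W₂ W₃ A A' B B' D Z p j a b j' q₁ j'' q₂ s t r x y j''' h₁ h₂ h₃ h₄ h₆
    have hq : q₁ ≫ q₂ = j.inv ≫ (a ⊗ₘ b) ≫ j'' := by
      rw [MonoidalCategory.tensorHom_def, Category.assoc, h₂, ← Category.assoc (a ▷ B), h₁]
      simp
    have hr : r ≫ s = j''' := by
      have : (r ≫ s) ≫ j'' ≫ j''' = j''' := by
        rw [Category.assoc, reassoc_of% h₃, reassoc_of% h₄]
      simpa [h₆] using this
    simp only [Category.assoc]
    rw [reassoc_of% hq, reassoc_of% hr, reassoc_of% h₆, tensorHom_comp_tensorHom]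
  exact key _ _ _ _ _ _ _ _ _ _ _ _ _ _ eq₁ eq₂ es hrs (Iso.hom_inv_id _)

end TreeMaps

/-! ### The universal pair -/

section FreePair

/-- Words in one generating object. The words `pow n` are formal tensor powers, isomorphic to the
iterated tensor products of `base`. -/
inductive Word : Type
  | unit : Word
  | base : Word
  | tensor : Word → Word → Word
  | pow : ℕ → Word

/-- The object obtained by substituting `M` for the generating object. -/
def Word.obj {C : Type u} [Category.{v} C] [MonoidalCategory C] (M : C) : Word → C
  | unit => 𝟙_ C
  | base => M
  | tensor a b => a.obj M ⊗ b.obj M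
  | pow n => tensorPow M n

/-- Formal expressions for morphisms in an additive symmetric monoidal category generated by a
monoid `base` and by morphisms `pow (k i) ⟶ base`. -/
inductive FreeTerm {I : Type} (k : I → ℕ) : Word → Word → Type
  | id (a : Word) : FreeTerm k a a
  | comp {a b c : Word} (s : FreeTerm k a b) (t : FreeTerm k b c) : FreeTerm k a c
  | zero (a b : Word) : FreeTerm k a b
  | add {a b : Word} (s t : FreeTerm k a b) : FreeTerm k a b
  | neg {a b : Word} (s : FreeTerm k a b) : FreeTerm k a b
  | whiskerLeft (a : Word) {b c : Word} (s : FreeTerm k b c) : FreeTerm k (a.tensor b) (a.tensor c)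
  | whiskerRight {a b : Word} (s : FreeTerm k a b) (c : Word) : FreeTerm k (a.tensor c) (b.tensor c)
  | assoc (a b c : Word) : FreeTerm k ((a.tensor b).tensor c) (a.tensor (b.tensor c))
  | assocInv (a b c : Word) : FreeTerm k (a.tensor (b.tensor c)) ((a.tensor b).tensor c)
  | leftUnit (a : Word) : FreeTerm k (Word.unit.tensor a) a
  | leftUnitInv (a : Word) : FreeTerm k a (Word.unit.tensor a)
  | rightUnit (a : Word) : FreeTerm k (a.tensor Word.unit) a
  | rightUnitInv (a : Word) : FreeTerm k a (a.tensor Word.unit)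
  | braid (a b : Word) : FreeTerm k (a.tensor b) (b.tensor a)
  | powZero : FreeTerm k Word.unit (Word.pow 0)
  | powSucc (n : ℕ) : FreeTerm k (Word.base.tensor (Word.pow n)) (Word.pow (n + 1))
  | gen (i : I) : FreeTerm k (Word.pow (k i)) Word.base
  | mul : FreeTerm k (Word.base.tensor Word.base) Word.base
  | one : FreeTerm k Word.unit Word.base

variable {I : Type} {k : I → ℕ}

/-- The value of a formal expression. -/
def FreeTerm.eval {C : Type u} [Category.{v} C] [MonoidalCategory C] [SymmetricCategory C]
    [Preadditive C] (M : C) [MonObj M] (f : ∀ i, tensorPow M (k i) ⟶ M) :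
    {a b : Word} → FreeTerm k a b → (a.obj M ⟶ b.obj M)
  | _, _, id _ => 𝟙 _
  | _, _, comp s t => s.eval M f ≫ t.eval M f
  | _, _, zero _ _ => 0
  | _, _, add s t => s.eval M f + t.eval M f
  | _, _, neg s => - s.eval M f
  | _, _, whiskerLeft a s => a.obj M ◁ s.eval M f
  | _, _, whiskerRight s c => s.eval M f ▷ c.obj M
  | _, _, assoc _ _ _ => (α_ _ _ _).hom
  | _, _, assocInv _ _ _ => (α_ _ _ _).inv
  | _, _, leftUnit _ => (λ_ _).hom
  | _, _, leftUnitInv _ => (λ_ _).inv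
  | _, _, rightUnit _ => (ρ_ _).hom
  | _, _, rightUnitInv _ => (ρ_ _).inv
  | _, _, braid _ _ => (β_ _ _).hom
  | _, _, powZero => 𝟙 (𝟙_ C)
  | _, _, powSucc n => 𝟙 (M ⊗ tensorPow M n)
  | _, _, gen i => f i
  | _, _, mul => MonObj.mul (X := M)
  | _, _, one => MonObj.one (X := M)

/-- Two expressions are equivalent if they have the same value in all pairs `(V, M)`. The second
clause makes values in the category of abelian groups available, whatever the universes `u` and `v`
are. -/
def FreeTerm.Equivalent {a b : Word} (s t : FreeTerm k a b) : Prop :=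
  (∀ (X : SymCat.{u, v}) (f : ∀ i, X.End (k i)), s.eval X.M f = t.eval X.M f) ∧
  (∀ (X : SymCat.{1, 0}) (f : ∀ i, X.End (k i)), s.eval X.M f = t.eval X.M f)

instance FreeTerm.setoid (k : I → ℕ) (a b : Word) : Setoid (ULift.{v} (FreeTerm k a b)) where
  r s t := FreeTerm.Equivalent.{u, v} s.down t.down
  iseqv :=
    ⟨fun _ => ⟨fun _ _ => rfl, fun _ _ => rfl⟩,
      fun h => ⟨fun X f => (h.1 X f).symm, fun X f => (h.2 X f).symm⟩,
      fun h h' => ⟨fun X f => (h.1 X f).trans (h'.1 X f), fun X f => (h.2 X f).trans (h'.2 X f)⟩⟩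

/-- The objects of the universal pair `(V, M)` with given morphisms `M^{⊗ k i} ⟶ M`. The unused
type `H` only records the universe of the morphisms. -/
structure FreeObj {I : Type} (k : I → ℕ) (H : Type v) : Type u where
  word : Word

/-- Morphisms of the universal pair: expressions up to equality of their values. -/
def FreeHom (k : I → ℕ) (a b : Word) : Type v := Quotient (FreeTerm.setoid.{u, v} k a b)

namespace FreeHom

/-- The class of an expression. -/
def mk {a b : Word} (t : FreeTerm k a b) : FreeHom.{u, v} k a b := Quotient.mk _ ⟨t⟩

section Eval

variable {C : Type u'} [Category.{v'} C] [MonoidalCategory C] [SymmetricCategory C] [Preadditive C]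

/-- Equivalent expressions have equal values for the given decorations. -/
def Respects (M : C) [MonObj M] (f : ∀ i, tensorPow M (k i) ⟶ M) : Prop :=
  ∀ ⦃a b : Word⦄ (s t : FreeTerm k a b), FreeTerm.Equivalent.{u, v} s t → s.eval M f = t.eval M f

/-- The value of a morphism of the universal pair. -/
def eval {M : C} [MonObj M] {f : ∀ i, tensorPow M (k i) ⟶ M} (h : Respects.{u, v} M f)
    {a b : Word} : FreeHom.{u, v} k a b → (a.obj M ⟶ b.obj M) :=
  Quotient.lift (fun t => t.down.eval M f) (fun _ _ hst => h _ _ hst)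

end Eval

theorem respects_left (X : SymCat.{u, v}) (f : ∀ i, X.End (k i)) : Respects.{u, v} X.M f :=
  fun _ _ _ _ h => h.1 X f

theorem respects_right (X : SymCat.{1, 0}) (f : ∀ i, X.End (k i)) : Respects.{u, v} X.M f :=
  fun _ _ _ _ h => h.2 X f

/-- Equations in the universal pair are checked on values in all pairs; so the axioms of an additive
symmetric monoidal category with a monoid are inherited from these. -/
theorem ext {a b : Word} {s t : FreeHom.{u, v} k a b}
    (h₁ : ∀ (X : SymCat.{u, v}) (f : ∀ i, X.End (k i)),
      s.eval (respects_left X f) = t.eval (respects_left X f))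
    (h₂ : ∀ (X : SymCat.{1, 0}) (f : ∀ i, X.End (k i)),
      s.eval (respects_right X f) = t.eval (respects_right X f)) : s = t := by
  induction s using Quotient.ind
  induction t using Quotient.ind
  exact Quotient.sound ⟨h₁, h₂⟩

/-- Apply a binary constructor of expressions. -/
def map₂ {a b c d a' b' : Word} (F : FreeTerm k a b → FreeTerm k c d → FreeTerm k a' b')
    (h : ∀ s s' t t', FreeTerm.Equivalent.{u, v} s s' → FreeTerm.Equivalent.{u, v} t t' →
      FreeTerm.Equivalent.{u, v} (F s t) (F s' t')) :
    FreeHom.{u, v} k a b → FreeHom.{u, v} k c d → FreeHom.{u, v} k a' b' :=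
  Quotient.map₂ (fun s t => ⟨F s.down t.down⟩) (fun _ _ hs _ _ ht => h _ _ _ _ hs ht)

/-- Apply a unary constructor of expressions. -/
def map {a b a' b' : Word} (F : FreeTerm k a b → FreeTerm k a' b')
    (h : ∀ s s', FreeTerm.Equivalent.{u, v} s s' → FreeTerm.Equivalent.{u, v} (F s) (F s')) :
    FreeHom.{u, v} k a b → FreeHom.{u, v} k a' b' :=
  Quotient.map (fun s => ⟨F s.down⟩) (fun _ _ hs => h _ _ hs)

end FreeHom

open FreeHom

instance : Category.{v} (FreeObj.{u, v} k PUnit) where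
  Hom a b := FreeHom.{u, v} k a.word b.word
  id a := mk (.id a.word)
  comp s t := map₂ .comp (fun _ _ _ _ hs ht =>
    ⟨fun X f => by rw [FreeTerm.eval, FreeTerm.eval, hs.1 X f, ht.1 X f],
      fun X f => by rw [FreeTerm.eval, FreeTerm.eval, hs.2 X f, ht.2 X f]⟩) s t
  id_comp s := by
    induction s using Quotient.ind
    exact Quotient.sound ⟨fun _ _ => Category.id_comp _, fun _ _ => Category.id_comp _⟩
  comp_id s := by
    induction s using Quotient.ind
    exact Quotient.sound ⟨fun _ _ => Category.comp_id _, fun _ _ => Category.comp_id _⟩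
  assoc s t r := by
    induction s using Quotient.ind
    induction t using Quotient.ind
    induction r using Quotient.ind
    exact Quotient.sound ⟨fun _ _ => Category.assoc _ _ _, fun _ _ => Category.assoc _ _ _⟩

namespace FreeHom

/-- The value of a morphism of the universal pair, as a map on morphisms of the category. -/
abbrev val {C : Type u'} [Category.{v'} C] [MonoidalCategory C] [SymmetricCategory C]
    [Preadditive C] {M : C} [MonObj M] {f : ∀ i, tensorPow M (k i) ⟶ M}
    (h : Respects.{u, v} M f) {a b : FreeObj.{u, v} k PUnit} (s : a ⟶ b) :
    a.word.obj M ⟶ b.word.obj M := FreeHom.eval h s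

theorem hom_ext {a b : FreeObj.{u, v} k PUnit} {s t : a ⟶ b}
    (h₁ : ∀ (X : SymCat.{u, v}) (f : ∀ i, X.End (k i)),
      val (respects_left X f) s = val (respects_left X f) t)
    (h₂ : ∀ (X : SymCat.{1, 0}) (f : ∀ i, X.End (k i)),
      val (respects_right X f) s = val (respects_right X f) t) : s = t :=
  FreeHom.ext h₁ h₂

end FreeHom

instance (a b : Word) : AddCommGroup (FreeHom.{u, v} k a b) :=
  letI : Add (FreeHom.{u, v} k a b) := ⟨map₂ .add (fun _ _ _ _ hs ht =>
    ⟨fun X f => congrArg₂ (· + ·) (hs.1 X f) (ht.1 X f),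
      fun X f => congrArg₂ (· + ·) (hs.2 X f) (ht.2 X f)⟩)⟩
  letI : Zero (FreeHom.{u, v} k a b) := ⟨mk (.zero _ _)⟩
  letI : Neg (FreeHom.{u, v} k a b) := ⟨map .neg (fun _ _ hs =>
    ⟨fun X f => congrArg Neg.neg (hs.1 X f), fun X f => congrArg Neg.neg (hs.2 X f)⟩)⟩
  { AddGroup.ofLeftAxioms (G := FreeHom.{u, v} k a b)
      (by
        intro s t r
        induction s using Quotient.ind
        induction t using Quotient.ind
        induction r using Quotient.ind
        exact Quotient.sound ⟨fun _ _ => add_assoc _ _ _, fun _ _ => add_assoc _ _ _⟩)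
      (by
        intro s
        induction s using Quotient.ind
        exact Quotient.sound ⟨fun _ _ => zero_add _, fun _ _ => zero_add _⟩)
      (by
        intro s
        induction s using Quotient.ind
        exact Quotient.sound ⟨fun _ _ => neg_add_cancel _, fun _ _ => neg_add_cancel _⟩) with
    add_comm := by
      intro s t
      induction s using Quotient.ind
      induction t using Quotient.ind
      exact Quotient.sound ⟨fun _ _ => add_comm _ _, fun _ _ => add_comm _ _⟩ }

instance : Preadditive (FreeObj.{u, v} k PUnit) where
  homGroup a b := inferInstanceAs (AddCommGroup (FreeHom.{u, v} k a.word b.word))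
  add_comp a b c s t r := by
    induction s using Quotient.ind
    induction t using Quotient.ind
    induction r using Quotient.ind
    exact Quotient.sound ⟨fun _ _ => Preadditive.add_comp _ _ _ _ _ _,
      fun _ _ => Preadditive.add_comp _ _ _ _ _ _⟩
  comp_add a b c s t r := by
    induction s using Quotient.ind
    induction t using Quotient.ind
    induction r using Quotient.ind
    exact Quotient.sound ⟨fun _ _ => Preadditive.comp_add _ _ _ _ _ _,
      fun _ _ => Preadditive.comp_add _ _ _ _ _ _⟩

namespace FreeHom

section

variable {C : Type u'} [Category.{v'} C] [MonoidalCategory C] [SymmetricCategory C]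
    [Preadditive C] {M : C} [MonObj M] {f : ∀ i, tensorPow M (k i) ⟶ M}
    (h : Respects.{u, v} M f) {a b c : FreeObj.{u, v} k PUnit}

theorem val_comp (s : a ⟶ b) (t : b ⟶ c) : val h (s ≫ t) = val h s ≫ val h t := by
  induction s using Quotient.ind
  induction t using Quotient.ind
  rfl

theorem val_add (s t : a ⟶ b) : val h (s + t) = val h s + val h t := by
  induction s using Quotient.ind
  induction t using Quotient.ind
  rfl

end

/-- A formal expression as a morphism of the universal category. -/
def ofTerm {a b : FreeObj.{u, v} k PUnit} (t : FreeTerm k a.word b.word) : a ⟶ b := mk t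

end FreeHom

instance : MonoidalCategoryStruct (FreeObj.{u, v} k PUnit) where
  tensorObj a b := ⟨a.word.tensor b.word⟩
  tensorUnit := ⟨.unit⟩
  whiskerLeft a _ _ s := map (.whiskerLeft a.word) (fun _ _ hs =>
    ⟨fun X f => congrArg (_ ◁ ·) (hs.1 X f), fun X f => congrArg (_ ◁ ·) (hs.2 X f)⟩) s
  whiskerRight s c := map (fun t => .whiskerRight t c.word) (fun _ _ hs =>
    ⟨fun X f => congrArg (· ▷ _) (hs.1 X f), fun X f => congrArg (· ▷ _) (hs.2 X f)⟩) s
  tensorHom {_ b c _} s t := map₂ (fun s t => (FreeTerm.whiskerRight s c.word).comp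
    (.whiskerLeft b.word t)) (fun _ _ _ _ hs ht =>
    ⟨fun X f => congrArg₂ (fun x y => x ▷ _ ≫ _ ◁ y) (hs.1 X f) (ht.1 X f),
      fun X f => congrArg₂ (fun x y => x ▷ _ ≫ _ ◁ y) (hs.2 X f) (ht.2 X f)⟩) s t
  associator _ _ _ :=
    { hom := ofTerm (.assoc _ _ _)
      inv := ofTerm (.assocInv _ _ _)
      hom_inv_id := Quotient.sound ⟨fun _ _ => Iso.hom_inv_id _, fun _ _ => Iso.hom_inv_id _⟩
      inv_hom_id := Quotient.sound ⟨fun _ _ => Iso.inv_hom_id _, fun _ _ => Iso.inv_hom_id _⟩ }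
  leftUnitor _ :=
    { hom := ofTerm (.leftUnit _)
      inv := ofTerm (.leftUnitInv _)
      hom_inv_id := Quotient.sound ⟨fun _ _ => Iso.hom_inv_id _, fun _ _ => Iso.hom_inv_id _⟩
      inv_hom_id := Quotient.sound ⟨fun _ _ => Iso.inv_hom_id _, fun _ _ => Iso.inv_hom_id _⟩ }
  rightUnitor _ :=
    { hom := ofTerm (.rightUnit _)
      inv := ofTerm (.rightUnitInv _)
      hom_inv_id := Quotient.sound ⟨fun _ _ => Iso.hom_inv_id _, fun _ _ => Iso.hom_inv_id _⟩
      inv_hom_id := Quotient.sound ⟨fun _ _ => Iso.inv_hom_id _, fun _ _ => Iso.inv_hom_id _⟩ }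

namespace FreeHom

section

variable {C : Type u'} [Category.{v'} C] [MonoidalCategory C] [SymmetricCategory C]
    [Preadditive C] {M : C} [MonObj M] {f : ∀ i, tensorPow M (k i) ⟶ M}
    (h : Respects.{u, v} M f) {a b c d : FreeObj.{u, v} k PUnit}

theorem val_whiskerLeft (s : b ⟶ c) : val h (a ◁ s) = a.word.obj M ◁ val h s := by
  induction s using Quotient.ind
  rfl

theorem val_whiskerRight (s : a ⟶ b) : val h (s ▷ c) = val h s ▷ c.word.obj M := by
  induction s using Quotient.ind
  rfl

theorem val_tensorHom (s : a ⟶ b) (t : c ⟶ d) : val h (s ⊗ₘ t) = (val h s ⊗ₘ val h t) := by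
  induction s using Quotient.ind
  induction t using Quotient.ind
  exact (MonoidalCategory.tensorHom_def _ _).symm

end

end FreeHom

instance : MonoidalCategory (FreeObj.{u, v} k PUnit) where
  tensorHom_def s t := by
    induction s using Quotient.ind
    induction t using Quotient.ind
    rfl
  id_tensorHom_id a b := by
    refine hom_ext (fun X f => ?_) (fun X f => ?_) <;> rw [val_tensorHom] <;>
      exact id_tensorHom_id _ _
  tensorHom_comp_tensorHom f₁ f₂ g₁ g₂ := by
    refine hom_ext (fun X f => ?_) (fun X f => ?_) <;>
      simp only [val_comp, val_tensorHom] <;> exact tensorHom_comp_tensorHom _ _ _ _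
  whiskerLeft_id a b := by
    refine hom_ext (fun X f => ?_) (fun X f => ?_) <;> rw [val_whiskerLeft] <;>
      exact MonoidalCategory.whiskerLeft_id _ _
  id_whiskerRight a b := by
    refine hom_ext (fun X f => ?_) (fun X f => ?_) <;> rw [val_whiskerRight] <;>
      exact MonoidalCategory.id_whiskerRight _ _
  associator_naturality f₁ f₂ f₃ := by
    refine hom_ext (fun X f => ?_) (fun X f => ?_) <;>
      simp only [val_comp, val_tensorHom] <;> exact associator_naturality _ _ _
  leftUnitor_naturality s := by
    refine hom_ext (fun X f => ?_) (fun X f => ?_) <;>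
      simp only [val_comp, val_whiskerLeft] <;> exact leftUnitor_naturality _
  rightUnitor_naturality s := by
    refine hom_ext (fun X f => ?_) (fun X f => ?_) <;>
      simp only [val_comp, val_whiskerRight] <;> exact rightUnitor_naturality _
  pentagon a b c d := by
    refine hom_ext (fun X f => ?_) (fun X f => ?_) <;>
      simp only [val_comp, val_whiskerRight, val_whiskerLeft] <;>
      exact MonoidalCategory.pentagon _ _ _ _
  triangle a b := by
    refine hom_ext (fun X f => ?_) (fun X f => ?_) <;>
      simp only [val_comp, val_whiskerRight, val_whiskerLeft] <;>
      exact MonoidalCategory.triangle _ _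

instance : SymmetricCategory (FreeObj.{u, v} k PUnit) where
  braiding a b :=
    { hom := ofTerm (.braid _ _)
      inv := ofTerm (.braid _ _)
      hom_inv_id := Quotient.sound ⟨fun _ _ => SymmetricCategory.symmetry _ _,
        fun _ _ => SymmetricCategory.symmetry _ _⟩
      inv_hom_id := Quotient.sound ⟨fun _ _ => SymmetricCategory.symmetry _ _,
        fun _ _ => SymmetricCategory.symmetry _ _⟩ }
  braiding_naturality_right a _ _ s := by
    refine hom_ext (fun X f => ?_) (fun X f => ?_) <;>
      simp only [val_comp, val_whiskerRight, val_whiskerLeft] <;>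
      exact BraidedCategory.braiding_naturality_right _ _
  braiding_naturality_left s a := by
    refine hom_ext (fun X f => ?_) (fun X f => ?_) <;>
      simp only [val_comp, val_whiskerRight, val_whiskerLeft] <;>
      exact BraidedCategory.braiding_naturality_left _ _
  hexagon_forward a b c := by
    refine hom_ext (fun X f => ?_) (fun X f => ?_) <;>
      simp only [val_comp, val_whiskerRight, val_whiskerLeft] <;>
      exact BraidedCategory.hexagon_forward _ _ _
  hexagon_reverse a b c := by
    refine hom_ext (fun X f => ?_) (fun X f => ?_) <;>
      simp only [val_comp, val_whiskerRight, val_whiskerLeft]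
    all_goals
      have h := BraidedCategory.hexagon_reverse (a.word.obj X.M) (b.word.obj X.M) (c.word.obj X.M)
      exact h
  symmetry a b := by
    refine hom_ext (fun X f => ?_) (fun X f => ?_) <;>
      simp only [val_comp] <;> exact SymmetricCategory.symmetry _ _

instance : MonoidalPreadditive (FreeObj.{u, v} k PUnit) where
  whiskerLeft_zero {a b c} := by
    refine hom_ext (fun X f => ?_) (fun X f => ?_) <;> rw [val_whiskerLeft] <;>
      exact MonoidalPreadditive.whiskerLeft_zero
  zero_whiskerRight {a b c} := by
    refine hom_ext (fun X f => ?_) (fun X f => ?_) <;> rw [val_whiskerRight] <;>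
      exact MonoidalPreadditive.zero_whiskerRight
  whiskerLeft_add s t := by
    refine hom_ext (fun X f => ?_) (fun X f => ?_) <;>
      simp only [val_add, val_whiskerLeft] <;> exact MonoidalPreadditive.whiskerLeft_add _ _
  add_whiskerRight s t := by
    refine hom_ext (fun X f => ?_) (fun X f => ?_) <;>
      simp only [val_add, val_whiskerRight] <;> exact MonoidalPreadditive.add_whiskerRight _ _

instance : MonObj (⟨.base⟩ : FreeObj.{u, v} k PUnit) where
  one := ofTerm .one
  mul := ofTerm .mul
  one_mul := by
    refine hom_ext (fun X f => ?_) (fun X f => ?_) <;>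
      simp only [val_comp, val_whiskerRight] <;> exact MonObj.one_mul X.M
  mul_one := by
    refine hom_ext (fun X f => ?_) (fun X f => ?_) <;>
      simp only [val_comp, val_whiskerLeft] <;> exact MonObj.mul_one X.M
  mul_assoc := by
    refine hom_ext (fun X f => ?_) (fun X f => ?_) <;>
      simp only [val_comp, val_whiskerRight, val_whiskerLeft] <;> exact MonObj.mul_assoc X.M

/-- The universal pair with given morphisms `M^{⊗ k i} ⟶ M`. -/
def freePair (k : I → ℕ) : SymCat.{u, v} where
  V := FreeObj.{u, v} k PUnit
  M := ⟨.base⟩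

end FreePair

/-! ### Naturality of the operation of a tree -/

section Naturality

open Functor.LaxMonoidal
open scoped Obj

variable {C : Type u} [Category.{v} C] [MonoidalCategory C]
  {D : Type u'} [Category.{v'} D] [MonoidalCategory D] (F : C ⥤ D)

/-- The comparison `N^{⊗ n} ⟶ F (M^{⊗ n})` for a monoidal functor `F` and `N ≅ F M`, between
categories in arbitrary universes. -/
def comparison [F.LaxMonoidal] {M : C} {N : D} (e : F.obj M ≅ N) :
    (n : ℕ) → (tensorPow N n ⟶ F.obj (tensorPow M n))
  | 0 => ε F
  | n + 1 => (e.inv ⊗ₘ comparison e n) ≫ μ F M (tensorPow M n)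

theorem powComparison_eq {D : Type u} [Category.{v} D] [MonoidalCategory D] (F : C ⥤ D)
    [F.LaxMonoidal] {M : C} {N : D} (e : F.obj M ≅ N) (n : ℕ) :
    powComparison F e n = comparison F e n := by
  induction n with
  | zero => rfl
  | succ n ih => simp only [powComparison, comparison, ih]

section Lax

variable [F.LaxMonoidal] {M : C} {N : D} (e : F.obj M ≅ N)

/-- The comparison maps are compatible with the decomposition of a tensor power. -/
theorem comparison_splitPow {α : Type} (L L' : List α) :
    comparison F e (L ++ L').length ≫ F.map (splitPow M L L') =
      splitPow N L L' ≫ (comparison F e L.length ⊗ₘ comparison F e L'.length) ≫ μ F _ _ := by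
  induction L with
  | nil =>
    have key : ∀ {A : C} {B : D} (p : B ⟶ F.obj A), p ≫ F.map (λ_ A).inv =
        (λ_ B).inv ≫ (ε F ⊗ₘ p) ≫ μ F _ _ := by
      intro A B p
      rw [← left_unitality_inv (F := F) A, MonoidalCategory.tensorHom_def', Category.assoc,
        leftUnitor_inv_naturality_assoc]
    rw [splitPow_nil, splitPow_nil]
    exact key _
  | cons x L ih =>
    have key : ∀ {P X Y : C} {P' X' Y' : D} (s : P ⟶ X ⊗ Y) (s' : P' ⟶ X' ⊗ Y')
        (p : P' ⟶ F.obj P) (q : X' ⟶ F.obj X) (r : Y' ⟶ F.obj Y),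
        p ≫ F.map s = s' ≫ (q ⊗ₘ r) ≫ μ F _ _ →
        ((e.inv ⊗ₘ p) ≫ μ F M P) ≫ F.map (M ◁ s ≫ (α_ M X Y).inv) =
          (N ◁ s' ≫ (α_ N X' Y').inv) ≫ (((e.inv ⊗ₘ q) ≫ μ F M X) ⊗ₘ r) ≫ μ F _ _ := by
      intro P X Y P' X' Y' s s' p q r h
      have h1 : ((e.inv ⊗ₘ p) ≫ μ F M P) ≫ F.map (M ◁ s) =
          N ◁ s' ≫ (e.inv ⊗ₘ (q ⊗ₘ r)) ≫ F.obj M ◁ μ F X Y ≫ μ F _ _ := by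
        rw [Category.assoc, ← μ_natural_right, ← id_tensorHom, ← id_tensorHom, ← id_tensorHom,
          tensorHom_comp_tensorHom_assoc, tensorHom_comp_tensorHom_assoc,
          tensorHom_comp_tensorHom_assoc, h]
        simp
      have h2 : (((e.inv ⊗ₘ q) ≫ μ F M X) ⊗ₘ r) = ((e.inv ⊗ₘ q) ⊗ₘ r) ≫ μ F M X ▷ F.obj Y := by
        rw [← tensorHom_id, tensorHom_comp_tensorHom, Category.comp_id]
      rw [F.map_comp, ← Category.assoc, h1, h2, Category.assoc, Category.assoc, Category.assoc,
         associativity_inv (F := F) M X Y,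
        associator_inv_naturality_assoc]
      simp only [Category.assoc]
    rw [splitPow_cons, splitPow_cons]
    exact key _ _ _ _ _ ih

theorem comparison_blockTensor {α : Type} (n : ℕ) (L : Fin n → List α)
    (w : ∀ x, tensorPow M (L x).length ⟶ M) (w' : ∀ x, tensorPow N (L x).length ⟶ N)
    (h : ∀ x, comparison F e _ ≫ F.map (w x) = w' x ≫ e.inv) :
    comparison F e _ ≫ F.map (blockTensor M n L w) = blockTensor N n L w' ≫ comparison F e n := by
  induction n with
  | zero =>
    have key : ∀ {A : C} {B : D} (p : B ⟶ F.obj A), p ≫ F.map (𝟙 A) = 𝟙 B ≫ p := by simp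
    exact key _
  | succ n ih =>
    have key : ∀ {P X Y Z : C} {P' X' Y' Z' : D} (s : P ⟶ X ⊗ Y) (s' : P' ⟶ X' ⊗ Y')
        (p : P' ⟶ F.obj P) (q : X' ⟶ F.obj X) (r : Y' ⟶ F.obj Y) (t : Z' ⟶ F.obj Z)
        (a : X ⟶ M) (a' : X' ⟶ N) (b : Y ⟶ Z) (b' : Y' ⟶ Z'),
        p ≫ F.map s = s' ≫ (q ⊗ₘ r) ≫ μ F _ _ → q ≫ F.map a = a' ≫ e.inv →
        r ≫ F.map b = b' ≫ t →
        p ≫ F.map (s ≫ (a ⊗ₘ b)) = (s' ≫ (a' ⊗ₘ b')) ≫ (e.inv ⊗ₘ t) ≫ μ F _ _ := by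
      intro P X Y Z P' X' Y' Z' s s' p q r t a a' b b' h₁ h₂ h₃
      rw [F.map_comp, reassoc_of% h₁, ← μ_natural, tensorHom_comp_tensorHom_assoc, h₂, h₃]
      simp
    exact key _ _ _ _ _ _ _ _ _ _ (comparison_splitPow F e _ _) (h 0)
      (ih _ _ _ (fun x => h x.succ))

variable [MonObj M] [MonObj N] [IsMonHom e.hom]

theorem comparison_iterMul (n : ℕ) :
    comparison F e n ≫ F.map (iterMul M n) = iterMul N n ≫ e.inv := by
  have h1 : MonObj.one (X := N) ≫ e.inv = ε F ≫ F.map MonObj.one := by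
    rw [← IsMonHom.one_hom e.hom]
    simp
  have h2 : MonObj.mul (X := N) ≫ e.inv = (e.inv ⊗ₘ e.inv) ≫ μ F M M ≫ F.map MonObj.mul := by
    have := IsMonHom.mul_hom e.hom
    rw [← cancel_epi (e.hom ⊗ₘ e.hom), ← reassoc_of% this]
    simp
  induction n with
  | zero => exact h1.symm
  | succ n ih =>
    have key : ∀ {P : C} {P' : D} (p : P' ⟶ F.obj P) (s : P ⟶ M) (s' : P' ⟶ N),
        p ≫ F.map s = s' ≫ e.inv →
        ((e.inv ⊗ₘ p) ≫ μ F M P) ≫ F.map (M ◁ s ≫ MonObj.mul) =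
          (N ◁ s' ≫ MonObj.mul) ≫ e.inv := by
      intro P P' p s s' h
      rw [Category.assoc, Category.assoc, h2, F.map_comp, ← μ_natural_right_assoc]
      have h3 : (e.inv ⊗ₘ p) ≫ F.obj M ◁ F.map s = N ◁ s' ≫ (e.inv ⊗ₘ e.inv) := by
        rw [← id_tensorHom, ← id_tensorHom, tensorHom_comp_tensorHom, tensorHom_comp_tensorHom, h]
        simp
      rw [reassoc_of% h3]
    exact key _ _ _ ih

theorem RawTree.comparison_eval {l : ℕ} {I : Type} {k : I → ℕ}
    (f : ∀ i, tensorPow M (k i) ⟶ M) (f' : ∀ i, tensorPow N (k i) ⟶ N)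
    (h : ∀ i, comparison F e _ ≫ F.map (f i) = f' i ≫ e.inv) (T : RawTree l k) :
    comparison F e _ ≫ F.map (T.eval M f) = T.eval N f' ≫ e.inv := by
  have key : ∀ {P Q : C} {P' Q' : D} {p : P' ⟶ F.obj P} {q : Q' ⟶ F.obj Q} {a : P ⟶ Q}
      {a' : P' ⟶ Q'} {b : Q ⟶ M} {b' : Q' ⟶ N}, p ≫ F.map a = a' ≫ q →
      q ≫ F.map b = b' ≫ e.inv → p ≫ F.map (a ≫ b) = (a' ≫ b') ≫ e.inv := by
    intro P Q P' Q' p q a a' b b' h₁ h₂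
    rw [F.map_comp, reassoc_of% h₁, h₂, Category.assoc]
  induction T with
  | leg a =>
    have key : ((e.inv ⊗ₘ ε F) ≫ μ F M (𝟙_ C)) ≫ F.map (ρ_ M).hom = (ρ_ N).hom ≫ e.inv := by
      rw [MonoidalCategory.tensorHom_def, Category.assoc, Category.assoc, ← right_unitality]
      simp
    exact key
  | white i ch ih =>
    exact key (comparison_blockTensor F e (k i) (fun x => (ch x).legs) _ _ ih) (h i)
  | black n ch ih =>
    exact key (comparison_blockTensor F e n (fun x => (ch x).legs) _ _ ih)
      (comparison_iterMul F e n)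
  | special => exact comparison_iterMul F e 0

end Lax

section Braided

variable [SymmetricCategory C] [SymmetricCategory D] [F.Braided] {M : C} {N : D}
  (e : F.obj M ≅ N)

theorem comparison_moveFront (n : ℕ) (j : Fin (n + 1)) :
    comparison F e (n + 1) ≫ F.map (moveFront M n j) =
      moveFront N n j ≫ (e.inv ⊗ₘ comparison F e n) ≫ μ F M (tensorPow M n) := by
  have one : ∀ {A : C} {B : D} (p : B ⟶ F.obj A), p ≫ F.map (𝟙 A) = 𝟙 B ≫ p := by simp
  induction n with
  | zero => exact one _
  | succ n ih =>
    induction j using Fin.cases with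
    | zero => exact one _
    | succ i =>
      have key : ∀ {P Q : C} {P' Q' : D} (p : P' ⟶ F.obj P) (q : Q' ⟶ F.obj Q)
          (s : P ⟶ M ⊗ Q) (s' : P' ⟶ N ⊗ Q'),
          p ≫ F.map s = s' ≫ (e.inv ⊗ₘ q) ≫ μ F M Q →
          ((e.inv ⊗ₘ p) ≫ μ F M P) ≫ F.map (M ◁ s ≫ (α_ M M Q).inv ≫ (β_ M M).hom ▷ Q ≫
            (α_ M M Q).hom) = (N ◁ s' ≫ (α_ N N Q').inv ≫ (β_ N N).hom ▷ Q' ≫ (α_ N N Q').hom) ≫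
            (e.inv ⊗ₘ ((e.inv ⊗ₘ q) ≫ μ F M Q)) ≫ μ F M (M ⊗ Q) := by
        intro P Q P' Q' p q s s' h
        have h1 : (e.inv ⊗ₘ p) ≫ F.obj M ◁ F.map s =
            N ◁ s' ≫ (e.inv ⊗ₘ (e.inv ⊗ₘ q)) ≫ F.obj M ◁ μ F M Q := by
          rw [← id_tensorHom, ← id_tensorHom, ← id_tensorHom, tensorHom_comp_tensorHom,
            tensorHom_comp_tensorHom, tensorHom_comp_tensorHom, h]
          simp
        have h2 : (e.inv ⊗ₘ ((e.inv ⊗ₘ q) ≫ μ F M Q)) =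
            (e.inv ⊗ₘ (e.inv ⊗ₘ q)) ≫ F.obj M ◁ μ F M Q := by
          rw [← id_tensorHom, tensorHom_comp_tensorHom, Category.comp_id]
        have h3 : ((e.inv ⊗ₘ e.inv) ⊗ₘ q) ≫ (β_ (F.obj M) (F.obj M)).hom ▷ F.obj Q =
            (β_ N N).hom ▷ Q' ≫ ((e.inv ⊗ₘ e.inv) ⊗ₘ q) := by
          rw [← tensorHom_id, ← tensorHom_id, tensorHom_comp_tensorHom, tensorHom_comp_tensorHom,
            BraidedCategory.braiding_naturality]
          simp
        have h4 : μ F M M ▷ F.obj Q ≫ F.map (β_ M M).hom ▷ F.obj Q =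
            (β_ (F.obj M) (F.obj M)).hom ▷ F.obj Q ≫ μ F M M ▷ F.obj Q := by
          rw [← comp_whiskerRight, Functor.LaxBraided.braided, comp_whiskerRight]
        rw [Category.assoc, F.map_comp, ← μ_natural_right_assoc, reassoc_of% h1, h2]
        simp only [F.map_comp, Category.assoc]
        rw [associativity_inv_assoc, ← μ_natural_left_assoc, reassoc_of% h4, associativity,
          associator_inv_naturality_assoc, reassoc_of% h3, associator_naturality_assoc]
      exact key _ _ _ _ (ih i)

theorem comparison_permute (m n : ℕ) (σ : Fin m ≃ Fin n) :
    comparison F e n ≫ F.map (permute M m n σ) = permute N m n σ ≫ comparison F e m := by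
  induction m generalizing n with
  | zero =>
    cases n with
    | zero =>
      have one : ∀ {A : C} {B : D} (p : B ⟶ F.obj A), p ≫ F.map (𝟙 A) = 𝟙 B ≫ p := by simp
      exact one _
    | succ n => exact (σ.symm 0).elim0
  | succ m ih =>
    cases n with
    | zero => exact (σ 0).elim0
    | succ n =>
      have key : ∀ {P Q R : C} {P' Q' R' : D} {p : P' ⟶ F.obj P} {q : Q' ⟶ F.obj Q}
          {r : R' ⟶ F.obj R} {s : P ⟶ M ⊗ Q} {s' : P' ⟶ N ⊗ Q'} {t : Q ⟶ R} {t' : Q' ⟶ R'},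
          p ≫ F.map s = s' ≫ (e.inv ⊗ₘ q) ≫ μ F M Q → q ≫ F.map t = t' ≫ r →
          p ≫ F.map (s ≫ M ◁ t) = (s' ≫ N ◁ t') ≫ (e.inv ⊗ₘ r) ≫ μ F M R := by
        intro P Q R P' Q' R' p q r s s' t t' h₁ h₂
        rw [F.map_comp, reassoc_of% h₁, ← μ_natural_right, Category.assoc, ← id_tensorHom,
          ← id_tensorHom, tensorHom_comp_tensorHom_assoc, tensorHom_comp_tensorHom_assoc, h₂]
        simp
      exact key (comparison_moveFront F e n (σ 0)) (ih _ _)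

/-- The map which a monoidal functor induces on morphisms `M^{⊗ n} ⟶ M`. -/
def mapEnd (n : ℕ) (g : tensorPow M n ⟶ M) : tensorPow N n ⟶ N :=
  comparison F e n ≫ F.map g ≫ e.hom

theorem mapEnd_add [Preadditive C] [Preadditive D] [F.Additive] (n : ℕ)
    (g g' : tensorPow M n ⟶ M) : mapEnd F e n (g + g') = mapEnd F e n g + mapEnd F e n g' := by
  simp [mapEnd, Functor.map_add]

end Braided

/-- Composition along a decorated planar tree, the factor of `M^{⊗ l}` with index `a` being fed into
the leg with label `a`. The white vertices may be labelled in any way. -/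
def RawTree.operation [SymmetricCategory C] {l : ℕ} {I : Type} {k : I → ℕ} (M : C) [MonObj M]
    (f : ∀ i, tensorPow M (k i) ⟶ M) (T : RawTree l k) (h : IsEnum T.legs) : tensorPow M l ⟶ M :=
  permute M _ _ h.equiv ≫ T.eval M f

/-- Monoidal functors preserve the operation of a tree. -/
theorem RawTree.mapEnd_operation [SymmetricCategory C] [SymmetricCategory D] [F.Braided] {M : C}
    {N : D} [MonObj M] [MonObj N] (e : F.obj M ≅ N) [IsMonHom e.hom] {l : ℕ} {I : Type} {k : I → ℕ}
    (f : ∀ i, tensorPow M (k i) ⟶ M) (T : RawTree l k) (h : IsEnum T.legs) :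
    mapEnd F e l (T.operation M f h) = T.operation N (fun i => mapEnd F e (k i) (f i)) h := by
  have h₁ := comparison_permute F e _ _ h.equiv
  have h₂ := T.comparison_eval F e f (fun i => mapEnd F e (k i) (f i)) (by simp [mapEnd])
  simp only [mapEnd, RawTree.operation, F.map_comp, Category.assoc]
  rw [reassoc_of% h₁, reassoc_of% h₂]
  simp [mapEnd]

theorem OpTree.act_eq {l : ℕ} {I : Type} {k : I → ℕ} (T : OpTree l k) (X : SymCat.{u, v})
    (f : ∀ i, X.End (k i)) :
    T.act X f = T.1.operation X.M f ⟨T.2.legs_nodup, T.2.mem_legs⟩ :=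
  congrArg _ (RawTree.planarEval_unit _ _ _)

end Naturality

/-! ### Evaluation of the universal pair -/

section EvaluationFunctor

open scoped Obj
open FreeHom

variable {I : Type} {k : I → ℕ}

namespace FreeHom

variable {C : Type u'} [Category.{v'} C] [MonoidalCategory C] [SymmetricCategory C]
    [Preadditive C] {M : C} [MonObj M] {f : ∀ i, tensorPow M (k i) ⟶ M}

/-- The functor out of the universal pair which is given by evaluation. -/
def evalFunctor (h : Respects.{u, v} M f) : (freePair.{u, v} k).V ⥤ C where
  obj := fun a : FreeObj.{u, v} k PUnit => a.word.obj M
  map {a b : FreeObj.{u, v} k PUnit} (s : a ⟶ b) := val h s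
  map_id _ := rfl
  map_comp s t := val_comp h s t

/-- Evaluation is strictly compatible with tensor products. -/
def evalCoreMonoidal (h : Respects.{u, v} M f) : (evalFunctor h).CoreMonoidal where
  εIso := Iso.refl _
  μIso := fun (a b : FreeObj.{u, v} k PUnit) => Iso.refl (a.word.obj M ⊗ b.word.obj M)
  μIso_hom_natural_left s c := (Category.comp_id _).trans
    ((val_whiskerRight h s).symm.trans (Category.id_comp _).symm)
  μIso_hom_natural_right c s := (Category.comp_id _).trans
    ((val_whiskerLeft h s).symm.trans (Category.id_comp _).symm)
  associativity a b c := by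
    have key : ∀ A B D : C, 𝟙 (A ⊗ B) ▷ D ≫ 𝟙 _ ≫ (α_ A B D).hom =
      (α_ A B D).hom ≫ A ◁ 𝟙 _ ≫ 𝟙 _ := by simp
    exact key _ _ _
  left_unitality a := by
    have key : ∀ A : C, (λ_ A).hom = 𝟙 (𝟙_ C) ▷ A ≫ 𝟙 _ ≫ (λ_ A).hom := by simp
    exact key _
  right_unitality a := by
    have key : ∀ A : C, (ρ_ A).hom = A ◁ 𝟙 (𝟙_ C) ≫ 𝟙 _ ≫ (ρ_ A).hom := by simp
    exact key _

instance (h : Respects.{u, v} M f) : (evalFunctor h).Braided where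
  __ := (evalCoreMonoidal h).toMonoidal
  braided a b := by
    have key : ∀ A B : C, 𝟙 _ ≫ (β_ A B).hom = (β_ A B).hom ≫ 𝟙 _ := by simp
    exact key _ _

instance (h : Respects.{u, v} M f) : (evalFunctor h).Additive where
  map_add := val_add h _ _

/-- The distinguished monoid of the universal pair is sent to the given monoid. -/
def evalIso (h : Respects.{u, v} M f) : (evalFunctor h).obj (freePair.{u, v} k).M ≅ M := Iso.refl M

instance (h : Respects.{u, v} M f) : IsMonHom (evalIso h).hom where
  one_hom := by
    have key : (𝟙 _ ≫ MonObj.one (X := M)) ≫ 𝟙 M = MonObj.one := by simp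
    exact key
  mul_hom := by
    have key : (𝟙 _ ≫ MonObj.mul (X := M)) ≫ 𝟙 M = (𝟙 M ⊗ₘ 𝟙 M) ≫ MonObj.mul := by simp
    exact key

end FreeHom

/-- The morphism from the universal pair to a pair with chosen morphisms `M^{⊗ k i} ⟶ M`. -/
def freeHom (X : SymCat.{u, v}) (f : ∀ i, X.End (k i)) : SymCat.Hom (freePair.{u, v} k) X where
  F := evalFunctor (respects_left X f)
  iso := evalIso (respects_left X f)

/-- The iterated tensor product in the universal pair is isomorphic to the formal power. -/
def toPow (k : I → ℕ) : (n : ℕ) →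
    (tensorPow (freePair.{u, v} k).M n ⟶ (⟨.pow n⟩ : FreeObj.{u, v} k PUnit))
  | 0 => ofTerm (a := ⟨.unit⟩) .powZero
  | n + 1 => (freePair.{u, v} k).M ◁ toPow k n ≫
      ofTerm (a := (⟨.base⟩ : FreeObj.{u, v} k PUnit) ⊗ ⟨.pow n⟩) (.powSucc n)

/-- The universal morphisms `M^{⊗ k i} ⟶ M`. -/
def freeGen (k : I → ℕ) (i : I) : (freePair.{u, v} k).End (k i) :=
  toPow k (k i) ≫ ofTerm (a := ⟨.pow (k i)⟩) (.gen i)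

section

variable {C : Type u'} [Category.{v'} C] [MonoidalCategory C] [SymmetricCategory C]
    [Preadditive C] {M : C} [MonObj M] {f : ∀ i, tensorPow M (k i) ⟶ M} (h : Respects.{u, v} M f)

/-- The formal power is evaluated to the iterated tensor product itself. -/
theorem comparison_toPow (n : ℕ) :
    comparison (evalFunctor h) (evalIso h) n ≫ (evalFunctor h).map (toPow k n) =
      𝟙 (tensorPow M n) := by
  induction n with
  | zero =>
    have key : 𝟙 (𝟙_ C) ≫ 𝟙 (𝟙_ C) = 𝟙 (𝟙_ C) := by simp
    exact key
  | succ n ih =>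
    have e : (evalFunctor h).map (toPow k (n + 1)) =
        M ◁ (evalFunctor h).map (toPow k n) ≫ 𝟙 _ :=
      (val_comp h _ _).trans (congrArg (· ≫ 𝟙 (M ⊗ tensorPow M n)) (val_whiskerLeft h _))
    have key : ∀ {A B : C} (p : A ⟶ B) (s : B ⟶ A), p ≫ s = 𝟙 A →
        ((𝟙 M ⊗ₘ p) ≫ 𝟙 (M ⊗ B)) ≫ M ◁ s ≫ 𝟙 _ = 𝟙 (M ⊗ A) := by
      intro A B p s h
      simp [← MonoidalCategory.whiskerLeft_comp, h]
    exact (congrArg _ e).trans (key _ _ ih)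

theorem mapEnd_freeGen (i : I) :
    mapEnd (evalFunctor h) (evalIso h) (k i) (freeGen k i) = f i := by
  have e : (evalFunctor h).map (freeGen k i) = (evalFunctor h).map (toPow k (k i)) ≫ f i :=
    val_comp h _ _
  have key : ∀ {A B : C} (p : A ⟶ B) (s : B ⟶ A) (g : A ⟶ M), p ≫ s = 𝟙 A →
      p ≫ (s ≫ g) ≫ 𝟙 M = g := by
    intro A B p s g h
    rw [Category.comp_id, reassoc_of% h]
  exact (congrArg (fun t => comparison (evalFunctor h) (evalIso h) (k i) ≫ t ≫ 𝟙 M) e).trans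
    (key _ _ _ (comparison_toPow h (k i)))

end

theorem SymCat.Hom.map_eq {X Y : SymCat.{u, v}} (φ : SymCat.Hom X Y) (n : ℕ) (g : X.End n) :
    φ.map n g = mapEnd φ.F φ.iso n g := by
  rw [SymCat.Hom.map, powComparison_eq]; rfl

theorem freeHom_map_freeGen (X : SymCat.{u, v}) (f : ∀ i, X.End (k i)) (i : I) :
    (freeHom X f).map (k i) (freeGen k i) = f i :=
  (SymCat.Hom.map_eq _ _ _).trans (mapEnd_freeGen (respects_left X f) i)

end EvaluationFunctor

/-! ### The normal form of formal expressions -/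

section NormalForm

variable {C : Type u} [Category.{v} C] [MonoidalCategory C] [SymmetricCategory C] {M : C}

/-- Tensor products of maps from two given families, preceded by a permutation of the factors. -/
def joinMaps {A B : C} (S : ∀ l, Set (tensorPow M l ⟶ A)) (T : ∀ l, Set (tensorPow M l ⟶ B))
    (l : ℕ) : Set (tensorPow M l ⟶ A ⊗ B) :=
  {g | ∃ (l₁ l₂ : ℕ) (p : tensorPow M l ⟶ tensorPow M (l₂ + l₁)) (g₁ : tensorPow M l₁ ⟶ A)
    (g₂ : tensorPow M l₂ ⟶ B), IsPerm M _ _ p ∧ g₁ ∈ S l₁ ∧ g₂ ∈ T l₂ ∧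
      g = p ≫ (joinPow M l₁ l₂).inv ≫ (g₁ ⊗ₘ g₂)}

/-- The family is closed under permutations of the factors of the source. -/
def PermStable {A : C} (S : ∀ l, Set (tensorPow M l ⟶ A)) : Prop :=
  ∀ ⦃l l' : ℕ⦄ ⦃p : tensorPow M l' ⟶ tensorPow M l⦄ ⦃g : tensorPow M l ⟶ A⦄,
    IsPerm M _ _ p → g ∈ S l → p ≫ g ∈ S l'

/-- The permutations with values in the unit object; they exist only on the zeroth power. -/
def unitMaps (M : C) (l : ℕ) : Set (tensorPow M l ⟶ 𝟙_ C) := {p | IsPerm M l 0 p}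

theorem permStable_unitMaps : PermStable (unitMaps M) := fun _ _ _ _ hp hg => hp.comp hg

variable {A B D : C} {S : ∀ l, Set (tensorPow M l ⟶ A)} {T : ∀ l, Set (tensorPow M l ⟶ B)}
  {R : ∀ l, Set (tensorPow M l ⟶ D)} {l : ℕ}

theorem permStable_joinMaps : PermStable (joinMaps S T) := by
  rintro l l' p _ hp ⟨l₁, l₂, p', g₁, g₂, hp', h₁, h₂, rfl⟩
  exact ⟨l₁, l₂, _, g₁, g₂, hp.comp hp', h₁, h₂, (Category.assoc _ _ _).symm⟩

theorem IsPerm.exists_join_assoc (a b c : ℕ) : ∃ q, IsPerm M (c + (b + a)) (c + b + a) q ∧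
    (joinPow M (b + a) c).inv ≫ (joinPow M a b).inv ▷ tensorPow M c ≫ (α_ _ _ _).hom =
      q ≫ (joinPow M a (c + b)).inv ≫ tensorPow M a ◁ (joinPow M b c).inv := by
  obtain ⟨q, hq, h⟩ := IsPerm.exists_assoc_join (M := M) a b c
  obtain ⟨q', hq', h₁, h₂⟩ := hq.exists_inv
  refine ⟨q', hq', ?_⟩
  rw [Iso.inv_comp_eq, ← cancel_epi ((joinPow M a b).hom ▷ tensorPow M c), reassoc_of% h,
    reassoc_of% h₁]
  simp

/-- Permutations can be moved past the tensor product to its source, where they are composed with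
the one coming from the associativity of concatenation. -/
theorem joinMaps_assoc {g : tensorPow M l ⟶ (A ⊗ B) ⊗ D}
    (hg : g ∈ joinMaps (joinMaps S T) R l) :
    g ≫ (α_ A B D).hom ∈ joinMaps S (joinMaps T R) l := by
  obtain ⟨l', c, p, _, g₃, hp, ⟨a, b, p', g₁, g₂, hp', h₁, h₂, rfl⟩, h₃, rfl⟩ := hg
  obtain ⟨q, hq, e⟩ := hp'.exists_whiskerRight_join c
  obtain ⟨r, hr, e'⟩ := IsPerm.exists_join_assoc (M := M) a b c
  refine ⟨a, c + b, _, g₁, (joinPow M b c).inv ≫ (g₂ ⊗ₘ g₃), hp.comp (hq.comp hr), h₁,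
    ⟨b, c, 𝟙 _, g₂, g₃, .id _, h₂, h₃, (Category.id_comp _).symm⟩, ?_⟩
  have e₁ : (joinPow M l' c).inv ≫ p' ▷ tensorPow M c = q ≫ (joinPow M (b + a) c).inv := by
    rw [Iso.inv_comp_eq, ← reassoc_of% e, Iso.hom_inv_id, Category.comp_id]
  have e₂ : (p' ≫ (joinPow M a b).inv ≫ (g₁ ⊗ₘ g₂) ⊗ₘ g₃) =
      p' ▷ _ ≫ (joinPow M a b).inv ▷ _ ≫ ((g₁ ⊗ₘ g₂) ⊗ₘ g₃) := by
    rw [← tensorHom_id, ← tensorHom_id, tensorHom_comp_tensorHom, tensorHom_comp_tensorHom]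
    simp
  have e₃ : (g₁ ⊗ₘ (joinPow M b c).inv ≫ (g₂ ⊗ₘ g₃)) =
      tensorPow M a ◁ (joinPow M b c).inv ≫ (g₁ ⊗ₘ g₂ ⊗ₘ g₃) := by
    rw [← id_tensorHom, tensorHom_comp_tensorHom]
    simp
  rw [e₂, e₃]
  simp only [Category.assoc]
  rw [reassoc_of% e₁, associator_naturality, reassoc_of% e']

theorem joinMaps_assoc_inv {g : tensorPow M l ⟶ A ⊗ B ⊗ D}
    (hg : g ∈ joinMaps S (joinMaps T R) l) :
    g ≫ (α_ A B D).inv ∈ joinMaps (joinMaps S T) R l := by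
  obtain ⟨a, l', p, g₁, _, hp, h₁, ⟨b, c, p', g₂, g₃, hp', h₂, h₃, rfl⟩, rfl⟩ := hg
  obtain ⟨q, hq, e⟩ := hp'.exists_whiskerLeft_join a
  obtain ⟨r, hr, e'⟩ := IsPerm.exists_join_assoc (M := M) a b c
  obtain ⟨r', hr', -, hr''⟩ := hr.exists_inv
  refine ⟨b + a, c, _, (joinPow M a b).inv ≫ (g₁ ⊗ₘ g₂), g₃, hp.comp (hq.comp hr'),
    ⟨a, b, 𝟙 _, g₁, g₂, .id _, h₁, h₂, (Category.id_comp _).symm⟩, h₃, ?_⟩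
  have e₁ : (joinPow M a l').inv ≫ tensorPow M a ◁ p' = q ≫ (joinPow M a (c + b)).inv := by
    rw [Iso.inv_comp_eq, ← reassoc_of% e, Iso.hom_inv_id, Category.comp_id]
  have e₂ : (g₁ ⊗ₘ p' ≫ (joinPow M b c).inv ≫ (g₂ ⊗ₘ g₃)) =
      _ ◁ p' ≫ _ ◁ (joinPow M b c).inv ≫ (g₁ ⊗ₘ g₂ ⊗ₘ g₃) := by
    rw [← id_tensorHom, ← id_tensorHom, tensorHom_comp_tensorHom, tensorHom_comp_tensorHom]
    simp
  have e₃ : ((joinPow M a b).inv ≫ (g₁ ⊗ₘ g₂) ⊗ₘ g₃) =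
      (joinPow M a b).inv ▷ tensorPow M c ≫ ((g₁ ⊗ₘ g₂) ⊗ₘ g₃) := by
    rw [← tensorHom_id, tensorHom_comp_tensorHom]
    simp
  have e₄ : (joinPow M a (c + b)).inv ≫ tensorPow M a ◁ (joinPow M b c).inv =
      r' ≫ (joinPow M (b + a) c).inv ≫ (joinPow M a b).inv ▷ tensorPow M c ≫ (α_ _ _ _).hom := by
    rw [e', reassoc_of% hr'']
  rw [e₂, e₃]
  simp only [Category.assoc]
  rw [reassoc_of% e₁, reassoc_of% e₄, associator_inv_naturality, Iso.hom_inv_id_assoc]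

theorem joinMaps_leftUnitor (hT : PermStable T) {g : tensorPow M l ⟶ 𝟙_ C ⊗ B}
    (hg : g ∈ joinMaps (unitMaps M) T l) : g ≫ (λ_ B).hom ∈ T l := by
  obtain ⟨l₁, l₂, p, g₁, g₂, hp, h₁, h₂, rfl⟩ := hg
  cases h₁
  have key : ∀ {P Q : C} (p : P ⟶ Q) (g : Q ⟶ B),
      (p ≫ (λ_ Q).inv ≫ (𝟙 _ ⊗ₘ g)) ≫ (λ_ B).hom = p ≫ g := by
    intro P Q p g
    simp
  exact (key p g₂).symm ▸ hT hp h₂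

theorem joinMaps_leftUnitor_inv {g : tensorPow M l ⟶ B} (hg : g ∈ T l) :
    g ≫ (λ_ B).inv ∈ joinMaps (unitMaps M) T l := by
  refine ⟨0, l, 𝟙 _, 𝟙 _, g, .id _, .zero, hg, ?_⟩
  have key : ∀ {P : C} (g : P ⟶ B), g ≫ (λ_ B).inv = 𝟙 _ ≫ (λ_ P).inv ≫ (𝟙 _ ⊗ₘ g) := by
    intro P g
    simp
  exact key g

theorem joinMaps_rightUnitor (hS : PermStable S) {g : tensorPow M l ⟶ A ⊗ 𝟙_ C}
    (hg : g ∈ joinMaps S (unitMaps M) l) : g ≫ (ρ_ A).hom ∈ S l := by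
  obtain ⟨l₁, l₂, p, g₁, g₂, hp, h₁, h₂, rfl⟩ := hg
  cases h₂
  obtain ⟨q, hq, e⟩ := IsPerm.exists_join_zero (M := M) l₁
  obtain ⟨q', hq', h, h'⟩ := hq.exists_inv
  have key : ∀ {P Q R : C} (p : P ⟶ R) (j : Q ⊗ 𝟙_ C ≅ R) (q : Q ⟶ R) (q' : R ⟶ Q) (g : Q ⟶ A),
      j.hom = (ρ_ Q).hom ≫ q → q ≫ q' = 𝟙 _ →
      (p ≫ j.inv ≫ (g ⊗ₘ 𝟙 _)) ≫ (ρ_ A).hom = (p ≫ q') ≫ g := by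
    intro P Q R p j q q' g h₁ h₂
    have : j.inv ≫ (ρ_ Q).hom = q' := by
      rw [Iso.inv_comp_eq, h₁, Category.assoc, h₂, Category.comp_id]
    simp [← this]
  exact (key p (joinPow M l₁ 0) q q' g₁ e h).symm ▸ hS (hp.comp hq') h₁

theorem joinMaps_rightUnitor_inv {g : tensorPow M l ⟶ A} (hg : g ∈ S l) :
    g ≫ (ρ_ A).inv ∈ joinMaps S (unitMaps M) l := by
  obtain ⟨q, hq, e⟩ := IsPerm.exists_join_zero (M := M) l
  refine ⟨l, 0, q, g, 𝟙 _, hq, hg, .zero, ?_⟩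
  have key : ∀ {P Q : C} (j : P ⊗ 𝟙_ C ≅ Q) (q : P ⟶ Q) (g : P ⟶ A), j.hom = (ρ_ P).hom ≫ q →
      g ≫ (ρ_ A).inv = q ≫ j.inv ≫ (g ⊗ₘ 𝟙 _) := by
    intro P Q j q g h
    have : q ≫ j.inv = (ρ_ P).inv := by
      rw [Iso.comp_inv_eq, h, Iso.inv_hom_id_assoc]
    rw [reassoc_of% this]
    simp
  exact key _ _ _ e

theorem joinMaps_braiding {g : tensorPow M l ⟶ A ⊗ B} (hg : g ∈ joinMaps S T l) :
    g ≫ (β_ A B).hom ∈ joinMaps T S l := by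
  obtain ⟨a, b, p, g₁, g₂, hp, h₁, h₂, rfl⟩ := hg
  obtain ⟨q, hq, e⟩ := IsPerm.exists_braiding_join (M := M) a b
  refine ⟨b, a, p ≫ q, g₂, g₁, hp.comp hq, h₂, h₁, ?_⟩
  have h : (joinPow M a b).inv ≫ (β_ _ _).hom = q ≫ (joinPow M b a).inv := by
    rw [Iso.inv_comp_eq, ← reassoc_of% e, Iso.hom_inv_id, Category.comp_id]
  simp only [Category.assoc]
  rw [BraidedCategory.braiding_naturality, reassoc_of% h]

theorem comp_mem_closure_joinMaps_left [Preadditive C] [MonoidalPreadditive C]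
    {X : C} {s : B ⟶ X} {T' : ∀ l, Set (tensorPow M l ⟶ X)}
    (h : ∀ l, ∀ g ∈ T l, g ≫ s ∈ AddSubgroup.closure (T' l)) {g : tensorPow M l ⟶ A ⊗ B}
    (hg : g ∈ joinMaps S T l) : g ≫ A ◁ s ∈ AddSubgroup.closure (joinMaps S T' l) := by
  obtain ⟨l₁, l₂, p, g₁, g₂, hp, h₁, h₂, rfl⟩ := hg
  have key : ∀ y ∈ AddSubgroup.closure (T' l₂), p ≫ (joinPow M l₁ l₂).inv ≫ (g₁ ⊗ₘ y) ∈
      AddSubgroup.closure (joinMaps S T' l) := by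
    intro y hy
    induction hy using AddSubgroup.closure_induction with
    | mem y hy => exact AddSubgroup.subset_closure ⟨l₁, l₂, p, g₁, y, hp, h₁, hy, rfl⟩
    | zero => simp
    | add y z _ _ hy hz =>
      simp only [MonoidalPreadditive.tensor_add, Preadditive.comp_add]
      exact add_mem hy hz
    | neg y _ hy =>
      have e : (g₁ ⊗ₘ -y) = -(g₁ ⊗ₘ y) := by
        rw [eq_neg_iff_add_eq_zero, ← MonoidalPreadditive.tensor_add, neg_add_cancel,
          MonoidalPreadditive.tensor_zero]
      rw [e, Preadditive.comp_neg, Preadditive.comp_neg]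
      exact neg_mem hy
  have e : (p ≫ (joinPow M l₁ l₂).inv ≫ (g₁ ⊗ₘ g₂)) ≫ A ◁ s =
      p ≫ (joinPow M l₁ l₂).inv ≫ (g₁ ⊗ₘ (g₂ ≫ s)) := by
    rw [Category.assoc, Category.assoc, ← id_tensorHom, tensorHom_comp_tensorHom, Category.comp_id]
  exact e ▸ key _ (h _ _ h₂)

theorem comp_mem_closure_joinMaps_right [Preadditive C] [MonoidalPreadditive C]
    {X : C} {s : A ⟶ X} {S' : ∀ l, Set (tensorPow M l ⟶ X)}
    (h : ∀ l, ∀ g ∈ S l, g ≫ s ∈ AddSubgroup.closure (S' l)) {g : tensorPow M l ⟶ A ⊗ B}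
    (hg : g ∈ joinMaps S T l) : g ≫ s ▷ B ∈ AddSubgroup.closure (joinMaps S' T l) := by
  have h' := comp_mem_closure_joinMaps_left (S := T) h (joinMaps_braiding hg)
  have e : g ≫ s ▷ B = ((g ≫ (β_ A B).hom) ≫ B ◁ s) ≫ (β_ B X).hom := by simp
  rw [e]
  generalize (g ≫ (β_ A B).hom) ≫ B ◁ s = y at h'
  induction h' using AddSubgroup.closure_induction with
  | mem y hy => exact AddSubgroup.subset_closure (joinMaps_braiding hy)
  | zero => simp
  | add y z _ _ hy hz => rw [Preadditive.add_comp]; exact add_mem hy hz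
  | neg y _ hy => rw [Preadditive.neg_comp]; exact neg_mem hy

variable {I : Type} {k : I → ℕ} [MonObj M] (f : ∀ i, tensorPow M (k i) ⟶ M)

/-- The maps `M^{⊗ l} ⟶ M^{⊗ n}` which are tensor products of maps represented by trees, preceded
by a permutation of the factors. -/
def powMaps : (n l : ℕ) → Set (tensorPow M l ⟶ tensorPow M n)
  | 0 => unitMaps M
  | n + 1 => joinMaps (treeMaps f) (powMaps n)

/-- The maps from `M^{⊗ l}` to the object given by a word which are tensor products of maps
represented by trees, preceded by a permutation of the factors. -/
def wordMaps : (b : Word) → (l : ℕ) → Set (tensorPow M l ⟶ b.obj M)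
  | .unit => unitMaps M
  | .base => treeMaps f
  | .tensor a b => joinMaps (wordMaps a) (wordMaps b)
  | .pow n => powMaps f n

variable {f}

theorem permStable_treeMaps : PermStable (treeMaps f) :=
  fun _ _ _ _ hp hg => perm_comp_mem_treeMaps hg hp

theorem permStable_wordMaps (b : Word) : PermStable (wordMaps f b) := by
  cases b with
  | unit => exact permStable_unitMaps
  | base => exact permStable_treeMaps
  | tensor a b => exact permStable_joinMaps
  | pow n =>
    cases n with
    | zero => exact permStable_unitMaps
    | succ n => exact permStable_joinMaps

theorem powMaps_subset_forestMaps (n l : ℕ) : powMaps f n l ⊆ forestMaps f n l := by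
  induction n generalizing l with
  | zero => exact fun p hp => perm_mem_forestMaps hp
  | succ n ih =>
    rintro _ ⟨l₁, l₂, p, g₁, g₂, hp, h₁, h₂, rfl⟩
    exact cons_mem_forestMaps hp h₁ (ih _ h₂)

theorem one_mem_treeMaps {p : tensorPow M l ⟶ 𝟙_ C} (hp : p ∈ unitMaps M l) :
    p ≫ MonObj.one ∈ treeMaps f l :=
  comp_iterMul_mem_treeMaps (n := 0) (perm_mem_forestMaps hp)

/-- The binary multiplication is the iterated multiplication of two factors, up to a unit. -/
theorem mul_mem_treeMaps {g : tensorPow M l ⟶ M ⊗ M}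
    (hg : g ∈ joinMaps (treeMaps f) (treeMaps f) l) : g ≫ MonObj.mul ∈ treeMaps f l := by
  obtain ⟨a, b, p, g₁, g₂, hp, h₁, h₂, rfl⟩ := hg
  have h : p ≫ (joinPow M a b).inv ≫ (g₁ ⊗ₘ (g₂ ≫ (ρ_ M).inv)) ∈ powMaps f 2 l :=
    ⟨a, b, p, g₁, _, hp, h₁, joinMaps_rightUnitor_inv h₂, rfl⟩
  have h' := comp_iterMul_mem_treeMaps (powMaps_subset_forestMaps 2 l h)
  have key : ∀ {P Q R X : C} (p : P ⟶ Q) (j : Q ⟶ R ⊗ X) (g₁ : R ⟶ M) (g₂ : X ⟶ M),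
      (p ≫ j ≫ (g₁ ⊗ₘ (g₂ ≫ (ρ_ M).inv))) ≫ M ◁ (M ◁ MonObj.one ≫ MonObj.mul) ≫ MonObj.mul =
        (p ≫ j ≫ (g₁ ⊗ₘ g₂)) ≫ MonObj.mul := by
    intro P Q R X p j g₁ g₂
    rw [MonObj.mul_one, Category.assoc, Category.assoc, Category.assoc, Category.assoc,
      ← id_tensorHom, tensorHom_comp_tensorHom_assoc]
    simp
  exact key p _ g₁ g₂ ▸ h'

/-- Composition with a formal expression preserves the group generated by tensor products of trees.
This is the normal form theorem: every expression is a linear combination of trees. -/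
theorem FreeTerm.comp_eval_mem [Preadditive C] [MonoidalPreadditive C] {a b : Word}
    (t : FreeTerm k a b) {g : tensorPow M l ⟶ a.obj M} (hg : g ∈ wordMaps f a l) :
    g ≫ t.eval M f ∈ AddSubgroup.closure (wordMaps f b l) := by
  induction t generalizing l with
  | id a => exact (Category.comp_id g).symm ▸ AddSubgroup.subset_closure hg
  | @comp a b c s t hs ht =>
    have h := hs hg
    rw [eval, ← Category.assoc]
    generalize g ≫ s.eval M f = y at h
    induction h using AddSubgroup.closure_induction with
    | mem y hy => exact ht hy
    | zero => simp
    | add y z _ _ hy hz => rw [Preadditive.add_comp]; exact add_mem hy hz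
    | neg y _ hy => rw [Preadditive.neg_comp]; exact neg_mem hy
  | zero a b => rw [eval, Limits.comp_zero]; exact zero_mem _
  | add s t hs ht => rw [eval, Preadditive.comp_add]; exact add_mem (hs hg) (ht hg)
  | neg s hs => rw [eval, Preadditive.comp_neg]; exact neg_mem (hs hg)
  | whiskerLeft a s hs => exact comp_mem_closure_joinMaps_left (fun l g hg => hs hg) hg
  | whiskerRight s c hs => exact comp_mem_closure_joinMaps_right (fun l g hg => hs hg) hg
  | assoc a b c => exact AddSubgroup.subset_closure (joinMaps_assoc hg)
  | assocInv a b c => exact AddSubgroup.subset_closure (joinMaps_assoc_inv hg)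
  | leftUnit a =>
    exact AddSubgroup.subset_closure (joinMaps_leftUnitor (permStable_wordMaps a) hg)
  | leftUnitInv a => exact AddSubgroup.subset_closure (joinMaps_leftUnitor_inv hg)
  | rightUnit a =>
    exact AddSubgroup.subset_closure (joinMaps_rightUnitor (permStable_wordMaps a) hg)
  | rightUnitInv a => exact AddSubgroup.subset_closure (joinMaps_rightUnitor_inv hg)
  | braid a b => exact AddSubgroup.subset_closure (joinMaps_braiding hg)
  | powZero => exact (Category.comp_id g).symm ▸ AddSubgroup.subset_closure hg
  | powSucc n => exact (Category.comp_id g).symm ▸ AddSubgroup.subset_closure hg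
  | gen i =>
    exact AddSubgroup.subset_closure (comp_mem_treeMaps i (powMaps_subset_forestMaps _ _ hg))
  | mul => exact AddSubgroup.subset_closure (mul_mem_treeMaps hg)
  | one => exact AddSubgroup.subset_closure (one_mem_treeMaps hg)

open FreeHom in
/-- Every operation in the universal pair is evaluated to a linear combination of trees. -/
theorem mapEnd_evalFunctor_mem {C : Type u'} [Category.{v'} C] [MonoidalCategory C]
    [SymmetricCategory C] [Preadditive C] [MonoidalPreadditive C] {M : C} [MonObj M]
    {f : ∀ i, tensorPow M (k i) ⟶ M} (h : Respects.{u, v} M f) (l : ℕ)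
    (g : (freePair.{u, v} k).End l) :
    mapEnd (evalFunctor h) (evalIso h) l g ∈ AddSubgroup.closure (treeMaps f l) := by
  have hc : ∀ n, comparison (evalFunctor h) (evalIso h) n ∈
      wordMaps f (FreeObj.word (tensorPow (freePair.{u, v} k).M n : FreeObj.{u, v} k PUnit)) n := by
    intro n
    induction n with
    | zero => exact IsPerm.zero
    | succ n ih =>
      refine ⟨1, n, 𝟙 _, (ρ_ M).hom, _, .id _, rightUnitor_mem_treeMaps, ih, ?_⟩
      have key : ∀ {P Q : C} (j : (M ⊗ 𝟙_ C) ⊗ P ≅ M ⊗ P) (c : P ⟶ Q),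
          j.hom = (ρ_ M).hom ▷ P →
          (𝟙 M ⊗ₘ c) ≫ 𝟙 _ = 𝟙 _ ≫ j.inv ≫ ((ρ_ M).hom ⊗ₘ c) := by
        intro P Q j c h
        have e : ((ρ_ M).hom ⊗ₘ c) = j.hom ≫ (𝟙 M ⊗ₘ c) := by
          rw [h, MonoidalCategory.tensorHom_def, id_tensorHom]
        rw [e]
        simp
      exact key _ _ (joinPow_one M n)
  have ht : ∀ t : FreeHom.{u, v} k _ .base, comparison (evalFunctor h) (evalIso h) l ≫
      FreeHom.eval h t ∈ AddSubgroup.closure (treeMaps f l) := by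
    intro t
    induction t using Quotient.ind with
    | _ t => exact t.down.comp_eval_mem (hc l)
  exact Set.mem_of_eq_of_mem (congrArg (comparison (evalFunctor h) (evalIso h) l ≫ ·)
    (Category.comp_id (FreeHom.eval h g))) (ht g)

end NormalForm

/-! ### Multilinearity of the operation of a tree -/

section Multilinearity

variable {C : Type u} [Category.{v} C] [MonoidalCategory C] [Preadditive C] [MonoidalPreadditive C]
  {M : C}

theorem zsmul_tensorHom {A B X Y : C} (n : ℤ) (g : A ⟶ B) (h : X ⟶ Y) :
    (n • g ⊗ₘ h) = n • (g ⊗ₘ h) :=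
  map_zsmul (AddMonoidHom.mk' (fun g : A ⟶ B => (g ⊗ₘ h))
    (fun _ _ => MonoidalPreadditive.add_tensor _ _ _)) n g

theorem tensorHom_zsmul {A B X Y : C} (n : ℤ) (g : A ⟶ B) (h : X ⟶ Y) :
    (g ⊗ₘ n • h) = n • (g ⊗ₘ h) :=
  map_zsmul (AddMonoidHom.mk' (fun h : X ⟶ Y => (g ⊗ₘ h))
    (fun _ _ => MonoidalPreadditive.tensor_add _ _ _)) n h

theorem blockTensor_add {α : Type} {n : ℕ} {L : Fin n → List α} (x₀ : Fin n)
    {a b c : ∀ x, tensorPow M (L x).length ⟶ M} (h₀ : a x₀ = b x₀ + c x₀)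
    (hb : ∀ x ≠ x₀, b x = a x) (hc : ∀ x ≠ x₀, c x = a x) :
    blockTensor M n L a = blockTensor M n L b + blockTensor M n L c := by
  induction n with
  | zero => exact x₀.elim0
  | succ n ih =>
    induction x₀ using Fin.cases with
    | zero =>
      have h₁ : (fun x : Fin n => b x.succ) = fun x : Fin n => a x.succ :=
        funext fun x => hb _ (Fin.succ_ne_zero x)
      have h₂ : (fun x : Fin n => c x.succ) = fun x : Fin n => a x.succ :=
        funext fun x => hc _ (Fin.succ_ne_zero x)
      have key : ∀ {P Q X Y : C} (s : P ⟶ Q ⊗ X) (g g' : Q ⟶ M) (h : X ⟶ Y),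
          s ≫ ((g + g') ⊗ₘ h) = s ≫ (g ⊗ₘ h) + s ≫ (g' ⊗ₘ h) := by
        intros
        rw [MonoidalPreadditive.add_tensor, Preadditive.comp_add]
      simp only [blockTensor, h₀, h₁, h₂]
      exact key _ _ _ _
    | succ x₀ =>
      have h := ih (L := fun x => L x.succ) x₀ (a := fun x => a x.succ) (b := fun x => b x.succ)
        (c := fun x => c x.succ) h₀
        (fun x hx => hb _ fun e => hx (Fin.succ_injective _ e))
        (fun x hx => hc _ fun e => hx (Fin.succ_injective _ e))
      have key : ∀ {P Q X Y : C} (s : P ⟶ Q ⊗ X) (g : Q ⟶ M) (h h' : X ⟶ Y),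
          s ≫ (g ⊗ₘ (h + h')) = s ≫ (g ⊗ₘ h) + s ≫ (g ⊗ₘ h') := by
        intros
        rw [MonoidalPreadditive.tensor_add, Preadditive.comp_add]
      simp only [blockTensor, h, hb 0 (Fin.succ_ne_zero x₀).symm, hc 0 (Fin.succ_ne_zero x₀).symm]
      exact key _ _ _ _

theorem blockTensor_zsmul {α : Type} {n : ℕ} {L : Fin n → List α} (c : Fin n → ℤ)
    (a : ∀ x, tensorPow M (L x).length ⟶ M) :
    blockTensor M n L (fun x => c x • a x) = (List.ofFn c).prod • blockTensor M n L a := by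
  induction n with
  | zero => exact (one_zsmul _).symm
  | succ n ih =>
    have key : ∀ {P Q X Y : C} (s : P ⟶ Q ⊗ X) (g : Q ⟶ M) (h : X ⟶ Y) (c p : ℤ),
        s ≫ (c • g ⊗ₘ p • h) = (c * p) • s ≫ (g ⊗ₘ h) := by
      intros
      rw [zsmul_tensorHom, tensorHom_zsmul, Preadditive.comp_zsmul, Preadditive.comp_zsmul,
        mul_zsmul]
    simp only [blockTensor, ih (L := fun x => L x.succ), List.ofFn_succ, List.prod_cons]
    exact key _ _ _ _ _

namespace RawTree

variable {l : ℕ} {I : Type} {k : I → ℕ} [MonObj M]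

omit [Preadditive C] [MonoidalPreadditive C] in
theorem eval_congr {f f' : ∀ i, tensorPow M (k i) ⟶ M} (T : RawTree l k)
    (h : ∀ i ∈ T.whites, f i = f' i) : T.eval M f = T.eval M f' := by
  induction T with
  | leg a => rfl
  | white i ch ih =>
    have e : (fun x => (ch x).eval M f) = fun x => (ch x).eval M f' := funext fun x =>
      ih x fun j hj => h j (List.mem_cons_of_mem _ (mem_catLists.2 ⟨x, hj⟩))
    simp only [eval, e, h i (List.mem_cons_self ..)]
  | black n ch ih =>
    have e : (fun x => (ch x).eval M f) = fun x => (ch x).eval M f' := funext fun x =>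
      ih x fun j hj => h j (mem_catLists.2 ⟨x, hj⟩)
    simp only [eval, e]
  | special => rfl

/-- A scalar multiple of a decoration contributes as many times as its label occurs. -/
theorem eval_zsmul (f : ∀ i, tensorPow M (k i) ⟶ M) (c : I → ℤ) (T : RawTree l k) :
    T.eval M (fun i => c i • f i) = (T.whites.map c).prod • T.eval M f := by
  have key : ∀ {n : ℕ} (ch : Fin n → RawTree l k) {X : C} (g : tensorPow M n ⟶ X) (b : ℤ),
      (∀ x, (ch x).eval M (fun i => c i • f i) = ((ch x).whites.map c).prod • (ch x).eval M f) →
      blockTensor M n _ (fun x => (ch x).eval M (fun i => c i • f i)) ≫ (b • g) =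
        (b * ((catLists n (fun x => (ch x).whites)).map c).prod) •
          blockTensor M n _ (fun x => (ch x).eval M f) ≫ g := by
    intro n ch X g b h
    simp only [h]
    rw [blockTensor_zsmul (fun x => ((ch x).whites.map c).prod) (fun x => (ch x).eval M f),
      prod_map_catLists, Preadditive.zsmul_comp, Preadditive.comp_zsmul, mul_comm, mul_zsmul]
  induction T with
  | leg a => exact (one_zsmul _).symm
  | white i ch ih =>
    simp only [eval, whites, List.map_cons, List.prod_cons]
    exact key ch _ _ ih
  | black n ch ih =>
    have h := key ch (iterMul M n) 1 ih
    rw [one_zsmul, one_mul] at h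
    exact h
  | special => exact (one_zsmul _).symm

/-- The operation of a tree is additive in a decoration whose label occurs exactly once. -/
theorem eval_add [DecidableEq I] {f f' f'' : ∀ i, tensorPow M (k i) ⟶ M} (i : I)
    (h : f i = f' i + f'' i) (h' : ∀ j ≠ i, f' j = f j) (h'' : ∀ j ≠ i, f'' j = f j)
    (T : RawTree l k) (hT : T.whites.count i = 1) :
    T.eval M f = T.eval M f' + T.eval M f'' := by
  have hch : ∀ {n : ℕ} (ch : Fin n → RawTree l k),
      (∀ x, (ch x).whites.count i = 1 →
        (ch x).eval M f = (ch x).eval M f' + (ch x).eval M f'') →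
      (catLists n (fun x => (ch x).whites)).count i = 1 →
      blockTensor M n _ (fun x => (ch x).eval M f) = blockTensor M n _ (fun x => (ch x).eval M f') +
        blockTensor M n _ (fun x => (ch x).eval M f'') := by
    intro n ch ih hc
    rw [count_catLists] at hc
    obtain ⟨x₀, -, hx₀⟩ := Finset.exists_ne_zero_of_sum_ne_zero (by rw [hc]; exact one_ne_zero)
    rw [← Finset.add_sum_erase _ _ (Finset.mem_univ x₀)] at hc
    have hs : ∀ x ≠ x₀, (ch x).whites.count i = 0 := by
      intro x hx
      have := Finset.sum_eq_zero_iff.1 (by omega : ∑ x ∈ Finset.univ.erase x₀,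
        (ch x).whites.count i = 0) x (Finset.mem_erase.2 ⟨hx, Finset.mem_univ x⟩)
      exact this
    have hs' : ∀ x ≠ x₀, ∀ j ∈ (ch x).whites, j ≠ i := by
      rintro x hx j hj rfl
      exact List.count_eq_zero.1 (hs x hx) hj
    exact blockTensor_add x₀ (ih x₀ (by omega))
      (fun x hx => eval_congr _ fun j hj => h' j (hs' x hx j hj))
      (fun x hx => eval_congr _ fun j hj => h'' j (hs' x hx j hj))
  induction T with
  | leg a => simp [whites] at hT
  | white j ch ih =>
    by_cases hj : j = i
    · subst hj
      have hi : j ∉ catLists (k j) (fun x => (ch x).whites) := by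
        rw [← List.count_eq_zero]
        simpa [whites] using hT
      have hs : ∀ x, ∀ a ∈ (ch x).whites, a ≠ j := by
        rintro x a ha rfl
        exact hi (mem_catLists.2 ⟨x, ha⟩)
      have e' : (fun x => (ch x).eval M f') = fun x => (ch x).eval M f :=
        funext fun x => eval_congr _ fun a ha => h' a (hs x a ha)
      have e'' : (fun x => (ch x).eval M f'') = fun x => (ch x).eval M f :=
        funext fun x => eval_congr _ fun a ha => h'' a (hs x a ha)
      simp only [eval, e', e'', h]
      exact Preadditive.comp_add _ _ _ _ _ _
    · have hc := hch ch ih (by simpa [whites, List.count_cons, hj] using hT)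
      simp only [eval, hc, h' j hj, h'' j hj]
      exact Preadditive.add_comp _ _ _ _ _ _
  | black n ch ih =>
    simp only [eval, hch ch ih hT]
    exact Preadditive.add_comp _ _ _ _ _ _
  | special => simp [whites] at hT

end RawTree

end Multilinearity

open scoped Obj in
/-- The family of multilinear operations represented by a tree. -/
def OpTree.natFamily {l : ℕ} {I : Type} {k : I → ℕ} (T : OpTree l k) : NatFamily.{u, v} l k :=
  ⟨fun X =>
    have hadd : ∀ [DecidableEq I] (f : ∀ i, X.End (k i)) (i : I) (g g' : X.End (k i)),
        T.act X (Function.update f i (g + g')) =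
          T.act X (Function.update f i g) + T.act X (Function.update f i g') := by
      intro _ f i g g'
      have h := T.1.eval_add (M := X.M) i (f := Function.update f i (g + g'))
        (f' := Function.update f i g) (f'' := Function.update f i g') (by simp)
        (fun j hj => by simp [hj]) (fun j hj => by simp [hj])
        (((RawTree.isOpTree_iff T.1).1 T.2).2.2 i)
      simp only [OpTree.act_eq, RawTree.operation, h]
      exact Preadditive.comp_add _ _ _ _ _ _
    { toFun := T.act X
      map_update_add' := hadd
      map_update_smul' := fun f i c g =>
        map_zsmul (AddMonoidHom.mk' (fun g => T.act X (Function.update f i g)) (hadd f i)) c g },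
    fun X Y φ f => by
      have := φ.isMonHom
      simp only [SymCat.Hom.map_eq]
      change mapEnd _ _ _ (T.act X f) = T.act Y _
      rw [OpTree.act_eq, OpTree.act_eq, RawTree.mapEnd_operation]⟩

/-! ### Monoid rings as distinguished monoids -/

section Model

open TensorProduct

variable {R : Type} [CommRing R] {G : Type} [Monoid G]

/-- The permutation `deleteZero σ` is `σ` on the remaining positions, which are numbered anew. -/
theorem succAbove_deleteZero {m n : ℕ} (σ : Fin (m + 1) ≃ Fin (n + 1)) (i : Fin m) :
    (σ 0).succAbove (deleteZero σ i) = σ i.succ := by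
  have h : finSuccAboveEquiv (σ 0) (deleteZero σ i) = ⟨σ i.succ, fun e =>
      Fin.succ_ne_zero i (σ.injective e)⟩ := by
    simp only [deleteZero, Equiv.trans_apply, Equiv.apply_symm_apply]
    ext1
    simp [finSuccAboveEquiv]
  exact congrArg Subtype.val h

/-- The monoid ring of `G`, as a module. -/
noncomputable abbrev monoidRing (R G : Type) [CommRing R] [Monoid G] : ModuleCat.{0} R :=
  ModuleCat.of R (MonoidAlgebra R G)

noncomputable instance : MonObj (monoidRing R G) :=
  ModuleCat.MonModuleEquivalenceAlgebra.inverseObj (AlgCat.of R (MonoidAlgebra R G))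

/-- The pair given by a monoid ring in the category of modules. -/
noncomputable def ringPair (R G : Type) [CommRing R] [Monoid G] : SymCat.{1, 0} where
  V := ModuleCat.{0} R
  M := monoidRing R G

/-- The tensor product of group-like elements of the monoid ring. -/
noncomputable def pureTensor : (n : ℕ) → (Fin n → G) → (tensorPow (monoidRing R G) n : ModuleCat R)
  | 0, _ => (1 : R)
  | n + 1, a => (MonoidAlgebra.single (a 0) (1 : R) : MonoidAlgebra R G) ⊗ₜ[R]
      pureTensor n (fun i => a i.succ)

/-- The linear map on the monoid ring with given values on group-like elements. -/
noncomputable def liftRing {P : Type} [AddCommMonoid P] [Module R P] (F : G → P) :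
    MonoidAlgebra R G →ₗ[R] P where
  toFun x := Finsupp.linearCombination R F x.coeff
  map_add' x y := by rw [MonoidAlgebra.coeff_add, map_add]
  map_smul' c x := by rw [MonoidAlgebra.coeff_smul, map_smul]; rfl

omit [Monoid G] in
theorem liftRing_single {P : Type} [AddCommMonoid P] [Module R P] (F : G → P) (g : G) :
    liftRing F (MonoidAlgebra.single g (1 : R)) = F g := by
  simp [liftRing]

/-- Arbitrary values on tensor products of group-like elements extend to a linear map. -/
theorem exists_hom (n : ℕ) (P : ModuleCat.{0} R) (φ : (Fin n → G) → P) :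
    ∃ f : tensorPow (monoidRing R G) n ⟶ P, ∀ a, f (pureTensor n a) = φ a := by
  induction n with
  | zero =>
    refine ⟨ModuleCat.ofHom (LinearMap.toSpanSingleton R P (φ Fin.elim0)), fun a => ?_⟩
    rw [Subsingleton.elim a Fin.elim0]
    exact (LinearMap.toSpanSingleton_apply R P (φ Fin.elim0) 1).trans (one_smul R _)
  | succ n ih =>
    choose f hf using fun g : G => ih (fun a => φ (Fin.cons g a))
    refine ⟨ModuleCat.ofHom (TensorProduct.lift (liftRing (fun g => (f g).hom))), fun a => ?_⟩
    refine (TensorProduct.lift.tmul _ _).trans ?_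
    rw [liftRing_single]
    exact (hf _ _).trans (congrArg φ (Fin.cons_self_tail a))

/-- The tensor product of group-like elements which are indexed by the entries of a list. -/
noncomputable abbrev pureList {α : Type} (a : α → G) (L : List α) :
    (tensorPow (monoidRing R G) L.length : ModuleCat R) :=
  pureTensor L.length (fun i => a (L.get i))

theorem splitPow_pureList {α : Type} (a : α → G) (L L' : List α) :
    splitPow (monoidRing R G) L L' (pureList a (L ++ L')) = pureList a L ⊗ₜ[R] pureList a L' := by
  induction L with
  | nil =>
    rw [splitPow_nil]
    exact ModuleCat.MonoidalCategory.leftUnitor_inv_apply _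
  | cons x L ih =>
    rw [splitPow_cons]
    have key : ∀ {X Y Z : ModuleCat.{0} R} (s : X ⟶ Y ⊗ Z) (m : monoidRing R G) (x : X) (y : Y)
        (z : Z), s x = y ⊗ₜ[R] z →
        (monoidRing R G ◁ s ≫ (α_ (monoidRing R G) Y Z).inv) (m ⊗ₜ[R] x) = (m ⊗ₜ[R] y) ⊗ₜ[R] z := by
      intro X Y Z s m x y z h
      rw [ModuleCat.comp_apply, ModuleCat.MonoidalCategory.whiskerLeft_apply, h]
      rfl
    exact key _ _ _ _ _ ih

theorem blockTensor_pureList {α : Type} (a : α → G) {n : ℕ} (L : Fin n → List α)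
    (w : ∀ x, tensorPow (monoidRing R G) (L x).length ⟶ monoidRing R G) (b : Fin n → G)
    (h : ∀ x, w x (pureList a (L x)) = (MonoidAlgebra.single (b x) 1 : MonoidAlgebra R G)) :
    blockTensor (monoidRing R G) n L w (pureList a (catLists n L)) = pureTensor n b := by
  induction n with
  | zero => rfl
  | succ n ih =>
    have key : ∀ {X Y Z A B : ModuleCat.{0} R} (s : X ⟶ Y ⊗ Z) (g : Y ⟶ A) (g' : Z ⟶ B) (x : X)
        (y : Y) (z : Z), s x = y ⊗ₜ[R] z → (s ≫ (g ⊗ₘ g')) x = g y ⊗ₜ[R] g' z := by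
      intro X Y Z A B s g g' x y z h
      rw [ModuleCat.comp_apply, h]
      rfl
    refine (key _ _ _ _ _ _ (splitPow_pureList a (L 0) _)).trans ?_
    rw [h 0, ih (fun x => L x.succ) (fun x => w x.succ) (fun x => b x.succ) fun x => h x.succ]
    rfl

theorem iterMul_pureTensor (n : ℕ) (b : Fin n → G) :
    iterMul (monoidRing R G) n (pureTensor n b) =
      (MonoidAlgebra.single (List.ofFn b).prod 1 : MonoidAlgebra R G) := by
  induction n with
  | zero => exact (map_one (algebraMap R (MonoidAlgebra R G)))
  | succ n ih =>
    have key : ∀ {X : ModuleCat.{0} R} (s : X ⟶ monoidRing R G) (m y : MonoidAlgebra R G) (x : X),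
        s x = y → (monoidRing R G ◁ s ≫ MonObj.mul) (m ⊗ₜ[R] x) = m * y := by
      rintro X s m _ x rfl
      rfl
    refine (key _ _ _ _ (ih _)).trans ?_
    rw [MonoidAlgebra.single_mul_single, List.ofFn_succ, List.prod_cons, mul_one]

theorem moveFront_pureTensor (n : ℕ) (j : Fin (n + 1)) (b : Fin (n + 1) → G) :
    moveFront (monoidRing R G) n j (pureTensor (n + 1) b) =
      (MonoidAlgebra.single (b j) 1 : MonoidAlgebra R G) ⊗ₜ[R]
        pureTensor n (fun i => b (j.succAbove i)) := by
  induction n with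
  | zero => obtain rfl : j = 0 := Fin.fin_one_eq_zero j; rfl
  | succ n ih =>
    induction j using Fin.cases with
    | zero => rfl
    | succ j =>
      have key : ∀ {X : ModuleCat.{0} R} (Y : ModuleCat.{0} R) (s : X ⟶ monoidRing R G ⊗ Y)
          (m m' : MonoidAlgebra R G) (x : X) (y : Y), s x = m' ⊗ₜ[R] y →
          (monoidRing R G ◁ s ≫ swapFront (monoidRing R G) Y) (m ⊗ₜ[R] x) =
            m' ⊗ₜ[R] (m ⊗ₜ[R] y) := by
        intro X Y s m m' x y h
        rw [ModuleCat.comp_apply, ModuleCat.MonoidalCategory.whiskerLeft_apply, h]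
        rfl
      rw [moveFront_succ]
      refine (key _ _ _ _ _ _ (ih j fun i => b i.succ)).trans ?_
      simp only [← Fin.succ_succAbove_succ]
      rfl

theorem permute_pureTensor (m n : ℕ) (σ : Fin m ≃ Fin n) (b : Fin n → G) :
    permute (monoidRing R G) m n σ (pureTensor n b) = pureTensor m (fun i => b (σ i)) := by
  induction m generalizing n with
  | zero =>
    cases n with
    | zero => rfl
    | succ n => exact (σ.symm 0).elim0
  | succ m ih =>
    cases n with
    | zero => exact (σ 0).elim0
    | succ n =>
      have key : ∀ {X Y Z : ModuleCat.{0} R} (s : X ⟶ monoidRing R G ⊗ Y) (t : Y ⟶ Z) (x : X)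
          (m : MonoidAlgebra R G) (y : Y) (z : Z), s x = m ⊗ₜ[R] y → t y = z →
          (s ≫ monoidRing R G ◁ t) x = m ⊗ₜ[R] z := by
        rintro X Y Z s t x m y _ h rfl
        rw [ModuleCat.comp_apply, h]
        rfl
      refine (key _ _ _ _ _ _ (moveFront_pureTensor n (σ 0) b) (ih _ (deleteZero σ) _)).trans ?_
      simp only [succAbove_deleteZero]
      rfl

namespace RawTree

variable {l : ℕ} {I : Type} {k : I → ℕ}

theorem operation_pureTensor (φ : ∀ i, (Fin (k i) → G) → G)
    (f : ∀ i, tensorPow (monoidRing R G) (k i) ⟶ monoidRing R G)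
    (hf : ∀ i a, f i (pureTensor (k i) a) = (MonoidAlgebra.single (φ i a) 1 : MonoidAlgebra R G))
    (T : RawTree l k) (h : IsEnum T.legs) (a : Fin l → G) :
    T.operation (monoidRing R G) f h (pureTensor l a) =
      (MonoidAlgebra.single (T.interp φ a) 1 : MonoidAlgebra R G) := by
  have key : ∀ T : RawTree l k, T.eval (monoidRing R G) f (pureList a T.legs) =
      (MonoidAlgebra.single (T.interp φ a) 1 : MonoidAlgebra R G) := by
    intro T
    induction T with
    | leg x => exact (ModuleCat.MonoidalCategory.rightUnitor_hom_apply _ _).trans (one_smul R _)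
    | white i ch ih =>
      have e := blockTensor_pureList a (fun x => (ch x).legs) _ _ ih
      exact (congrArg (f i) e).trans (hf i _)
    | black n ch ih =>
      have e := blockTensor_pureList a (fun x => (ch x).legs) _ _ ih
      exact (congrArg (iterMul (monoidRing R G) n) e).trans (iterMul_pureTensor n _)
    | special => exact iterMul_pureTensor 0 Fin.elim0
  refine Eq.trans ?_ (key T)
  exact congrArg (T.eval (monoidRing R G) f) (permute_pureTensor _ _ h.equiv a)

theorem black_get {n : ℕ} (ch : Fin n → RawTree l k) (L : List (RawTree l k))
    (h : L = List.ofFn ch) : black L.length L.get = black n ch := by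
  subst h
  have key : ∀ (m : ℕ) (h : m = n) (ch' : Fin m → RawTree l k),
      (∀ i, ch' i = ch (i.cast h)) → black m ch' = black n ch := by
    rintro m rfl ch' h'
    exact congrArg (black m) (funext h')
  exact key _ (List.length_ofFn ..) _ (fun i => by simp; rfl)

theorem joinFactors_factors (T : RawTree l k) (hT : T.IsReduced) : joinFactors T.factors = T := by
  cases T with
  | leg a => rfl
  | white i ch => rfl
  | special => rfl
  | black n ch =>
    obtain ⟨n, rfl⟩ := Nat.exists_eq_add_of_le hT.1
    have h : ∀ L : List (RawTree l k), 2 ≤ L.length → joinFactors L = black L.length L.get := by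
      intro L hL
      match L, hL with
      | S :: T :: L, _ => rfl
    exact (h _ (by simp [factors])).trans (black_get ch _ rfl)

/-- In the free monoid on all trees, with the operations given by white vertices, a reduced tree is
interpreted by the list of its factors. Therefore the interpretations in monoids separate reduced
trees. -/
theorem interp_freeMonoid (T : RawTree l k) (hT : T.IsReduced) :
    T.interp (G := FreeMonoid (RawTree l k))
      (fun i b => FreeMonoid.of (white i (fun x => joinFactors (FreeMonoid.toList (b x)))))
      (fun x => FreeMonoid.of (leg x)) = FreeMonoid.ofList T.factors := by
  induction T with
  | leg x => rfl
  | white i ch ih =>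
    simp only [interp, ih _ (hT _), FreeMonoid.toList_ofList, joinFactors_factors _ (hT _)]
    rfl
  | black n ch ih =>
    have h : ∀ x, (ch x).interp (G := FreeMonoid (RawTree l k))
        (fun i b => FreeMonoid.of (white i (fun x => joinFactors (FreeMonoid.toList (b x)))))
        (fun x => FreeMonoid.of (leg x)) = FreeMonoid.of (ch x) := by
      intro x
      rw [ih x (hT.2 x).2]
      have := (hT.2 x).1
      revert this
      cases ch x with
      | leg a => exact fun _ => rfl
      | white i ch => exact fun _ => rfl
      | black n ch => exact fun h => (h trivial).elim
      | special => exact fun h => (h trivial).elim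
    simp only [interp, h, factors]
    rw [← FreeMonoid.ofList_toList (List.ofFn fun x => FreeMonoid.of (ch x)).prod,
      FreeMonoid.toList_prod]
    congr 1
    have e : ((List.ofFn ch).map fun T => [T]).flatten = List.ofFn ch := by
      rw [← List.flatMap_def]
      simp
    rw [List.map_ofFn] at e ⊢
    exact e
  | special => rfl

end RawTree

end Model

/-! ### Trees and natural families -/

section Comparison

open FreeHom
open scoped Obj

variable {l : ℕ} {I : Type} {k : I → ℕ}

theorem RawTree.operation_congr {C : Type u} [Category.{v} C] [MonoidalCategory C]
    [SymmetricCategory C] {M : C} [MonObj M] (f : ∀ i, tensorPow M (k i) ⟶ M) {T T' : RawTree l k}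
    (e : (⟨T.legs, T.eval M f⟩ : LabelledMap (Fin l) M) = ⟨T'.legs, T'.eval M f⟩)
    (h : IsEnum T.legs) (h' : IsEnum T'.legs) : T.operation M f h = T'.operation M f h' := by
  have key : ∀ x y : LabelledMap (Fin l) M, x = y → ∀ (hx : IsEnum x.labels)
      (hy : IsEnum y.labels), permute M _ _ hx.equiv ≫ x.hom = permute M _ _ hy.equiv ≫ y.hom := by
    rintro x _ rfl _ _
    rfl
  exact key _ _ e h h'

/-- Reduced trees with legs labelled bijectively; the labels of the white vertices may be repeated
or missing. -/
def LegTree (l : ℕ) (k : I → ℕ) : Type := {T : RawTree l k // T.IsReduced ∧ IsEnum T.legs}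

theorem treeMaps_subset_range {C : Type u} [Category.{v} C] [MonoidalCategory C]
    [SymmetricCategory C] {M : C} [MonObj M] (f : ∀ i, tensorPow M (k i) ⟶ M) :
    treeMaps f l ⊆ Set.range fun T : LegTree l k => T.1.operation M f T.2.2 := by
  rintro _ ⟨T, h, rfl⟩
  have e := T.eval_reduce M f
  have hl : T.reduce.legs = T.legs := congrArg LabelledMap.labels e
  have h' : IsEnum T.reduce.legs := hl.symm ▸ h
  exact ⟨⟨T.reduce, T.isReduced_reduce, h'⟩, RawTree.operation_congr f e h' h⟩

/-- The monoid in which trees are interpreted by lists of trees. -/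
abbrev TreeMonoid (l : ℕ) (k : I → ℕ) : Type := FreeMonoid (RawTree l k)

/-- The operation on lists of trees given by a white vertex. -/
def whiteOp (i : I) (b : Fin (k i) → TreeMonoid l k) : TreeMonoid l k :=
  FreeMonoid.of (.white i fun x => RawTree.joinFactors (FreeMonoid.toList (b x)))

/-- The linear extension of `whiteOp` to the monoid ring. -/
noncomputable def whiteHom (l : ℕ) (k : I → ℕ) (i : I) :
    tensorPow (monoidRing ℤ (TreeMonoid l k)) (k i) ⟶ monoidRing ℤ (TreeMonoid l k) :=
  (exists_hom (k i) (monoidRing ℤ (TreeMonoid l k))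
    (fun b => (MonoidAlgebra.single (whiteOp i b) 1 : MonoidAlgebra ℤ _))).choose

theorem whiteHom_pureTensor (i : I) (b : Fin (k i) → TreeMonoid l k) :
    whiteHom l k i (pureTensor (k i) b) =
      (MonoidAlgebra.single (whiteOp i b) 1 : MonoidAlgebra ℤ (TreeMonoid l k)) :=
  (exists_hom (k i) (monoidRing ℤ (TreeMonoid l k))
    (fun b => (MonoidAlgebra.single (whiteOp i b) 1 : MonoidAlgebra ℤ _))).choose_spec b

theorem respects_whiteHom : Respects.{u, v} (monoidRing ℤ (TreeMonoid l k)) (whiteHom l k) :=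
  respects_right (ringPair ℤ (TreeMonoid l k)) (whiteHom l k)

/-- The map induced by evaluation of the universal pair in the monoid ring of lists of trees. -/
noncomputable def treeEval (l : ℕ) (k : I → ℕ) (n : ℕ) (g : (freePair.{u, v} k).End n) :
    tensorPow (monoidRing ℤ (TreeMonoid l k)) n ⟶ monoidRing ℤ (TreeMonoid l k) :=
  mapEnd (evalFunctor respects_whiteHom) (evalIso respects_whiteHom) n g

/-- The value of an element of the universal pair on group-like elements. -/
noncomputable def treeValue {n : ℕ} (g : (freePair.{u, v} k).End n)
    (a : Fin n → TreeMonoid l k) : MonoidAlgebra ℤ (TreeMonoid l k) :=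
  treeEval l k n g (pureTensor n a)

theorem treeValue_add {n : ℕ} (g g' : (freePair.{u, v} k).End n) (a : Fin n → TreeMonoid l k) :
    treeValue (g + g') a = treeValue g a + treeValue g' a := by
  have h : treeEval l k n (g + g') = treeEval l k n g + treeEval l k n g' := mapEnd_add _ _ n g g'
  rw [treeValue, h]
  rfl

/-- An element of the universal pair takes group-like elements to group-like elements, as
prescribed by `φ`. -/
def Represents {n : ℕ} (g : (freePair.{u, v} k).End n)
    (φ : (Fin n → TreeMonoid l k) → TreeMonoid l k) : Prop :=
  ∀ a, treeValue g a = MonoidAlgebra.single (φ a) 1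

theorem represents_freeGen (i : I) : Represents (l := l) (freeGen.{u, v} k i) (whiteOp i) := by
  intro a
  have h : treeEval l k (k i) (freeGen.{u, v} k i) = whiteHom l k i := mapEnd_freeGen _ i
  rw [treeValue, h]
  exact whiteHom_pureTensor i a

theorem represents_operation {J : Type} {m : J → ℕ} {n : ℕ} (T : RawTree n m) (h : IsEnum T.legs)
    {g : ∀ j, (freePair.{u, v} k).End (m j)}
    {φ : ∀ j, (Fin (m j) → TreeMonoid l k) → TreeMonoid l k} (hg : ∀ j, Represents (g j) (φ j)) :
    Represents (T.operation (freePair.{u, v} k).M g h) (T.interp φ) := by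
  intro a
  have e : treeEval l k n (T.operation (freePair.{u, v} k).M g h) =
      T.operation (monoidRing ℤ (TreeMonoid l k)) (fun j => treeEval l k (m j) (g j)) h :=
    T.mapEnd_operation _ _ g h
  rw [treeValue, e]
  exact T.operation_pureTensor φ _ hg h a

/-- The coefficient of a reduced tree in an operation of the universal pair. -/
noncomputable def treeCoeff (T : RawTree l k) : (freePair.{u, v} k).End l →+ ℤ :=
  AddMonoidHom.mk' (fun g => (treeValue g fun x => FreeMonoid.of (.leg x)).coeff
    (FreeMonoid.ofList T.factors)) (by
    intro g g'
    rw [treeValue_add]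
    rfl)

open Classical in
theorem treeCoeff_eq (T₀ : RawTree l k) {g : (freePair.{u, v} k).End l}
    {φ : (Fin l → TreeMonoid l k) → TreeMonoid l k} (hg : Represents g φ) :
    treeCoeff T₀ g =
      if φ (fun x => FreeMonoid.of (.leg x)) = FreeMonoid.ofList T₀.factors then 1 else 0 := by
  have h := hg fun x => FreeMonoid.of (.leg x)
  simp only [treeCoeff, AddMonoidHom.mk'_apply, h, MonoidAlgebra.coeff_single, Finsupp.single_apply]

open Classical in
theorem treeCoeff_operation (T₀ T : LegTree l k) :
    treeCoeff T₀.1 (T.1.operation (freePair.{u, v} k).M (freeGen k) T.2.2) =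
      if T = T₀ then 1 else 0 := by
  rw [treeCoeff_eq T₀.1 (represents_operation T.1 T.2.2 represents_freeGen)]
  have e : T.1.interp (G := TreeMonoid l k) whiteOp (fun x => FreeMonoid.of (.leg x)) =
      FreeMonoid.ofList T.1.factors := T.1.interp_freeMonoid T.2.1
  rw [e]
  congr 1
  refine propext ⟨fun h => Subtype.ext ?_, fun h => h ▸ rfl⟩
  rw [← T.1.joinFactors_factors T.2.1, ← T₀.1.joinFactors_factors T₀.2.1]
  exact congrArg RawTree.joinFactors h

/-- The trees of the operad as special cases of trees with arbitrarily labelled white vertices. -/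
def OpTree.toLegTree (T : OpTree l k) : LegTree l k :=
  ⟨T.1, T.2.reduced, T.2.legs_nodup, T.2.mem_legs⟩

theorem OpTree.toLegTree_injective : Function.Injective (OpTree.toLegTree (l := l) (k := k)) :=
  fun _ _ h => Subtype.ext (congrArg (fun T : LegTree l k => T.1) h)

/-- The homomorphism which sends a tree to the natural family of operations it represents. -/
noncomputable def treeHom (l : ℕ) (k : I → ℕ) : (OpTree l k →₀ ℤ) →+ NatFamily.{u, v} l k :=
  Finsupp.liftAddHom fun T => zmultiplesHom _ T.natFamily

theorem treeHom_single (T : OpTree l k) (n : ℤ) :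
    treeHom.{u, v} l k (Finsupp.single T n) = n • T.natFamily := by
  simp [treeHom]

/-- Evaluation of natural families. -/
def NatFamily.appHom (X : SymCat.{u, v}) (f : ∀ i, X.End (k i)) : NatFamily.{u, v} l k →+ X.End l :=
  AddMonoidHom.mk' (fun α => NatFamily.app α X f) fun _ _ => rfl

theorem treeCoeff_treeHom (T : OpTree l k) (x : OpTree l k →₀ ℤ) :
    treeCoeff T.1 (NatFamily.appHom (freePair.{u, v} k) (freeGen k) (treeHom l k x)) = x T := by
  classical
  have h : ((treeCoeff T.1).comp ((NatFamily.appHom (freePair.{u, v} k) (freeGen k)).comp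
      (treeHom l k))) = Finsupp.applyAddHom T := by
    refine Finsupp.addHom_ext fun S n => ?_
    simp only [AddMonoidHom.comp_apply, treeHom_single, map_zsmul]
    have e : NatFamily.appHom (freePair.{u, v} k) (freeGen k) S.natFamily =
      S.1.operation (freePair.{u, v} k).M (freeGen k) S.toLegTree.2.2 :=
      S.act_eq (freePair.{u, v} k) (freeGen k)
    rw [e]
    have e' := treeCoeff_operation.{u, v} T.toLegTree S.toLegTree
    refine (congrArg (n • ·) e').trans ?_
    simp [Finsupp.single_apply, OpTree.toLegTree_injective.eq_iff]
  exact DFunLike.congr_fun h x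

theorem treeHom_injective : Function.Injective (treeHom.{u, v} l k) := by
  intro x y h
  ext T
  rw [← treeCoeff_treeHom.{u, v} T x, ← treeCoeff_treeHom.{u, v} T y, h]

/-- A natural family is determined by its value on the universal arguments, which is a linear
combination of trees. -/
theorem NatFamily.exists_eq_sum (α : NatFamily.{u, v} l k) :
    ∃ c : LegTree l k →₀ ℤ, ∀ (X : SymCat.{u, v}) (f : ∀ i, X.End (k i)),
      NatFamily.app α X f = c.sum fun T n => n • T.1.operation X.M f T.2.2 := by
  have hmap : ∀ (X : SymCat.{u, v}) (f : ∀ i, X.End (k i)),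
      (freeHom X f).map l (NatFamily.app α (freePair k) (freeGen k)) = NatFamily.app α X f := by
    intro X f
    refine (α.2 _ _ (freeHom X f) (freeGen k)).trans (congrArg (α.1 X) (funext fun i => ?_))
    exact freeHom_map_freeGen X f i
  have hw : NatFamily.app α (freePair k) (freeGen k) ∈
      AddSubgroup.closure (treeMaps (freeGen.{u, v} k) l) := by
    -- The value is its own image under evaluation of the universal pair in itself.
    rw [← hmap, SymCat.Hom.map_eq]
    exact mapEnd_evalFunctor_mem _ l _
  have hw' := AddSubgroup.closure_mono (treeMaps_subset_range (freeGen.{u, v} k)) hw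
  rw [← Submodule.span_int_eq_addSubgroupClosure, Submodule.mem_toAddSubgroup,
    Finsupp.mem_span_range_iff_exists_finsupp] at hw'
  obtain ⟨c, hc⟩ := hw'
  refine ⟨c, fun X f => ?_⟩
  rw [← hmap, ← hc]
  let ψ : (freePair.{u, v} k).End l →+ X.End l :=
    AddMonoidHom.mk' ((freeHom X f).map l) ((freeHom X f).map_add l)
  refine (map_finsuppSum ψ c _).trans (Finsupp.sum_congr fun T _ => ?_)
  rw [map_zsmul]
  congr 1
  have := (freeHom X f).isMonHom
  refine ((freeHom X f).map_eq l _).trans ?_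
  rw [RawTree.mapEnd_operation]
  congr 1
  funext i
  rw [← SymCat.Hom.map_eq, freeHom_map_freeGen]

/-- Scaling the argument with index `i` scales the operation of a tree by a power whose exponent is
the number of white vertices labelled `i`. -/
theorem RawTree.operation_zsmul [DecidableEq I] (X : SymCat.{u, v}) (f : ∀ i, X.End (k i)) (i : I)
    (c : ℤ) (T : RawTree l k) (h : IsEnum T.legs) :
    T.operation X.M (Function.update f i (c • f i)) h =
      (c ^ T.whites.count i) • T.operation X.M f h := by
  have e : Function.update f i (c • f i) = fun j => (if j = i then c else 1) • f j := by
    funext j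
    by_cases hj : j = i
    · subst hj; simp
    · simp [hj]
  have e' : (T.whites.map fun j => if j = i then c else 1).prod = c ^ T.whites.count i := by
    induction T.whites with
    | nil => simp
    | cons j L ih =>
      by_cases hj : j = i
      · simp [ih, hj, pow_succ']
      · simp [ih, hj]
  have h' := T.eval_zsmul (M := X.M) f fun j => if j = i then c else 1
  simp only [operation, e, h', e']
  exact Preadditive.comp_zsmul _ _ _

/-- Multilinearity excludes trees in which the label of a white vertex is repeated or missing:
multiplying the argument with index `i` by `2` multiplies the operation of a tree with `c` white
vertices labelled `i` by `2 ^ c`. -/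
theorem treeHom_surjective : Function.Surjective (treeHom.{u, v} l k) := by
  classical
  intro α
  obtain ⟨c, hc⟩ := NatFamily.exists_eq_sum α
  have hcount : ∀ T ∈ c.support, ∀ i, T.1.whites.count i = 1 := by
    intro T₀ hT₀ i
    have h₁ := hc (freePair k) (Function.update (freeGen k) i ((2 : ℤ) • freeGen k i))
    have h₂ : NatFamily.app α (freePair k) (Function.update (freeGen k) i ((2 : ℤ) • freeGen k i)) =
        (2 : ℤ) • NatFamily.app α (freePair k) (freeGen k) := by
      rw [NatFamily.app, MultilinearMap.map_update_smul, Function.update_eq_self]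
    rw [h₂, hc] at h₁
    have h₃ := congrArg (treeCoeff T₀.1) h₁
    simp only [map_zsmul, map_finsuppSum, RawTree.operation_zsmul, treeCoeff_operation] at h₃
    simp only [Finsupp.sum, smul_eq_mul, mul_ite, mul_one, mul_zero, Finset.sum_ite_eq', hT₀,
      if_true] at h₃
    have h₄ : (2 : ℤ) = 2 ^ T₀.1.whites.count i :=
      mul_left_cancel₀ (Finsupp.mem_support_iff.1 hT₀) ((mul_comm _ _).trans h₃)
    have h₅ : (2 : ℕ) ^ 1 = 2 ^ T₀.1.whites.count i := by exact_mod_cast h₄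
    exact (Nat.pow_right_injective le_rfl h₅).symm
  have hop : ∀ T ∈ c.support, T.1.IsOpTree := fun T hT =>
    ⟨T.2.1, T.2.2.nodup, T.2.2.mem, List.nodup_iff_count_le_one.2 fun i => (hcount T hT i).le,
      fun i => List.count_pos_iff.1 (by rw [hcount T hT i]; exact one_pos)⟩
  refine ⟨∑ T ∈ c.support.attach, Finsupp.single ⟨T.1.1, hop T.1 T.2⟩ (c T.1), ?_⟩
  refine Subtype.ext (funext fun X => MultilinearMap.ext fun f => ?_)
  refine Eq.trans ?_ (hc X f).symm
  refine (map_sum ((NatFamily.appHom X f).comp (treeHom l k)) _ _).trans ?_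
  refine Eq.trans ?_ (Finset.sum_attach c.support fun T => c T • T.1.operation X.M f T.2.2)
  refine Finset.sum_congr rfl fun T _ => ?_
  refine (congrArg (NatFamily.appHom X f) (treeHom_single _ _)).trans ((map_zsmul _ _ _).trans ?_)
  exact congrArg (c T.1 • ·) (OpTree.act_eq ⟨T.1.1, hop T.1 T.2⟩ X f)

/-- A natural family is determined by the map by which its value on the universal arguments acts on
lists of trees, since this map determines all coefficients of trees. -/
theorem NatFamily.eq_of_represents {α β : NatFamily.{u, v} l k}
    {φ : (Fin l → TreeMonoid l k) → TreeMonoid l k}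
    (hα : Represents (NatFamily.app α (freePair k) (freeGen k)) φ)
    (hβ : Represents (NatFamily.app β (freePair k) (freeGen k)) φ) : α = β := by
  classical
  obtain ⟨x, rfl⟩ := treeHom_surjective α
  obtain ⟨y, rfl⟩ := treeHom_surjective β
  congr 1
  ext T
  rw [← treeCoeff_treeHom.{u, v} T x, ← treeCoeff_treeHom.{u, v} T y]
  exact (treeCoeff_eq T.1 hα).trans (treeCoeff_eq T.1 hβ).symm

end Comparison

/-! ### The isomorphism of operads -/

section Operads

namespace OperadData

/-- The axioms of an operad are inherited along an isomorphism. -/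
theorem IsOperad.of_iso {C : Type} {P : OperadData.{w₁} C} {Q : OperadData.{w₂} C} (Φ : Iso P Q)
    (hQ : Q.IsOperad) : P.IsOperad where
  relabel_add e k f g := by
    apply (Φ.equiv _ _).injective
    simp only [Φ.map_relabel, map_add, hQ.relabel_add]
  relabel_refl k f := (Φ.equiv _ _).injective <| by
    exact (Φ.map_relabel _ _ _).trans (hQ.relabel_refl _ _)
  relabel_trans e e' k f := (Φ.equiv _ _).injective <| by
    refine (Φ.map_relabel _ _ _).trans ((hQ.relabel_trans _ _ _ _).trans ?_)
    exact ((Φ.map_relabel _ _ _).trans (congrArg _ (Φ.map_relabel _ _ _))).symm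
  comp_add_left f f' g := by
    apply (Φ.equiv _ _).injective
    simp only [Φ.map_comp, map_add, hQ.comp_add_left]
  comp_add_right {l I _ _ k J _ m} f g i a b := by
    apply (Φ.equiv _ _).injective
    have h : ∀ c, (fun j => Φ.equiv (k j) (m j) (Function.update g i c j)) =
        Function.update (fun j => Φ.equiv (k j) (m j) (g j)) i (Φ.equiv (k i) (m i) c) := by
      intro c
      funext j
      by_cases hj : j = i
      · subst hj; simp
      · simp [hj]
    rw [map_add, Φ.map_comp, Φ.map_comp, Φ.map_comp, h, h, h, map_add, hQ.comp_add_right]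
  comp_relabel_left e k J _ m f g := (Φ.equiv _ _).injective <| by
    have h := Φ.map_comp f fun i => g (e i)
    refine Eq.trans ?_ ((Φ.map_relabel _ _ _).trans (congrArg (Q.relabel _ _) h)).symm
    rw [Φ.map_comp, Φ.map_relabel]
    exact hQ.comp_relabel_left _ _ _
  comp_relabel_right e m f g := (Φ.equiv _ _).injective <| by
    have h := Φ.map_comp f g
    refine Eq.trans ?_ ((Φ.map_relabel _ _ _).trans (congrArg (Q.relabel _ _) h)).symm
    rw [Φ.map_comp]
    simp only [Φ.map_relabel]
    exact hQ.comp_relabel_right _ _ _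
  unit_comp {l I _ k} f := (Φ.equiv _ _).injective <| by
    have h := Φ.map_comp (m := fun _ => k) (P.unit l) fun _ : Unit => f
    rw [Φ.map_unit] at h
    exact (Φ.map_relabel _ _ _).trans ((congrArg (Q.relabel _ _) h).trans (hQ.unit_comp _))
  comp_unit {l I _ k} f := (Φ.equiv _ _).injective <| by
    have h := Φ.map_comp (m := fun i _ => k i) f fun i => P.unit (k i)
    simp only [Φ.map_unit] at h
    exact (Φ.map_relabel _ _ _).trans ((congrArg (Q.relabel _ _) h).trans (hQ.comp_unit _))
  assoc {l I _ k J _ m K _ n} f g h := (Φ.equiv _ _).injective <| by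
    have e := Φ.map_comp (m := fun p : Σ i, J i => n p.1 p.2) (P.comp f g) fun p => h p.1 p.2
    rw [Φ.map_comp] at e
    have e' := Φ.map_comp (m := fun i (p : Σ j, K i j) => n i p.1 p.2) f fun i => P.comp (g i) (h i)
    simp only [Φ.map_comp] at e'
    exact (Φ.map_relabel _ _ _).trans ((congrArg (Q.relabel _ _) e).trans
      ((hQ.assoc _ _ _).trans e'.symm))

end OperadData

theorem isOperad_natOperad : natOperad.{u, v}.IsOperad where
  relabel_add _ _ _ _ := rfl
  relabel_refl _ _ := rfl
  relabel_trans _ _ _ _ := rfl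
  comp_add_left _ _ _ := rfl
  comp_add_right {l I _ _ k J _ m} f g i a b := by
    refine Subtype.ext (funext fun X => MultilinearMap.ext fun x => ?_)
    let y : ∀ j, natOperad.obj (k j) (m j) → X.End (k j) := fun j c =>
      NatFamily.app c X fun p => x ⟨j, p⟩
    have h : ∀ c : natOperad.obj (k i) (m i), (fun j => y j (Function.update g i c j)) =
        Function.update (fun j => y j (g j)) i (y i c) := by
      intro c
      funext j
      by_cases hj : j = i
      · subst hj
        rw [Function.update_self, Function.update_self]
      · rw [Function.update_of_ne hj, Function.update_of_ne hj]
    have e := (f.1 X).map_update_add (fun j => y j (g j)) i (y i a) (y i b)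
    rw [← h a, ← h b] at e
    exact (congrArg (f.1 X) (h (a + b))).trans e
  comp_relabel_left _ _ _ _ _ _ _ := rfl
  comp_relabel_right _ _ _ _ := rfl
  unit_comp _ := rfl
  comp_unit _ := rfl
  assoc _ _ _ := rfl

variable {l : ℕ} {I : Type} {k : I → ℕ}

theorem represents_natFamily (T : OpTree l k) {n : ℕ} {J : Type} {m : J → ℕ}
    {g : ∀ i, (freePair.{u, v} m).End (k i)}
    {φ : ∀ i, (Fin (k i) → TreeMonoid n m) → TreeMonoid n m} (hg : ∀ i, Represents (g i) (φ i)) :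
    Represents (NatFamily.app T.natFamily (freePair.{u, v} m) g) (T.1.interp φ) := by
  have e : NatFamily.app T.natFamily (freePair.{u, v} m) g = T.1.operation _ g T.toLegTree.2.2 :=
    T.act_eq (freePair.{u, v} m) g
  rw [e]
  exact represents_operation _ _ hg

theorem natFamily_relabel {J : Type} (e : I ≃ J) (k : J → ℕ) (T : OpTree l (fun i => k (e i))) :
    (T.relabel e k).natFamily = NatFamily.relabel.{u, v} e k T.natFamily := by
  have h := represents_natFamily.{u, v} (T.relabel e k) (n := l)
    (fun i => represents_freeGen i)
  have h' := represents_natFamily.{u, v} T (n := l) (m := k) (g := fun i => freeGen k (e i))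
    (fun i => represents_freeGen (e i))
  refine NatFamily.eq_of_represents h ?_
  intro a
  exact (h' a).trans (congrArg (MonoidAlgebra.single · 1) (RawTree.interp_relabel _ e _ _).symm)

theorem natFamily_corolla (c : ℕ) :
    (OpTree.corolla c).natFamily = NatFamily.unit.{u, v} c :=
  NatFamily.eq_of_represents (represents_natFamily (OpTree.corolla c) fun i => represents_freeGen i)
    (represents_freeGen ())

theorem natFamily_insert {J : I → Type} {m : ∀ i, J i → ℕ} (T : OpTree l k)
    (S : ∀ i, OpTree (k i) (m i)) :
    (T.insert S).natFamily = NatFamily.comp.{u, v} T.natFamily fun i => (S i).natFamily := by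
  have h := represents_natFamily.{u, v} (T.insert S) (n := l) (fun i => represents_freeGen i)
  have h' := represents_natFamily.{u, v} T (n := l) fun i =>
    represents_natFamily.{u, v} (S i) fun j =>
      represents_freeGen (k := fun p : Σ i, J i => m p.1 p.2) ⟨i, j⟩
  refine NatFamily.eq_of_represents h ?_
  intro a
  exact (h' a).trans (congrArg (MonoidAlgebra.single · 1) (RawTree.interp_insert _ _ _ _).symm)

/-- The isomorphism between the group generated by trees and the group of natural families. -/
noncomputable def treeEquiv (l : ℕ) (k : I → ℕ) :
    (OpTree l k →₀ ℤ) ≃+ NatFamily.{u, v} l k :=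
  AddEquiv.ofBijective (treeHom l k) ⟨treeHom_injective, treeHom_surjective⟩

theorem treeHom_mapDomain {J : Type} (e : I ≃ J) (k : J → ℕ)
    (x : OpTree l (fun i => k (e i)) →₀ ℤ) :
    treeHom.{u, v} l k (Finsupp.mapDomain (OpTree.relabel e k) x) =
      NatFamily.relabel e k (treeHom l _ x) := by
  let ρ : NatFamily.{u, v} l (fun i => k (e i)) →+ NatFamily.{u, v} l k :=
    AddMonoidHom.mk' (NatFamily.relabel e k) fun _ _ => rfl
  have h : (treeHom.{u, v} l k).comp (Finsupp.mapDomain.addMonoidHom (OpTree.relabel e k)) =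
      ρ.comp (treeHom l _) := by
    refine Finsupp.addHom_ext fun T n => ?_
    simp only [AddMonoidHom.comp_apply, Finsupp.mapDomain.addMonoidHom_apply,
      Finsupp.mapDomain_single, treeHom_single, map_zsmul, natFamily_relabel]
    rfl
  exact DFunLike.congr_fun h x

theorem app_treeHom (X : SymCat.{u, v}) (f : ∀ i, X.End (k i)) (x : OpTree l k →₀ ℤ) :
    NatFamily.app (treeHom l k x) X f = x.sum fun T n => n • T.act X f := by
  change NatFamily.appHom X f (treeHom l k x) = _
  rw [treeHom, Finsupp.liftAddHom_apply, map_finsuppSum]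
  refine Finsupp.sum_congr fun T _ => ?_
  exact map_zsmul (NatFamily.appHom X f) _ _

theorem treeHom_comp [Finite I] {J : I → Type} [∀ i, Finite (J i)] {m : ∀ i, J i → ℕ}
    (x : OpTree l k →₀ ℤ) (y : ∀ i, OpTree (k i) (m i) →₀ ℤ) :
    treeHom.{u, v} l (fun p : Σ i, J i => m p.1 p.2) (treeOperad.comp x y) =
      NatFamily.comp (treeHom l k x) fun i => treeHom (k i) (m i) (y i) := by
  classical
  let := Fintype.ofFinite I
  refine Subtype.ext (funext fun X => MultilinearMap.ext fun f => ?_)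
  have hy : ∀ i, NatFamily.app (treeHom (k i) (m i) (y i)) X (fun j => f ⟨i, j⟩) =
      ∑ S ∈ (y i).support, y i S • S.act X (fun j => f ⟨i, j⟩) := fun i => app_treeHom X _ _
  have hr : NatFamily.app (NatFamily.comp (treeHom l k x) fun i => treeHom (k i) (m i) (y i)) X f =
      x.sum fun T n => n • T.act X fun i =>
        ∑ S ∈ (y i).support, y i S • S.act X (fun j => f ⟨i, j⟩) := by
    simp only [← hy]
    exact app_treeHom X _ x
  refine Eq.trans ?_ hr.symm
  change NatFamily.appHom X f (treeHom l _ (x.sum fun T a => _)) = _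
  rw [map_finsuppSum, map_finsuppSum]
  refine Finsupp.sum_congr fun T _ => ?_
  have hT : (T.act X fun i => ∑ S ∈ (y i).support, y i S • S.act X (fun j => f ⟨i, j⟩)) =
      ∑ S ∈ Fintype.piFinset fun i => (y i).support,
        (∏ i, y i (S i)) • (T.insert S).act X f := by
    refine ((T.natFamily.1 X).map_sum_finset _ _).trans (Finset.sum_congr rfl fun S _ => ?_)
    refine ((T.natFamily.1 X).map_smul_univ _ _).trans (congrArg ((∏ i, y i (S i)) • ·) ?_)
    exact congrArg (fun α => NatFamily.app α X f) (natFamily_insert T S).symm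
  rw [hT, Finset.smul_sum, map_sum, map_sum]
  refine Finset.sum_congr (by congr) fun S _ => ?_
  rw [treeHom_single, map_zsmul, smul_smul]
  rfl

end Operads

theorem mainTheorem3 :
    treeOperad.IsOperad ∧ natOperad.{u, v}.IsOperad ∧
    ∃ Φ : OperadData.Iso treeOperad natOperad.{u, v},
      ∀ (l : ℕ) (I : Type) [Finite I] (k : I → ℕ) (T : OpTree l k) (X : SymCat.{u, v})
        (f : ∀ i, X.End (k i)),
        NatFamily.app (Φ.equiv l k (Finsupp.single T 1)) X f = T.act X f := by
  have hunit : ∀ {l : ℕ} {I : Type} {k : I → ℕ} (T : OpTree l k),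
      treeHom.{u, v} l k (Finsupp.single T 1) = T.natFamily := fun T => by
    rw [treeHom_single, one_zsmul]
  let Φ : OperadData.Iso treeOperad natOperad.{u, v} :=
    { equiv := fun l _ _ k => treeEquiv l k
      map_relabel := fun e k x => treeHom_mapDomain e k x
      map_unit := fun c => (hunit _).trans (natFamily_corolla c)
      map_comp := fun x y => treeHom_comp x y }
  refine ⟨isOperad_natOperad.of_iso Φ, isOperad_natOperad, Φ, fun l I _ k T X f => ?_⟩
  exact congrArg (fun α => NatFamily.app α X f) (hunit T)
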